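/- All graphs are finite, simple and connected. For a graph $G$ let $N(v)$ and $d(v)$ denote the neighbourhood and the degree of a vertex $v$. A dynamic 3-colouring of $G$ is a map $c:V(G)\to\{1,2,3\}$ with $c(u)\ne c(v)$ for all adjacent $u,v$ and $|c(N(v))|\ge\min\{d(v),2\}$ for all vertices $v$; $G$ is dynamically 3-colourable if it has one. For $i\ge 2$ let $A_i$ denote any subgraph of $G$ that is a path with $i$ vertices whose two end-vertices have degree 3 in $G$ and whose $i-2$ internal vertices have degree 2 in $G$. Let $\mathscr C$ be the class of graphs of maximum degree at most 3 that contain no induced $K_{1,3}$ and no $A_i$ with $i=3j+1$, $j\ge 1$. Let $\mathscr T$ be the class of graphs that consist of an even number of vertex-disjoint triangles covering all vertices, together with further edges that join every vertex to exactly one vertex outside its own triangle (so these edges form a perfect matching, and the graph is 3-regular). Running times are worst-case numbers of steps of a random access machine with unit costs, the graph being given by adjacency lists; $n$ is the number of vertices unless said otherwise. (1) There is an algorithm that, given any dynamically 3-colourable graph in $\mathscr C$ with $n$ vertices, finds a dynamic 3-colouring of it in $O(n)$ time. If $n\ge 3$, the colouring found uses all three colours. (2) If $G\in\mathscr T$ has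 exactly $m$ triangles, then its independence number is $\alpha(G)=m$. Every maximum independent set $S$ of $G$ meets every triangle of $G$, and $G\setminus S$ is bipartite. (This part holds for disconnected graphs as well.) (3) There is an algorithm that, given any graph in $\mathscr T$ with $n$ vertices, finds a maximum independent set of it in $O(n)$ time. (4) There is an algorithm that, given any graph $G\in\mathscr T$ with $n$ vertices and any maximum independent set $S$ of $G$, finds in $O(n)$ time a proper 3-colouring of $G$ in which $S$ is the set of vertices of the third colour, that is, it colours $G\setminus S$ properly with the other two colours. -/

import Mathlib

/-! ### Dynamic colorings and the two graph classes -/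

/-- The adjacency condition and the double-adjacency condition for a coloring `c` with colors
from a set of `k` colors: adjacent vertices get different colors, and the neighbors of every
vertex `v` carry at least `min {d(v), 2}` different colors. -/
def IsDynamicColoring {V : Type*} (G : SimpleGraph V) [G.LocallyFinite] {k : ℕ}
    (c : V → Fin k) : Prop :=
  (∀ u v, G.Adj u v → c u ≠ c v) ∧
    ∀ v, min (G.degree v) 2 ≤ ((G.neighborFinset v).image c).card

/-- No induced subgraph is isomorphic to `K_{1,3}`. -/
def IsClawFree {V : Type*} (G : SimpleGraph V) : Prop :=
  ¬ (completeBipartiteGraph (Fin 1) (Fin 3)).IsIndContained G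

/-- `G` has a subgraph `A_i`: a path with `i` vertices whose two end-vertices have degree 3 in `G`
and whose internal vertices all have degree 2 in `G`. -/
def HasSubgraphA {V : Type*} (G : SimpleGraph V) [G.LocallyFinite] (i : ℕ) : Prop :=
  ∃ (u v : V) (p : G.Walk u v), p.IsPath ∧ p.support.length = i ∧
    G.degree u = 3 ∧ G.degree v = 3 ∧ ∀ w ∈ p.support, w ≠ u → w ≠ v → G.degree w = 2

/-- The class `𝒞`: maximum degree at most 3, claw-free, and `A_i`-free for every
`i = 3j + 1`, `j ≥ 1`. -/
def InClassC {V : Type*} (G : SimpleGraph V) [G.LocallyFinite] : Prop :=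
  (∀ v, G.degree v ≤ 3) ∧ IsClawFree G ∧ ∀ j : ℕ, 1 ≤ j → ¬ HasSubgraphA G (3 * j + 1)

/-- The class `𝒯`: the vertex set is partitioned into a family `T` of an even number of triangles,
and the edges outside these triangles join every vertex to exactly one further vertex, which lies
in another triangle. -/
def InClassT {V : Type*} (G : SimpleGraph V) : Prop :=
  ∃ T : Finset (Finset V), Even T.card ∧
    (∀ t ∈ T, G.IsNClique 3 t) ∧
    (∀ v, ∃! t, t ∈ T ∧ v ∈ t) ∧
    ∀ v, ∃! u, G.Adj v u ∧ ¬ ∃ t ∈ T, v ∈ t ∧ u ∈ t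

/-! ### A random access machine with unit costs

A program works on registers and on arrays of natural numbers. Its only arithmetic is adding and
subtracting 1, so after `t` steps no cell exceeds the largest number in the input and in the
program by more than `t`: in linear time all words have `O(log n)` bits. -/

/-- The memory: `reg x` is the content of register `x`, and `arr a i` is the content of cell `i`
of array `a`. -/
structure RamState where
  reg : ℕ → ℕ
  arr : ℕ → ℕ → ℕ

/-- Overwrite register `x` by `k`. -/
def RamState.setReg (s : RamState) (x k : ℕ) : RamState :=
  { s with reg := Function.update s.reg x k }

/-- Overwrite cell `i` of array `a` by `k`. -/
def RamState.setArr (s : RamState) (a i k : ℕ) : RamState :=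
  { s with arr := Function.update s.arr a (Function.update (s.arr a) i k) }

/-- Comparisons of two registers. -/
inductive RamTest where
  | eq (x y : ℕ)
  | lt (x y : ℕ)

def RamTest.Holds (s : RamState) : RamTest → Prop
  | .eq x y => s.reg x = s.reg y
  | .lt x y => s.reg x < s.reg y

/-- Programs. Here `x`, `y`, `i` are names of registers, `a` is the name of an array and `k` is a
constant; `load x a i` is `x := a[i]` and `store a i x` is `a[i] := x`. -/
inductive RamProg where
  | skip
  | const (x k : ℕ)
  | copy (x y : ℕ)
  | succ (x : ℕ)
  | pred (x : ℕ)
  | load (x a i : ℕ)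
  | store (a i x : ℕ)
  | seq (p q : RamProg)
  | cond (b : RamTest) (p q : RamProg)
  | loop (b : RamTest) (p : RamProg)

/-- `Exec p s t s'`: started in the memory `s`, the program `p` halts after exactly `t` steps with
the memory `s'`. Every elementary instruction and every evaluation of a test is one step. -/
inductive RamProg.Exec : RamProg → RamState → ℕ → RamState → Prop where
  | skip (s) : Exec .skip s 1 s
  | const (s x k) : Exec (.const x k) s 1 (s.setReg x k)
  | copy (s x y) : Exec (.copy x y) s 1 (s.setReg x (s.reg y))
  | succ (s x) : Exec (.succ x) s 1 (s.setReg x (s.reg x + 1))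
  | pred (s x) : Exec (.pred x) s 1 (s.setReg x (s.reg x - 1))
  | load (s x a i) : Exec (.load x a i) s 1 (s.setReg x (s.arr a (s.reg i)))
  | store (s a i x) : Exec (.store a i x) s 1 (s.setArr a (s.reg i) (s.reg x))
  | seq {p q s s' s'' t t'} : Exec p s t s' → Exec q s' t' s'' → Exec (.seq p q) s (t + t') s''
  | cond_true {b p q s s' t} : b.Holds s → Exec p s t s' → Exec (.cond b p q) s (t + 1) s'
  | cond_false {b p q s s' t} : ¬ b.Holds s → Exec q s t s' → Exec (.cond b p q) s (t + 1) s'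
  | loop_true {b p s s' s'' t t'} : b.Holds s → Exec p s t s' → Exec (.loop b p) s' t' s'' →
      Exec (.loop b p) s (t + t' + 1) s''
  | loop_false {b p s} : ¬ b.Holds s → Exec (.loop b p) s 1 s

/-! ### Graphs as inputs -/

/-- `nb` is an adjacency-list representation of `G`: the list `nb v` contains every neighbor of
`v` exactly once, in an arbitrary order. -/
def IsAdjacencyLists {n : ℕ} (G : SimpleGraph (Fin n)) (nb : Fin n → List (Fin n)) : Prop :=
  ∀ v, (nb v).Nodup ∧ ∀ u, u ∈ nb v ↔ G.Adj v u

/-- The initial memory for a graph of maximum degree at most 3 on the vertices `0, …, n - 1`, given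
by adjacency lists. Register 0 holds `n`, cell `v` of array 0 holds the degree of `v`, and cell `v`
of array `j = 1, 2, 3` holds the `j`-th neighbor of `v`, if there is one. Everything else is 0. -/
def graphInput {n : ℕ} (nb : Fin n → List (Fin n)) : RamState where
  reg x := if x = 0 then n else 0
  arr a i :=
    if h : i < n then
      if a = 0 then (nb ⟨i, h⟩).length
      else if a ≤ 3 then (((nb ⟨i, h⟩).map Fin.val)[a - 1]?).getD 0
      else 0
    else 0

/-- The initial memory for a graph as above together with a vertex set `S`, whose indicator
function is stored in array 5. -/
def graphSetInput {n : ℕ} (nb : Fin n → List (Fin n)) (S : Finset (Fin n)) : RamState where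
  reg := (graphInput nb).reg
  arr a i :=
    if a = 5 then (if i ∈ S.image Fin.val then 1 else 0) else (graphInput nb).arr a i

/-- Started in the memory `s`, the program `p` halts after at most `T` steps, and then the first
`n` cells of array 4 hold `out 0, …, out (n - 1)`. -/
def ComputesWithin (p : RamProg) (s : RamState) (T : ℕ) {n : ℕ} (out : Fin n → ℕ) : Prop :=
  ∃ t ≤ T, ∃ s', p.Exec s t s' ∧ ∀ v : Fin n, s'.arr 4 v = out v

/-! In a claw-free graph of maximum degree at most 3 every vertex lies in exactly one triangle
(`SingleAt`), in several (`CenterAt`), or in none, and in the last case it has at most two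
neighbours (`PlainAt`). The edges whose ends have no common neighbour (`outerGraph`) form disjoint
paths and cycles, and a triangle vertex can only be an end of such a path. A dynamic 3-colouring
gives different colours to any three consecutive vertices of a path of this kind, so it is
determined there up to a permutation of the colours and has period 3. Two distinct triangle vertices
that are the ends of one path could share a colour only if the path had `3j` edges, and so were a
forbidden `A_{3j+1}`; hence they always differ (`LocTri.color_ne`).

Each path may therefore be contracted to a link between its ends. It suffices to colour the
triangles so that linked vertices differ. The labels of the two ends then differ as well as their
prescribed colours, so some permutation of the colours makes the labels along the path fit
(`fill_spec`, `LocTri.finalColor_spec`).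

Triangles that share no vertex with another triangle are coloured as follows. A walk that enters a
triangle through a link chooses a vertex other than its entrance and leaves through the link of the
chosen vertex; this yields a set with one vertex in each triangle and no two linked vertices
(`TransversalInv.process`). Outside this set one side of each triangle remains, and these sides
alternate with links along paths and even cycles, which takes two colours (`ColorInv.extend`). All
other triangles lie in diamonds, because a 3-coloured graph contains no `K_4`. The two ends of a
diamond get one colour that avoids the colours of their at most two mates (`DiaColoring.step`).

In a graph of class `𝒯` the links are the matching edges. An independent set has at most one vertex
in each triangle, and the walk produces a set that attains this bound, so the maximum independent
sets are exactly the independent transversals. Existence of the set and of the two-colouring is read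
off from the correctness of the programs (`RamProg.Spec.exists_post`).

Every program is a sequence of pointwise array maps and of single loops with a decreasing measure of
linear size (`RamProg.phase_spec`). The given dynamic colouring occurs in the invariants only; no
program has access to it. -/

/-! ### A small structured language compiled to random access programs -/

/-- Expressions; `ite a b c d` is `c` if `a = b` and `d` otherwise. -/
inductive Ex where
  | var (x : ℕ)
  | lit (k : ℕ)
  | succ (e : Ex)
  | rd (a : ℕ) (e : Ex)
  | ite (a b c d : Ex)

namespace Ex

def eval (ρ : ℕ → ℕ) (A : ℕ → ℕ → ℕ) : Ex → ℕ
  | var x => ρ x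
  | lit k => k
  | succ e => e.eval ρ A + 1
  | rd a e => A a (e.eval ρ A)
  | ite a b c d => if a.eval ρ A = b.eval ρ A then c.eval ρ A else d.eval ρ A

/-- All variables of the expression are smaller than `d`. -/
def varsLt (d : ℕ) : Ex → Bool
  | var x => decide (x < d)
  | lit _ => true
  | succ e => e.varsLt d
  | rd _ e => e.varsLt d
  | ite a b c e => a.varsLt d && b.varsLt d && c.varsLt d && e.varsLt d

/-- The expression does not read the array `a`. -/
def avoids (a : ℕ) : Ex → Bool
  | var _ => true
  | lit _ => true
  | succ e => e.avoids a
  | rd b e => decide (b ≠ a) && e.avoids a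
  | ite e f g h => e.avoids a && f.avoids a && g.avoids a && h.avoids a

/-- The program that computes the value into register `d`, using only registers from `d` on. -/
def code : Ex → ℕ → RamProg
  | var x, d => .copy d x
  | lit k, d => .const d k
  | succ e, d => .seq (e.code d) (.succ d)
  | rd a e, d => .seq (e.code d) (.load d a d)
  | ite a b c e, d =>
      .seq (a.code d) (.seq (b.code (d + 1)) (.cond (.eq d (d + 1)) (c.code d) (e.code d)))

def cost : Ex → ℕ
  | var _ => 1
  | lit _ => 1
  | succ e => e.cost + 1
  | rd _ e => e.cost + 1
  | ite a b c d => a.cost + b.cost + c.cost + d.cost + 1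

theorem varsLt_mono {d d' : ℕ} (h : d ≤ d') : ∀ e : Ex, e.varsLt d → e.varsLt d'
  | var x => by simp only [varsLt, decide_eq_true_eq]; omega
  | lit _ => by simp [varsLt]
  | succ e => by simpa [varsLt] using varsLt_mono h e
  | rd a e => by simpa [varsLt] using varsLt_mono h e
  | ite a b c e => by
      simp only [varsLt, Bool.and_eq_true]
      rintro ⟨⟨⟨h1, h2⟩, h3⟩, h4⟩
      exact ⟨⟨⟨varsLt_mono h a h1, varsLt_mono h b h2⟩, varsLt_mono h c h3⟩, varsLt_mono h e h4⟩

theorem eval_congr {d : ℕ} {ρ ρ' : ℕ → ℕ} (A : ℕ → ℕ → ℕ) (h : ∀ x < d, ρ x = ρ' x) :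
    ∀ e : Ex, e.varsLt d → e.eval ρ A = e.eval ρ' A
  | var x => by simp only [varsLt, decide_eq_true_eq]; exact h x
  | lit _ => fun _ => rfl
  | succ e => fun he => by simp only [eval]; rw [eval_congr A h e he]
  | rd a e => fun he => by simp only [eval]; rw [eval_congr A h e he]
  | ite a b c e => by
      simp only [varsLt, Bool.and_eq_true]
      rintro ⟨⟨⟨h1, h2⟩, h3⟩, h4⟩
      simp only [eval]
      rw [eval_congr A h a h1, eval_congr A h b h2, eval_congr A h c h3, eval_congr A h e h4]

theorem eval_congr_arr {a : ℕ} (ρ : ℕ → ℕ) {A A' : ℕ → ℕ → ℕ} (h : ∀ b ≠ a, A b = A' b) :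
    ∀ e : Ex, e.avoids a → e.eval ρ A = e.eval ρ A'
  | var _ => fun _ => rfl
  | lit _ => fun _ => rfl
  | succ e => fun he => by simp only [eval]; rw [eval_congr_arr ρ h e he]
  | rd b e => by
      simp only [avoids, Bool.and_eq_true, decide_eq_true_eq]
      rintro ⟨h1, h2⟩
      simp only [eval]
      rw [eval_congr_arr ρ h e h2, h b h1]
  | ite e f g k => by
      simp only [avoids, Bool.and_eq_true]
      rintro ⟨⟨⟨h1, h2⟩, h3⟩, h4⟩
      simp only [eval]
      rw [eval_congr_arr ρ h e h1, eval_congr_arr ρ h f h2, eval_congr_arr ρ h g h3,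
        eval_congr_arr ρ h k h4]

/-- The registers below `d` are preserved, so a compound expression can keep one operand in `d`
while the next is computed in `d + 1`. The cost is only an upper bound, since it counts both
branches of a conditional. -/
theorem code_exec : ∀ (e : Ex) (d : ℕ) (s : RamState), e.varsLt d →
    ∃ t ≤ e.cost, ∃ s', (e.code d).Exec s t s' ∧ s'.arr = s.arr ∧
      (∀ x < d, s'.reg x = s.reg x) ∧ s'.reg d = e.eval s.reg s.arr
  | var x, d, s, _ => ⟨1, le_rfl, _, .copy s d x, rfl,
      fun y hy => by simp [RamState.setReg, hy.ne], by simp [RamState.setReg, eval]⟩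
  | lit k, d, s, _ => ⟨1, le_rfl, _, .const s d k, rfl,
      fun y hy => by simp [RamState.setReg, hy.ne], by simp [RamState.setReg, eval]⟩
  | succ e, d, s, he => by
      obtain ⟨t, ht, s', h1, h2, h3, h4⟩ := code_exec e d s he
      exact ⟨_, Nat.add_le_add_right ht 1, _, .seq h1 (.succ s' d), h2,
        fun y hy => by simp [RamState.setReg, hy.ne, h3 y hy],
        by simp [RamState.setReg, eval, h4]⟩
  | rd a e, d, s, he => by
      obtain ⟨t, ht, s', h1, h2, h3, h4⟩ := code_exec e d s he
      exact ⟨_, Nat.add_le_add_right ht 1, _, .seq h1 (.load s' d a d), h2,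
        fun y hy => by simp [RamState.setReg, hy.ne, h3 y hy],
        by simp [RamState.setReg, eval, h4, h2]⟩
  | ite a b c e, d, s, he => by
      simp only [varsLt, Bool.and_eq_true] at he
      obtain ⟨⟨⟨ha, hb⟩, hc⟩, he⟩ := he
      obtain ⟨t1, ht1, s1, x1, a1, r1, v1⟩ := code_exec a d s ha
      obtain ⟨t2, ht2, s2, x2, a2, r2, v2⟩ :=
        code_exec b (d + 1) s1 (varsLt_mono (Nat.le_succ d) b hb)
      have r2' : ∀ x < d, s2.reg x = s.reg x := fun x hx => by
        rw [r2 x (by omega), r1 x hx]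
      have hv1 : s2.reg d = a.eval s.reg s.arr := by rw [r2 d (by omega), v1]
      have hv2 : s2.reg (d + 1) = b.eval s.reg s.arr := by
        rw [v2, a1, eval_congr s.arr r1 b hb]
      have a2' : s2.arr = s.arr := a2.trans a1
      by_cases hab : a.eval s.reg s.arr = b.eval s.reg s.arr
      · obtain ⟨t3, ht3, s3, x3, a3, r3, v3⟩ := code_exec c d s2 hc
        refine ⟨t1 + (t2 + (t3 + 1)), by simp only [cost]; omega, s3,
          .seq x1 (.seq x2 (.cond_true ?_ x3)), a3.trans a2',
          fun x hx => (r3 x hx).trans (r2' x hx), ?_⟩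
        · show s2.reg d = s2.reg (d + 1)
          rw [hv1, hv2, hab]
        · rw [v3, a2', eval_congr s.arr r2' c hc]; simp only [eval]; rw [if_pos hab]
      · obtain ⟨t3, ht3, s3, x3, a3, r3, v3⟩ := code_exec e d s2 he
        refine ⟨t1 + (t2 + (t3 + 1)), by simp only [cost]; omega, s3,
          .seq x1 (.seq x2 (.cond_false ?_ x3)), a3.trans a2',
          fun x hx => (r3 x hx).trans (r2' x hx), ?_⟩
        · show ¬ s2.reg d = s2.reg (d + 1)
          rw [hv1, hv2]; exact hab
        · rw [v3, a2', eval_congr s.arr r2' e he]; simp only [eval]; rw [if_neg hab]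

end Ex

/-- Loop-free statements. -/
inductive St where
  | set (x : ℕ) (e : Ex)
  | put (a : ℕ) (i e : Ex)
  | ite (a b : Ex) (p q : St)
  | seq (p q : St)

infixr:60 " ;; " => St.seq

/-- The registers from here on serve as temporary storage of compiled programs. -/
abbrev tempReg : ℕ := 20

namespace St

def run : St → RamState → RamState
  | set x e, s => s.setReg x (e.eval s.reg s.arr)
  | put a i e, s => s.setArr a (i.eval s.reg s.arr) (e.eval s.reg s.arr)
  | ite a b p q, s => if a.eval s.reg s.arr = b.eval s.reg s.arr then p.run s else q.run s
  | seq p q, s => q.run (p.run s)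

def ok : St → Bool
  | set x e => decide (x < tempReg) && e.varsLt tempReg
  | put _ i e => i.varsLt tempReg && e.varsLt tempReg
  | ite a b p q => a.varsLt tempReg && b.varsLt tempReg && p.ok && q.ok
  | seq p q => p.ok && q.ok

def code : St → RamProg
  | set x e => .seq (e.code tempReg) (.copy x tempReg)
  | put a i e =>
      .seq (i.code tempReg) (.seq (e.code (tempReg + 1)) (.store a tempReg (tempReg + 1)))
  | ite a b p q => .seq (a.code tempReg) (.seq (b.code (tempReg + 1))
      (.cond (.eq tempReg (tempReg + 1)) p.code q.code))
  | seq p q => .seq p.code q.code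

def cost : St → ℕ
  | set _ e => e.cost + 1
  | put _ i e => i.cost + e.cost + 1
  | ite a b p q => a.cost + b.cost + p.cost + q.cost + 1
  | seq p q => p.cost + q.cost

end St

/-- Two memories that agree up to the temporary registers. -/
def RamState.Agree (s s' : RamState) : Prop :=
  s.arr = s'.arr ∧ ∀ x < tempReg, s.reg x = s'.reg x

/-- Compiled code overwrites temporary registers, which `run` leaves alone; hence the comparison by
`Agree`. The check `ok` guarantees that no variable of the statement is a temporary register. -/
theorem St.code_exec : ∀ (p : St) (s₀ s : RamState), p.ok → s₀.Agree s →
    ∃ t ≤ p.cost, ∃ s₀', p.code.Exec s₀ t s₀' ∧ s₀'.Agree (p.run s)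
  | set x e, s₀, s, h, hs => by
      simp only [ok, Bool.and_eq_true, decide_eq_true_eq] at h
      obtain ⟨t, ht, s', h1, h2, h3, h4⟩ := e.code_exec tempReg s₀ h.2
      refine ⟨_, Nat.add_le_add_right ht 1, _, .seq h1 (.copy s' x tempReg), h2.trans hs.1,
        fun y hy => ?_⟩
      simp only [RamState.setReg, run, Function.update_apply]
      rw [h4, hs.1, Ex.eval_congr s.arr hs.2 e h.2, h3 y hy, hs.2 y hy]
  | put a i e, s₀, s, h, hs => by
      simp only [ok, Bool.and_eq_true] at h
      obtain ⟨t1, ht1, s1, x1, a1, r1, v1⟩ := i.code_exec tempReg s₀ h.1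
      obtain ⟨t2, ht2, s2, x2, a2, r2, v2⟩ :=
        e.code_exec (tempReg + 1) s1 (Ex.varsLt_mono (Nat.le_succ _) e h.2)
      refine ⟨_, by simp only [cost]; omega, _, .seq x1 (.seq x2 (.store s2 a _ _)), ?_,
        fun y hy => ?_⟩
      · simp only [RamState.setArr, run]
        rw [v2, r2 tempReg (by omega), v1, a2, a1, hs.1, Ex.eval_congr s.arr hs.2 i h.1,
          Ex.eval_congr s.arr (fun x hx => (r1 x hx).trans (hs.2 x hx)) e h.2]
      · simp only [RamState.setArr, run]
        rw [r2 y (by omega), r1 y hy, hs.2 y hy]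
  | ite a b p q, s₀, s, h, hs => by
      simp only [ok, Bool.and_eq_true] at h
      obtain ⟨⟨⟨ha, hb⟩, hp⟩, hq⟩ := h
      obtain ⟨t1, ht1, s1, x1, a1, r1, v1⟩ := a.code_exec tempReg s₀ ha
      obtain ⟨t2, ht2, s2, x2, a2, r2, v2⟩ :=
        b.code_exec (tempReg + 1) s1 (Ex.varsLt_mono (Nat.le_succ _) b hb)
      have hs2 : s2.Agree s := ⟨a2.trans (a1.trans hs.1), fun y hy => by
        rw [r2 y (by omega), r1 y hy, hs.2 y hy]⟩
      have hv1 : s2.reg tempReg = a.eval s.reg s.arr := by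
        rw [r2 _ (by omega), v1, hs.1, Ex.eval_congr s.arr hs.2 a ha]
      have hv2 : s2.reg (tempReg + 1) = b.eval s.reg s.arr := by
        rw [v2, a1, hs.1, Ex.eval_congr s.arr (fun x hx => (r1 x hx).trans (hs.2 x hx)) b hb]
      by_cases hab : a.eval s.reg s.arr = b.eval s.reg s.arr
      · obtain ⟨t3, ht3, s3, x3, h3⟩ := code_exec p s2 s hp hs2
        refine ⟨_, ?_, s3, .seq x1 (.seq x2 (.cond_true ?_ x3)), ?_⟩
        · simp only [cost]; omega
        · show s2.reg _ = s2.reg _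
          rw [hv1, hv2, hab]
        · simpa only [run, if_pos hab] using h3
      · obtain ⟨t3, ht3, s3, x3, h3⟩ := code_exec q s2 s hq hs2
        refine ⟨_, ?_, s3, .seq x1 (.seq x2 (.cond_false ?_ x3)), ?_⟩
        · simp only [cost]; omega
        · show ¬ s2.reg _ = s2.reg _
          rw [hv1, hv2]; exact hab
        · simpa only [run, if_neg hab] using h3
  | seq p q, s₀, s, h, hs => by
      simp only [ok, Bool.and_eq_true] at h
      obtain ⟨t1, ht1, s1, x1, h1⟩ := code_exec p s₀ s h.1 hs
      obtain ⟨t2, ht2, s2, x2, h2⟩ := code_exec q s1 _ h.2 h1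
      exact ⟨_, by simp only [cost]; omega, s2, .seq x1 x2, h2⟩

/-- The rule for a loop that runs while register 1 is smaller than register 0: an invariant and a
measure that decreases in every round. -/
theorem RamProg.loop_exec {body : St} (hok : body.ok) {I : RamState → Prop} {μ : RamState → ℕ}
    (h : ∀ s, I s → s.reg 1 < s.reg 0 → I (body.run s) ∧ μ (body.run s) < μ s) :
    ∀ (m : ℕ) (s₀ s : RamState), μ s ≤ m → s₀.Agree s → I s →
      ∃ t ≤ (body.cost + 1) * m + 1, ∃ s₀' s', (RamProg.loop (.lt 1 0) body.code).Exec s₀ t s₀' ∧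
        s₀'.Agree s' ∧ I s' ∧ ¬ s'.reg 1 < s'.reg 0 := by
  intro m
  induction m with
  | zero =>
    intro s₀ s hm hs hI
    have hn : ¬ s.reg 1 < s.reg 0 := fun hlt => by
      have := (h s hI hlt).2
      omega
    refine ⟨1, by omega, s₀, s, .loop_false ?_, hs, hI, hn⟩
    show ¬ s₀.reg 1 < s₀.reg 0
    rwa [hs.2 1 (by decide), hs.2 0 (by decide)]
  | succ m ih =>
    intro s₀ s hm hs hI
    by_cases hlt : s.reg 1 < s.reg 0
    · obtain ⟨hI', hμ⟩ := h s hI hlt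
      obtain ⟨t1, ht1, s1, x1, h1⟩ := body.code_exec s₀ s hok hs
      obtain ⟨t2, ht2, s2, s', x2, h2⟩ := ih s1 _ (by omega) h1 hI'
      refine ⟨t1 + t2 + 1, ?_, s2, s', .loop_true ?_ x1 x2, h2⟩
      · have : (body.cost + 1) * (m + 1) = (body.cost + 1) * m + body.cost + 1 := by ring
        omega
      · show s₀.reg 1 < s₀.reg 0
        rwa [hs.2 1 (by decide), hs.2 0 (by decide)]
    · refine ⟨1, by omega, s₀, s, .loop_false ?_, hs, hI, hlt⟩
      show ¬ s₀.reg 1 < s₀.reg 0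
      rwa [hs.2 1 (by decide), hs.2 0 (by decide)]

/-! ### Linear-time specifications -/

/-- `p` runs in time linear in the content `n` of register 0, which it leaves unchanged, and turns
arrays satisfying `Pre n` into arrays related to them by `Post n`. -/
def RamProg.Spec (p : RamProg) (Pre : ℕ → (ℕ → ℕ → ℕ) → Prop)
    (Post : ℕ → (ℕ → ℕ → ℕ) → (ℕ → ℕ → ℕ) → Prop) : Prop :=
  ∃ C, ∀ s : RamState, Pre (s.reg 0) s.arr →
    ∃ t ≤ C * (s.reg 0 + 1), ∃ s', p.Exec s t s' ∧ s'.reg 0 = s.reg 0 ∧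
      Post (s.reg 0) s.arr s'.arr

namespace RamProg.Spec

variable {p q : RamProg} {P P' : ℕ → (ℕ → ℕ → ℕ) → Prop}
  {Q Q' : ℕ → (ℕ → ℕ → ℕ) → (ℕ → ℕ → ℕ) → Prop}

theorem seq (h : p.Spec P Q) (h' : q.Spec P' Q') (hmid : ∀ n A A', P n A → Q n A A' → P' n A') :
    (RamProg.seq p q).Spec P (fun n A A'' => ∃ A', Q n A A' ∧ Q' n A' A'') := by
  obtain ⟨C, h⟩ := h
  obtain ⟨C', h'⟩ := h'
  refine ⟨C + C', fun s hs => ?_⟩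
  obtain ⟨t, ht, s1, x1, r1, q1⟩ := h s hs
  obtain ⟨t', ht', s2, x2, r2, q2⟩ := h' s1 (by rw [r1]; exact hmid _ _ _ hs q1)
  rw [r1] at ht' r2 q2
  exact ⟨t + t', by rw [add_mul]; omega, s2, .seq x1 x2, r2, _, q1, q2⟩

theorem weaken (h : p.Spec P Q) (hP : ∀ n A, P' n A → P n A)
    (hQ : ∀ n A A', P' n A → Q n A A' → Q' n A A') : p.Spec P' Q' := by
  obtain ⟨C, h⟩ := h
  refine ⟨C, fun s hs => ?_⟩
  obtain ⟨t, ht, s1, x1, r1, q1⟩ := h s (hP _ _ hs)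
  exact ⟨t, ht, s1, x1, r1, hQ _ _ _ hs q1⟩

end RamProg.Spec

/-- A program that consists of an initialization and one loop. -/
def RamProg.phase (init body : St) : RamProg := .seq init.code (.loop (.lt 1 0) body.code)

/-- A round costs at most `body.cost + 1` steps and lowers `μ`, so a linear bound on the initial
value of `μ` bounds the whole loop linearly. The invariant may mention the initial arrays `A`, which
lets the postcondition compare input and output. -/
theorem RamProg.phase_spec {init body : St} (hinit : init.ok) (hbody : body.ok)
    {P : ℕ → (ℕ → ℕ → ℕ) → Prop} {Q : ℕ → (ℕ → ℕ → ℕ) → (ℕ → ℕ → ℕ) → Prop}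
    (I : ℕ → (ℕ → ℕ → ℕ) → RamState → Prop) (μ : RamState → ℕ) (K : ℕ)
    (h0 : ∀ n A s, s.reg 0 = n → s.arr = A → P n A →
      I n A (init.run s) ∧ μ (init.run s) ≤ K * (n + 1))
    (h1 : ∀ n A s, P n A → I n A s → s.reg 1 < s.reg 0 →
      I n A (body.run s) ∧ μ (body.run s) < μ s)
    (h2 : ∀ n A s, P n A → I n A s → ¬ s.reg 1 < s.reg 0 → s.reg 0 = n ∧ Q n A s.arr) :
    (RamProg.phase init body).Spec P Q := by
  refine ⟨init.cost + (body.cost + 1) * K + 1, fun s hs => ?_⟩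
  obtain ⟨hI, hμ⟩ := h0 _ _ s rfl rfl hs
  obtain ⟨t1, ht1, s1, x1, a1⟩ := init.code_exec s s hinit ⟨rfl, fun _ _ => rfl⟩
  obtain ⟨t2, ht2, s2, s', x2, a2, hI', hlt⟩ :=
    RamProg.loop_exec hbody (h1 (s.reg 0) s.arr · hs) _ s1 _ hμ a1 hI
  obtain ⟨hn, hq⟩ := h2 _ _ _ hs hI' hlt
  refine ⟨t1 + t2, ?_, s2, .seq x1 x2, ?_, ?_⟩
  · calc t1 + t2 ≤ init.cost + ((body.cost + 1) * (K * (s.reg 0 + 1)) + 1) := by omega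
      _ ≤ _ := by nlinarith [Nat.zero_le (init.cost * s.reg 0)]
  · rw [a2.2 0 (by decide), hn]
  · rw [a2.1]; exact hq

/-! ### Pointwise array maps -/

/-- The arrays after cell `i` of array `a` has been set to the value of `e` at `i`, for all
`i < n`; variable 0 stands for `n` and variable 1 for `i`. -/
def mapArr (n a : ℕ) (e : Ex) (A : ℕ → ℕ → ℕ) : ℕ → ℕ → ℕ :=
  Function.update A a fun v =>
    if v < n then e.eval (fun x => if x = 0 then n else v) A else A a v

theorem mapArr_of_ne {n a b : ℕ} (e : Ex) (A : ℕ → ℕ → ℕ) (h : b ≠ a) : mapArr n a e A b = A b := by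
  simp [mapArr, h]

theorem mapArr_self {n a v : ℕ} (e : Ex) (A : ℕ → ℕ → ℕ) (h : v < n) :
    mapArr n a e A a v = e.eval (fun x => if x = 0 then n else v) A := by
  simp [mapArr, h]

def RamProg.map (a : ℕ) (e : Ex) : RamProg :=
  .phase (.set 1 (.lit 0)) (.put a (.var 1) e ;; .set 1 (.succ (.var 1)))

/-- The cells are overwritten one after another. The result is nevertheless the simultaneous update,
because the expression does not read the array that is being written. -/
theorem RamProg.map_spec (a : ℕ) (e : Ex) (hb : e.varsLt 2) (ha : e.avoids a) :
    (RamProg.map a e).Spec (fun _ _ => True) (fun n A A' => A' = mapArr n a e A) := by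
  have hb' : e.varsLt tempReg := Ex.varsLt_mono (by decide) e hb
  refine RamProg.phase_spec rfl (by simp [St.ok, Ex.varsLt, hb'])
    (fun n A s => s.reg 0 = n ∧ s.reg 1 ≤ n ∧ (∀ b ≠ a, s.arr b = A b) ∧
      ∀ v, s.arr a v = if v < s.reg 1 then e.eval (fun x => if x = 0 then n else v) A else A a v)
    (fun s => s.reg 0 - s.reg 1) 1 ?_ ?_ ?_
  · rintro n A s rfl rfl -
    simp [St.run, RamState.setReg, Ex.eval]
  · rintro n A s - ⟨h0, h1, h2, h3⟩ hlt
    have key : e.eval s.reg s.arr = e.eval (fun x => if x = 0 then n else s.reg 1) A := by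
      rw [Ex.eval_congr_arr s.reg h2 e ha]
      refine Ex.eval_congr A (fun x hx => ?_) e hb
      interval_cases x <;> simp [h0]
    simp only [St.run, RamState.setReg, RamState.setArr, Ex.eval, key]
    refine ⟨⟨by simpa using h0, by simp; omega, fun b hb => by simpa [hb] using h2 b hb,
      fun v => ?_⟩, by simp; omega⟩
    simp only [Function.update_self, Function.update_apply]
    by_cases hv : v = s.reg 1
    · subst hv; simp
    · have : v < s.reg 1 + 1 ↔ v < s.reg 1 := by omega
      simp only [hv, if_false, this]
      simpa using h3 v
  · rintro n A s - ⟨h0, h1, h2, h3⟩ hlt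
    refine ⟨h0, ?_⟩
    have h4 : s.reg 1 = n := by omega
    funext b v
    by_cases hb : b = a
    · subst hb; rw [h3, h4]; simp [mapArr]
    · rw [h2 b hb, mapArr_of_ne e A hb]

/-- A sequence of maps. -/
def RamProg.maps : List (ℕ × Ex) → RamProg
  | [] => .skip
  | (a, e) :: l => .seq (.map a e) (maps l)

def mapsArr (n : ℕ) : List (ℕ × Ex) → (ℕ → ℕ → ℕ) → ℕ → ℕ → ℕ
  | [], A => A
  | (a, e) :: l, A => mapsArr n l (mapArr n a e A)

theorem RamProg.maps_spec : ∀ (l : List (ℕ × Ex)), (∀ x ∈ l, x.2.varsLt 2 ∧ x.2.avoids x.1) →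
    (RamProg.maps l).Spec (fun _ _ => True) (fun n A A' => A' = mapsArr n l A)
  | [], _ => ⟨1, fun s _ => ⟨1, by omega, s, .skip s, rfl, rfl⟩⟩
  | (a, e) :: l, h => by
      have hae := h (a, e) (by simp)
      refine ((map_spec a e hae.1 hae.2).seq
        (maps_spec l fun x hx => h x (by simp [hx])) (fun _ _ _ _ _ => trivial)).weaken
        (fun _ _ h => h) ?_
      rintro n A A' - ⟨A1, rfl, rfl⟩
      rfl

/-- A count that drops because one element is lost and none is gained. -/
theorem card_filter_range_lt {n : ℕ} {p q : ℕ → Prop} [DecidablePred p] [DecidablePred q]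
    (hpq : ∀ v < n, q v → p v) {w : ℕ} (hw : w < n) (hp : p w) (hq : ¬ q w) :
    ((Finset.range n).filter q).card < ((Finset.range n).filter p).card := by
  refine Finset.card_lt_card (Finset.ssubset_iff_subset_ne.2 ⟨fun v hv => ?_, fun h => ?_⟩)
  · simp only [Finset.mem_filter, Finset.mem_range] at hv ⊢
    exact ⟨hv.1, hpq v hv.1 hv.2⟩
  · have : w ∈ (Finset.range n).filter p := by simp [hw, hp]
    rw [← h] at this
    simp [hq] at this

theorem card_filter_range_le {n : ℕ} (p : ℕ → Prop) [DecidablePred p] :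
    ((Finset.range n).filter p).card ≤ n :=
  (Finset.card_filter_le _ _).trans (by simp)

/-! ### Linked triangles: transversals and colorings -/

/-- A partition of the active numbers below `n` (those with `inact v = 0`) into triangles
`{v, t1 v, t2 v}`, and an involution `m` that links some of them with others. -/
structure TriSys (n : ℕ) (inact t1 t2 m : ℕ → ℕ) : Prop where
  lt1 : ∀ v < n, inact v = 0 → t1 v < n
  lt2 : ∀ v < n, inact v = 0 → t2 v < n
  act1 : ∀ v < n, inact v = 0 → inact (t1 v) = 0
  act2 : ∀ v < n, inact v = 0 → inact (t2 v) = 0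
  ne1 : ∀ v < n, inact v = 0 → t1 v ≠ v
  ne2 : ∀ v < n, inact v = 0 → t2 v ≠ v
  ne12 : ∀ v < n, inact v = 0 → t1 v ≠ t2 v
  swap1 : ∀ v < n, inact v = 0 →
    (t1 (t1 v) = v ∧ t2 (t1 v) = t2 v) ∨ (t1 (t1 v) = t2 v ∧ t2 (t1 v) = v)
  swap2 : ∀ v < n, inact v = 0 →
    (t1 (t2 v) = v ∧ t2 (t2 v) = t1 v) ∨ (t1 (t2 v) = t1 v ∧ t2 (t2 v) = v)
  m_lt : ∀ v < n, inact v = 0 → m v < n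
  mm : ∀ v < n, inact v = 0 → m (m v) = v

/-- `S` is the indicator function of a set of active numbers that contains exactly one element of
each triangle and no two linked elements. -/
structure IsTransversal (n : ℕ) (inact t1 t2 m S : ℕ → ℕ) : Prop where
  inact_zero : ∀ v < n, inact v ≠ 0 → S v = 0
  sum_eq : ∀ v < n, inact v = 0 → S v + S (t1 v) + S (t2 v) = 1
  indep : ∀ v < n, inact v = 0 → S v = 1 → S (m v) = 1 → m v = v

/-- The invariant of the search for a transversal: `mark` tells which triangles are done, `w` is
the next candidate, and everything below `i` is done. -/
structure TransversalInv (n : ℕ) (inact t1 t2 m mark S : ℕ → ℕ) (w i : ℕ) : Prop where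
  w_lt : 0 < n → w < n
  inact_mark : ∀ v < n, inact v ≠ 0 → mark v ≠ 0
  inact_zero : ∀ v < n, inact v ≠ 0 → S v = 0
  mark_le : ∀ v < n, inact v = 0 → mark v ≤ 1
  sum_eq : ∀ v < n, inact v = 0 → S v + S (t1 v) + S (t2 v) = mark v
  mark1 : ∀ v < n, inact v = 0 → mark (t1 v) = mark v
  mark2 : ∀ v < n, inact v = 0 → mark (t2 v) = mark v
  indep : ∀ v < n, inact v = 0 → S v = 1 → S (m v) = 1 → m v = v
  opn : ∀ v < n, inact v = 0 → S v = 1 → mark (m v) = 0 → m v = w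
  done : ∀ v < i, v < n → mark v ≠ 0

namespace TransversalInv

variable {n : ℕ} {inact t1 t2 m mark S : ℕ → ℕ} {w i : ℕ}

/-- By `opn`, the only unmarked vertex linked to a chosen one is `w`. Choosing `t1 w`, which is not
`w`, is therefore always safe, and the only new open link leads to `m (t1 w)`, the next candidate.
The search never has to backtrack. -/
theorem process (h : TransversalInv n inact t1 t2 m mark S w i) (hT : TriSys n inact t1 t2 m)
    (hn : 0 < n) (hw : mark w = 0) :
    TransversalInv n inact t1 t2 m
      (Function.update (Function.update (Function.update mark w 1) (t1 w) 1) (t2 w) 1)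
      (Function.update S (t1 w) 1) (m (t1 w)) i := by
  have hwn := h.w_lt hn
  have ha : inact w = 0 := by
    by_contra h0
    exact h.inact_mark w hwn h0 hw
  have a1 := hT.act1 w hwn ha
  have a2 := hT.act2 w hwn ha
  have l1 := hT.lt1 w hwn ha
  have l2 := hT.lt2 w hwn ha
  have e1 := hT.ne1 w hwn ha
  have e2 := hT.ne2 w hwn ha
  have e12 := hT.ne12 w hwn ha
  have s1 := hT.swap1 w hwn ha
  have s2 := hT.swap2 w hwn ha
  have m1 := h.mark1 w hwn ha
  have m2 := h.mark2 w hwn ha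
  have hS := h.sum_eq w hwn ha
  -- From outside the triangle of `w`, the maps `t1` and `t2` do not lead into it; so the sums and
  -- marks of other triangles are unaffected.
  have key : ∀ v < n, inact v = 0 → v ≠ w → v ≠ t1 w → v ≠ t2 w →
      (t1 v ≠ w ∧ t1 v ≠ t1 w ∧ t1 v ≠ t2 w) ∧ (t2 v ≠ w ∧ t2 v ≠ t1 w ∧ t2 v ≠ t2 w) := by
    intro v hv hav h1 h2 h3
    have b1 := hT.swap1 v hv hav
    have b2 := hT.swap2 v hv hav
    grind
  constructor
  · exact fun _ => hT.m_lt _ l1 a1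
  · intro v hv hav
    have := h.inact_mark v hv hav
    simp only [Function.update_apply]
    grind
  · intro v hv hav
    have := h.inact_zero v hv hav
    simp only [Function.update_apply]
    grind
  · intro v hv hav
    have := h.mark_le v hv hav
    simp only [Function.update_apply]
    grind
  · intro v hv hav
    have := h.sum_eq v hv hav
    have := key v hv hav
    simp only [Function.update_apply]
    grind
  · intro v hv hav
    have := h.mark1 v hv hav
    have := key v hv hav
    simp only [Function.update_apply]
    grind
  · intro v hv hav
    have := h.mark2 v hv hav
    have := key v hv hav
    simp only [Function.update_apply]
    grind
  · intro v hv hav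
    have i1 := h.indep v hv hav
    have o1 := h.opn v hv hav
    have o2 := h.opn (m v) (hT.m_lt v hv hav)
    have i3 := h.inact_zero (m v) (hT.m_lt v hv hav)
    have mm := hT.mm v hv hav
    simp only [Function.update_apply]
    grind
  · intro v hv hav
    have o1 := h.opn v hv hav
    simp only [Function.update_apply]
    grind
  · intro v hv hvn
    have := h.done v hv hvn
    simp only [Function.update_apply]
    grind

/-- By `opn`, a link from a chosen vertex to an unmarked one could only end in `w`. As `w` is
marked, no such link is left, and the search may resume anywhere. -/
theorem jump (h : TransversalInv n inact t1 t2 m mark S w i) (hi : i < n) (hw : mark w ≠ 0) :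
    TransversalInv n inact t1 t2 m mark S i i :=
  { h with
    w_lt := fun _ => hi
    opn := fun v hv hav hS hm => absurd (h.opn v hv hav hS hm ▸ hm) hw }

theorem next (h : TransversalInv n inact t1 t2 m mark S w i) (hi : mark i ≠ 0) :
    TransversalInv n inact t1 t2 m mark S w (i + 1) :=
  { h with
    done := fun v hv hvn => by
      rcases Nat.lt_succ_iff_lt_or_eq.1 hv with h' | rfl
      exacts [h.done v h' hvn, hi] }

theorem isTransversal (h : TransversalInv n inact t1 t2 m mark S w i) (hi : n ≤ i) :
    IsTransversal n inact t1 t2 m S where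
  inact_zero := h.inact_zero
  indep := h.indep
  sum_eq v hv hav := by
    have h1 := h.sum_eq v hv hav
    have h2 := h.mark_le v hv hav
    have h3 := h.done v (by omega) hv
    omega

end TransversalInv

/-- The initialization and the loop body of the search for a transversal, which is stored in
array 5. Arrays 6, 7, 8, 9 hold `t1`, `t2`, `m`, `inact`; array 10 holds the marks. -/
def transversalInit : St := .set 1 (.lit 0) ;; .set 2 (.lit 0)

def transversalBody : St :=
  .ite (.rd 10 (.var 2)) (.lit 0)
    (.put 10 (.var 2) (.lit 1) ;; .put 10 (.rd 6 (.var 2)) (.lit 1) ;;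
      .put 10 (.rd 7 (.var 2)) (.lit 1) ;; .put 5 (.rd 6 (.var 2)) (.lit 1) ;;
      .set 2 (.rd 8 (.rd 6 (.var 2))))
    (.ite (.rd 10 (.var 1)) (.lit 0) (.set 2 (.var 1)) (.set 1 (.succ (.var 1))))

theorem transversal_loop_spec :
    (RamProg.phase transversalInit transversalBody).Spec
      (fun n A => TriSys n (A 9) (A 6) (A 7) (A 8) ∧ ∀ v < n, A 5 v = 0 ∧ A 10 v = A 9 v)
      (fun n A A' => (∀ b, b ≠ 5 → b ≠ 10 → A' b = A b) ∧
        IsTransversal n (A 9) (A 6) (A 7) (A 8) (A' 5)) := by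
  refine RamProg.phase_spec rfl rfl
    (fun n A s => s.reg 0 = n ∧ (∀ b, b ≠ 5 → b ≠ 10 → s.arr b = A b) ∧
      TransversalInv n (A 9) (A 6) (A 7) (A 8) (s.arr 10) (s.arr 5) (s.reg 2) (s.reg 1))
    -- Processing a triangle loses at least one unmarked vertex, worth 2, and raises the flag by at
    -- most 1. A jump lowers the flag, and otherwise the scan position advances. The initial value
    -- is at most `3 * n + 1`.
    (fun s => 2 * ((Finset.range (s.reg 0)).filter fun v => s.arr 10 v = 0).card +
      (if s.arr 10 (s.reg 2) = 0 then 0 else 1) + (s.reg 0 - s.reg 1)) 4 ?_ ?_ ?_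
  · rintro n A s rfl rfl ⟨hT, hA⟩
    refine ⟨⟨rfl, fun b _ _ => rfl, ?_⟩, ?_⟩
    · simp only [transversalInit, St.run, RamState.setReg, Ex.eval]
      constructor
      · simp
      · intro v hv hav; rw [(hA v hv).2]; exact hav
      · intro v hv hav; exact (hA v hv).1
      · intro v hv hav; rw [(hA v hv).2, hav]; exact Nat.zero_le _
      · intro v hv hav
        rw [(hA v hv).1, (hA _ (hT.lt1 v hv hav)).1, (hA _ (hT.lt2 v hv hav)).1, (hA v hv).2, hav]
      · intro v hv hav
        rw [(hA _ (hT.lt1 v hv hav)).2, (hA v hv).2, hT.act1 v hv hav, hav]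
      · intro v hv hav
        rw [(hA _ (hT.lt2 v hv hav)).2, (hA v hv).2, hT.act2 v hv hav, hav]
      · intro v hv hav h; rw [(hA v hv).1] at h; omega
      · intro v hv hav h; rw [(hA v hv).1] at h; omega
      · intro v hv; simp at hv
    · have := card_filter_range_le (n := s.reg 0) fun v => s.arr 10 v = 0
      simp [transversalInit, St.run, RamState.setReg, Ex.eval]
      split_ifs <;> omega
  · rintro n A s ⟨hT, -⟩ ⟨rfl, hA, hI⟩ hlt
    have h6 := hA 6 (by decide) (by decide)
    have h7 := hA 7 (by decide) (by decide)
    have h8 := hA 8 (by decide) (by decide)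
    by_cases hw : s.arr 10 (s.reg 2) = 0
    · have hI' := hI.process hT (by omega) hw
      have hwn := hI.w_lt (by omega)
      simp only [transversalBody, St.run, RamState.setReg, RamState.setArr, Ex.eval, hw, if_true]
      refine ⟨⟨rfl, fun b h5 h10 => ?_, ?_⟩, ?_⟩
      · simpa [h5, h10] using hA b h5 h10
      · simpa [h6, h7, h8] using hI'
      · have hc := card_filter_range_lt (n := s.reg 0) (p := fun v => s.arr 10 v = 0)
          (q := fun v => Function.update (Function.update (Function.update (s.arr 10) (s.reg 2) 1)
            (A 6 (s.reg 2)) 1) (A 7 (s.reg 2)) 1 v = 0)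
          (fun v _ => by simp only [Function.update_apply]; grind) hwn hw
          (by simp only [Function.update_apply]; grind)
        simp [h6, h7, h8]
        split_ifs <;> omega
    · by_cases hi : s.arr 10 (s.reg 1) = 0
      · simp only [transversalBody, St.run, RamState.setReg, RamState.setArr, Ex.eval, hw, hi,
          if_true, if_false]
        refine ⟨⟨rfl, fun b h5 h10 => by simpa using hA b h5 h10, ?_⟩, ?_⟩
        · simpa using hI.jump hlt hw
        · simp [hi]
      · simp only [transversalBody, St.run, RamState.setReg, RamState.setArr, Ex.eval, hw, hi,
          if_false]
        refine ⟨⟨rfl, fun b h5 h10 => by simpa using hA b h5 h10, ?_⟩, ?_⟩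
        · simpa using hI.next hi
        · simp [hw]
          omega
  · rintro n A s - ⟨rfl, hA, hI⟩ hlt
    exact ⟨rfl, hA, hI.isTransversal (by omega)⟩

/-- Finding a transversal. -/
def transversalProg : RamProg :=
  .seq (.maps [(5, .lit 0), (10, .rd 9 (.var 1))]) (.phase transversalInit transversalBody)

theorem transversalProg_spec :
    transversalProg.Spec (fun n A => TriSys n (A 9) (A 6) (A 7) (A 8))
      (fun n A A' => (∀ b, b ≠ 5 → b ≠ 10 → A' b = A b) ∧
        IsTransversal n (A 9) (A 6) (A 7) (A 8) (A' 5)) := by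
  refine (((RamProg.maps_spec [(5, .lit 0), (10, .rd 9 (.var 1))] (by decide)).weaken
    (P' := fun n A => TriSys n (A 9) (A 6) (A 7) (A 8)) (fun _ _ _ => trivial)
    (fun _ _ _ _ h => h)).seq transversal_loop_spec ?_).weaken (fun _ _ h => h) ?_
  · rintro n A A' hT rfl
    refine ⟨by simpa [mapsArr, mapArr_of_ne] using hT, fun v hv => ?_⟩
    simp [mapsArr, mapArr_of_ne, mapArr_self, hv, Ex.eval]
  · rintro n A A'' hT ⟨A', rfl, h1, h2⟩
    refine ⟨fun b h5 h10 => by rw [h1 b h5 h10]; simp [mapsArr, mapArr_of_ne, h5, h10], ?_⟩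
    simpa [mapsArr, mapArr_of_ne] using h2

/-! ### Two-colouring the complement of a transversal -/

/-- The other element outside `S` of the triangle of `v`, where `v` is outside `S`. -/
def partner (t1 t2 S : ℕ → ℕ) (v : ℕ) : ℕ := if S (t1 v) = 1 then t2 v else t1 v

/-- For `v` outside `S` exactly one of `t1 v` and `t2 v` is in `S`, so `partner` is a
fixed-point-free involution on the active complement of `S`. -/
theorem IsTransversal.partner_spec {n : ℕ} {inact t1 t2 m S : ℕ → ℕ}
    (h : IsTransversal n inact t1 t2 m S) (hT : TriSys n inact t1 t2 m) {v : ℕ} (hv : v < n)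
    (ha : inact v = 0) (hS : S v = 0) :
    partner t1 t2 S v < n ∧ inact (partner t1 t2 S v) = 0 ∧ S (partner t1 t2 S v) = 0 ∧
      partner t1 t2 S v ≠ v ∧ partner t1 t2 S (partner t1 t2 S v) = v := by
  have hs := h.sum_eq v hv ha
  have s1 := hT.swap1 v hv ha
  have s2 := hT.swap2 v hv ha
  have := hT.lt1 v hv ha
  have := hT.lt2 v hv ha
  have := hT.act1 v hv ha
  have := hT.act2 v hv ha
  have := hT.ne1 v hv ha
  have := hT.ne2 v hv ha
  have := hT.ne12 v hv ha
  have hor : (S (t1 v) = 1 ∧ S (t2 v) = 0) ∨ (S (t1 v) = 0 ∧ S (t2 v) = 1) := by omega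
  unfold partner
  rcases hor with ⟨h1, h2⟩ | ⟨h1, h2⟩
  · grind
  · grind

/-- The invariant of the coloring of the active numbers outside a transversal `S`. Color 2 stands
for membership in `S`, color 3 for a missing color and color 4 for inactive numbers. The walk goes
on at `w` with color `k`, and a second one is pending at `w'` with color `k'`. -/
structure ColorInv (n : ℕ) (inact t1 t2 m S col : ℕ → ℕ) (w k w' k' i : ℕ) : Prop where
  inact_four : ∀ v < n, inact v ≠ 0 → col v = 4
  mem_two : ∀ v < n, inact v = 0 → S v = 1 → col v = 2
  pair : ∀ v < n, inact v = 0 → S v = 0 →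
    (col v = 3 ∧ col (partner t1 t2 S v) = 3) ∨ col v + col (partner t1 t2 S v) = 1
  proper : ∀ v < n, inact v = 0 → col v < 2 → col (m v) < 2 → m v ≠ v → col v ≠ col (m v)
  opn : ∀ v < n, inact v = 0 → col v < 2 → col (m v) = 3 → m v = w ∨ m v = w'
  w_lt : col w = 3 → w < n
  w_lt' : col w' = 3 → w' < n
  k_le : k ≤ 1
  k_le' : k' ≤ 1
  prev : col w = 3 → col (m w) + k = 1
  prev' : col w' = 3 → col (m w') + k' = 1
  both : col w = 3 → col w' = 3 → w = w' ∨ k ≠ k'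
  done : ∀ v < i, v < n → col v ≠ 3

namespace ColorInv

variable {n : ℕ} {inact t1 t2 m S col : ℕ → ℕ} {w k w' k' i : ℕ}

theorem act (h : ColorInv n inact t1 t2 m S col w k w' k' i) (hS : IsTransversal n inact t1 t2 m S)
    {v : ℕ} (hv : v < n) (hc : col v = 3) : inact v = 0 ∧ S v = 0 := by
  have h1 := h.inact_four v hv
  have h2 := h.mem_two v hv
  have h3 := hS.sum_eq v hv
  refine ⟨by grind, ?_⟩
  have : inact v = 0 := by grind
  have := h3 this
  have := h2 ‹_›
  omega

/-- The walk alternates between links and triangle sides. The vertex behind `w` has colour `1 - k`,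
so `w` takes `k`, its partner takes `1 - k`, and `k` is again the right colour beyond the next link.
When a cycle closes, the partner of `w` is the pending vertex `w'`; by `both` then `k ≠ k'`, so it
receives exactly the colour `k'` that its own link demands. -/
theorem extend (h : ColorInv n inact t1 t2 m S col w k w' k' i) (hT : TriSys n inact t1 t2 m)
    (hS : IsTransversal n inact t1 t2 m S) (hw : col w = 3) :
    ColorInv n inact t1 t2 m S
      (Function.update (Function.update col w k) (partner t1 t2 S w) (1 - k))
      (m (partner t1 t2 S w)) k w' k' i := by
  have hwn := h.w_lt hw
  obtain ⟨ha, hs⟩ := h.act hS hwn hw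
  obtain ⟨pl, pa, ps, pn, pp⟩ := hS.partner_spec hT hwn ha hs
  have hpair := h.pair w hwn ha hs
  have hk := h.k_le
  have hk' := h.k_le'
  have hprev := h.prev hw
  have hprev' := h.prev'
  have hboth := h.both hw
  have mw := hT.mm w hwn ha
  have mp := hT.mm _ pl pa
  have hmp := hT.m_lt _ pl pa
  have hwl' := h.w_lt'
  generalize hp : partner t1 t2 S w = p at *
  have hcp : col p = 3 := by omega
  have hmw : col (m w) < 2 := by omega
  constructor
  · intro v hv hav
    have := h.inact_four v hv hav
    simp only [Function.update_apply]
    grind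
  · intro v hv hav hSv
    have := h.mem_two v hv hav hSv
    simp only [Function.update_apply]
    grind
  · intro v hv hav hSv
    have := h.pair v hv hav hSv
    have := hS.partner_spec hT hv hav hSv
    simp only [Function.update_apply]
    grind
  · intro v hv hav
    have h1 := h.proper v hv hav
    have h2 := h.opn v hv hav
    have h3 := h.opn (m v) (hT.m_lt v hv hav)
    have h4 := h.inact_four (m v) (hT.m_lt v hv hav)
    have mm := hT.mm v hv hav
    have e1 : v = w → m v = m w := fun e => e ▸ rfl
    have e2 : v = p → m v = m p := fun e => e ▸ rfl
    simp only [Function.update_apply]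
    grind
  · intro v hv hav
    have h2 := h.opn v hv hav
    simp only [Function.update_apply]
    grind
  · grind
  · simp only [Function.update_apply]
    grind
  · exact hk
  · exact hk'
  · intro _
    rw [mp]
    simp only [Function.update_apply]
    grind
  · simp only [Function.update_apply]
    grind
  · simp only [Function.update_apply]
    grind
  · intro v hv hvn
    have := h.done v hv hvn
    simp only [Function.update_apply]
    grind

theorem switch (h : ColorInv n inact t1 t2 m S col w k w' k' i) (hw : col w ≠ 3) :
    ColorInv n inact t1 t2 m S col w' k' w' k' i :=
  { h with
    opn := fun v hv hav h1 h2 => by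
      rcases h.opn v hv hav h1 h2 with h3 | h3
      · exact absurd (h3 ▸ h2) hw
      · exact .inl h3
    w_lt := h.w_lt'
    k_le := h.k_le'
    prev := h.prev'
    both := fun _ _ => .inl rfl }

/-- Both walks have stopped, so no vertex of colour 0 or 1 is linked to an uncoloured one and the
colours of `i` and its partner are free. The new component is explored in both directions; the two
walks carry the different colours 0 and 1, which establishes `both`. -/
theorem start (h : ColorInv n inact t1 t2 m S col w k w' k' i) (hT : TriSys n inact t1 t2 m)
    (hS : IsTransversal n inact t1 t2 m S) (hw : col w ≠ 3) (hw' : col w' ≠ 3) (hi : i < n)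
    (hc : col i = 3) :
    ColorInv n inact t1 t2 m S
      (Function.update (Function.update col i 0) (partner t1 t2 S i) 1)
      (m (partner t1 t2 S i)) 0 (m i) 1 i := by
  obtain ⟨ha, hs⟩ := h.act hS hi hc
  obtain ⟨pl, pa, ps, pn, pp⟩ := hS.partner_spec hT hi ha hs
  have hpair := h.pair i hi ha hs
  have mi := hT.mm i hi ha
  have mp := hT.mm _ pl pa
  have hmp := hT.m_lt _ pl pa
  have hmi := hT.m_lt i hi ha
  generalize hp : partner t1 t2 S i = p at *
  have hcp : col p = 3 := by omega
  have hopn : ∀ v < n, inact v = 0 → col v < 2 → col (m v) ≠ 3 := by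
    intro v hv hav h1 h2
    rcases h.opn v hv hav h1 h2 with h3 | h3
    · exact hw (h3 ▸ h2)
    · exact hw' (h3 ▸ h2)
  constructor
  · intro v hv hav
    have := h.inact_four v hv hav
    simp only [Function.update_apply]
    grind
  · intro v hv hav hSv
    have := h.mem_two v hv hav hSv
    simp only [Function.update_apply]
    grind
  · intro v hv hav hSv
    have := h.pair v hv hav hSv
    have := hS.partner_spec hT hv hav hSv
    simp only [Function.update_apply]
    grind
  · intro v hv hav
    have h1 := h.proper v hv hav
    have h2 := hopn v hv hav
    have h3 := hopn (m v) (hT.m_lt v hv hav)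
    have h4 := h.inact_four (m v) (hT.m_lt v hv hav)
    have mm := hT.mm v hv hav
    simp only [Function.update_apply]
    grind
  · intro v hv hav
    have h2 := hopn v hv hav
    simp only [Function.update_apply]
    grind
  · exact fun _ => hmp
  · exact fun _ => hmi
  · exact Nat.zero_le _
  · exact le_rfl
  · intro _
    rw [mp]
    simp
  · intro _
    rw [mi]
    simp [pn.symm]
  · exact fun _ _ => .inr (by decide)
  · intro v hv hvn
    have := h.done v hv hvn
    simp only [Function.update_apply]
    grind

theorem next (h : ColorInv n inact t1 t2 m S col w k w' k' i) (hc : col i ≠ 3) :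
    ColorInv n inact t1 t2 m S col w k w' k' (i + 1) :=
  { h with
    done := fun v hv hvn => by
      rcases Nat.lt_succ_iff_lt_or_eq.1 hv with h' | rfl
      exacts [h.done v h' hvn, hc] }

end ColorInv

/-- A coloring of the active numbers by 0, 1, 2 in which color 2 is the set `S`; the elements of a
triangle and linked elements get different colors. Inactive numbers have color 4. -/
structure IsTriColoring (n : ℕ) (inact t1 t2 m S col : ℕ → ℕ) : Prop where
  inact_four : ∀ v < n, inact v ≠ 0 → col v = 4
  lt_three : ∀ v < n, inact v = 0 → col v < 3
  two_iff : ∀ v < n, inact v = 0 → (col v = 2 ↔ S v = 1)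
  ne1 : ∀ v < n, inact v = 0 → col v ≠ col (t1 v)
  ne2 : ∀ v < n, inact v = 0 → col v ≠ col (t2 v)
  ne_m : ∀ v < n, inact v = 0 → m v ≠ v → col v ≠ col (m v)

theorem ColorInv.isTriColoring {n : ℕ} {inact t1 t2 m S col : ℕ → ℕ} {w k w' k' i : ℕ}
    (h : ColorInv n inact t1 t2 m S col w k w' k' i) (hT : TriSys n inact t1 t2 m)
    (hS : IsTransversal n inact t1 t2 m S) (hi : n ≤ i) :
    IsTriColoring n inact t1 t2 m S col := by
  have lt2 : ∀ v < n, inact v = 0 → S v = 0 →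
      col v < 2 ∧ col v + col (partner t1 t2 S v) = 1 := fun v hv ha hs => by
    have := h.pair v hv ha hs
    have := h.done v (by omega) hv
    omega
  have hS01 : ∀ v < n, inact v = 0 → S v = 0 ∨ S v = 1 := fun v hv ha => by
    have := hS.sum_eq v hv ha
    omega
  constructor
  · exact h.inact_four
  · intro v hv ha
    have := h.mem_two v hv ha
    have := lt2 v hv ha
    have := hS01 v hv ha
    grind
  · intro v hv ha
    have := h.mem_two v hv ha
    have := lt2 v hv ha
    have := hS01 v hv ha
    grind
  · intro v hv ha
    have h1 := h.mem_two v hv ha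
    have h2 := lt2 v hv ha
    have h3 := hS01 v hv ha
    have h4 := h.mem_two _ (hT.lt1 v hv ha) (hT.act1 v hv ha)
    have h5 := lt2 _ (hT.lt1 v hv ha) (hT.act1 v hv ha)
    have h6 := hS.sum_eq v hv ha
    have h7 := hS01 _ (hT.lt1 v hv ha) (hT.act1 v hv ha)
    unfold partner at h2
    grind
  · intro v hv ha
    have h1 := h.mem_two v hv ha
    have h2 := lt2 v hv ha
    have h3 := hS01 v hv ha
    have h4 := h.mem_two _ (hT.lt2 v hv ha) (hT.act2 v hv ha)
    have h5 := lt2 _ (hT.lt2 v hv ha) (hT.act2 v hv ha)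
    have h6 := hS.sum_eq v hv ha
    have h7 := hS01 _ (hT.lt2 v hv ha) (hT.act2 v hv ha)
    unfold partner at h2
    grind
  · intro v hv ha hm
    have h1 := h.mem_two v hv ha
    have h2 := lt2 v hv ha
    have h3 := hS01 v hv ha
    by_cases hma : inact (m v) = 0
    · have h4 := h.mem_two _ (hT.m_lt v hv ha) hma
      have h5 := lt2 _ (hT.m_lt v hv ha) hma
      have h6 := hS.indep v hv ha
      have h7 := hS01 _ (hT.m_lt v hv ha) hma
      have h8 := h.proper v hv ha
      grind
    · have := h.inact_four _ (hT.m_lt v hv ha) hma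
      grind

def Ex.partner (v : Ex) : Ex := .ite (.rd 5 (.rd 6 v)) (.lit 1) (.rd 7 v) (.rd 6 v)

/-- The initialization and the loop body of the coloring, which is stored in array 4. Arrays 6, 7,
8, 5 hold `t1`, `t2`, `m` and the transversal. -/
def colorInit : St :=
  .set 1 (.lit 0) ;; .put 4 (.var 0) (.lit 4) ;; .set 2 (.var 0) ;; .set 3 (.lit 0) ;;
    .set 4 (.var 0) ;; .set 5 (.lit 0)

def colorBody : St :=
  .ite (.rd 4 (.var 2)) (.lit 3)
    (.set 6 (.partner (.var 2)) ;; .put 4 (.var 2) (.var 3) ;;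
      .put 4 (.var 6) (.ite (.var 3) (.lit 0) (.lit 1) (.lit 0)) ;; .set 2 (.rd 8 (.var 6)))
    (.ite (.rd 4 (.var 4)) (.lit 3) (.set 2 (.var 4) ;; .set 3 (.var 5))
      (.ite (.rd 4 (.var 1)) (.lit 3)
        (.set 6 (.partner (.var 1)) ;; .put 4 (.var 1) (.lit 0) ;; .put 4 (.var 6) (.lit 1) ;;
          .set 2 (.rd 8 (.var 6)) ;; .set 3 (.lit 0) ;; .set 4 (.rd 8 (.var 1)) ;;
          .set 5 (.lit 1))
        (.set 1 (.succ (.var 1)))))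

theorem color_loop_spec :
    (RamProg.phase colorInit colorBody).Spec
      (fun n A => TriSys n (A 9) (A 6) (A 7) (A 8) ∧ IsTransversal n (A 9) (A 6) (A 7) (A 8) (A 5) ∧
        ∀ v < n, A 4 v = if A 5 v = 1 then 2 else if A 9 v = 0 then 3 else 4)
      (fun n A A' => (∀ b, b ≠ 4 → A' b = A b) ∧
        IsTriColoring n (A 9) (A 6) (A 7) (A 8) (A 5) (A' 4)) := by
  refine RamProg.phase_spec rfl rfl
    (fun n A s => s.reg 0 = n ∧ (∀ b, b ≠ 4 → s.arr b = A b) ∧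
      ColorInv n (A 9) (A 6) (A 7) (A 8) (A 5) (s.arr 4) (s.reg 2) (s.reg 3) (s.reg 4) (s.reg 5)
        (s.reg 1))
    (fun s => 2 * ((Finset.range (s.reg 0)).filter fun v => s.arr 4 v = 3).card +
      (if s.arr 4 (s.reg 2) = 3 then 0 else 1) + (s.reg 0 - s.reg 1)) 4 ?_ ?_ ?_
  · rintro n A s rfl rfl ⟨hT, hS, hA⟩
    refine ⟨⟨rfl, fun b h4 => ?_, ?_⟩, ?_⟩
    · simp [colorInit, St.run, RamState.setReg, RamState.setArr, h4]
    · simp only [colorInit, St.run, RamState.setReg, RamState.setArr, Ex.eval]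
      -- Cell `n` belongs to no vertex. It holds 4, so that the initial choice `w = w' = n` means
      -- that no walk is in progress.
      have hc : ∀ v < s.reg 0, Function.update (s.arr 4) (s.reg 0) 4 v = s.arr 4 v :=
        fun v hv => by simp [hv.ne]
      have hc2 : ∀ v < s.reg 0, 2 ≤ s.arr 4 v := fun v hv => by
        rw [hA v hv]; split_ifs <;> omega
      have hS01 : ∀ v < s.reg 0, s.arr 9 v = 0 → s.arr 5 v ≤ 1 := fun v hv ha => by
        have := hS.sum_eq v hv ha
        omega
      simp
      constructor
      · intro v hv ha; rw [hc v hv, hA v hv, hS.inact_zero v hv ha]; simp [ha]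
      · intro v hv ha h1; rw [hc v hv, hA v hv, h1]; simp
      · intro v hv ha h1
        obtain ⟨pl, pa, ps, -⟩ := hS.partner_spec hT hv ha h1
        left
        rw [hc v hv, hA v hv, hc _ pl, hA _ pl, pa, ps, ha, h1]; simp
      · intro v hv ha h1; rw [hc v hv] at h1; have := hc2 v hv; omega
      · intro v hv ha h1; rw [hc v hv] at h1; have := hc2 v hv; omega
      · simp
      · simp
      · simp
      · simp
      · simp
      · simp
      · simp
      · intro v hv; simp at hv
    · have := card_filter_range_le (n := s.reg 0)
        fun v => Function.update (s.arr 4) (s.reg 0) 4 v = 3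
      simp [colorInit, St.run, RamState.setReg, RamState.setArr, Ex.eval]
      omega
  · rintro n A s ⟨hT, hS, -⟩ ⟨rfl, hA, hI⟩ hlt
    have h5 := hA 5 (by decide)
    have h6 := hA 6 (by decide)
    have h7 := hA 7 (by decide)
    have h8 := hA 8 (by decide)
    have hp : ∀ x, (if A 5 (A 6 x) = 1 then A 7 x else A 6 x) = partner (A 6) (A 7) (A 5) x :=
      fun _ => rfl
    have count : ∀ x y a b, x < s.reg 0 → s.arr 4 x = 3 → a ≠ 3 → b ≠ 3 →
        ((Finset.range (s.reg 0)).filter fun v =>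
          Function.update (Function.update (s.arr 4) x a) y b v = 3).card <
        ((Finset.range (s.reg 0)).filter fun v => s.arr 4 v = 3).card := by
      intro x y a b hx h3 ha hb
      refine card_filter_range_lt (fun v _ => ?_) hx h3 ?_ <;>
        simp only [Function.update_apply] <;> grind
    by_cases hw : s.arr 4 (s.reg 2) = 3
    · have hI' := hI.extend hT hS hw
      have hk : (if s.reg 3 = 0 then 1 else 0) = 1 - s.reg 3 := by
        have := hI.k_le
        split_ifs <;> omega
      have hc := count (s.reg 2) (partner (A 6) (A 7) (A 5) (s.reg 2)) (s.reg 3) (1 - s.reg 3)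
        (hI.w_lt hw) hw (by have := hI.k_le; omega) (by omega)
      simp only [colorBody, St.run, RamState.setReg, RamState.setArr, Ex.eval, Ex.partner, hw,
        if_true]
      refine ⟨⟨rfl, fun b h4 => ?_, ?_⟩, ?_⟩
      · simpa [h4] using hA b h4
      · simpa [h5, h6, h7, h8, hp, hk] using hI'
      · simp [h5, h6, h7, h8, hp, hk]
        split_ifs <;> omega
    · by_cases hw' : s.arr 4 (s.reg 4) = 3
      · simp only [colorBody, St.run, RamState.setReg, RamState.setArr, Ex.eval, hw, hw',
          if_true, if_false]
        refine ⟨⟨rfl, fun b h4 => by simpa using hA b h4, ?_⟩, ?_⟩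
        · simpa using hI.switch hw
        · simp [hw']
      · by_cases hi : s.arr 4 (s.reg 1) = 3
        · have hI' := hI.start hT hS hw hw' hlt hi
          have hc := count (s.reg 1) (partner (A 6) (A 7) (A 5) (s.reg 1)) 0 1 hlt hi
            (by omega) (by omega)
          simp only [colorBody, St.run, RamState.setReg, RamState.setArr, Ex.eval, Ex.partner, hw,
            hw', hi, if_true, if_false]
          refine ⟨⟨rfl, fun b h4 => ?_, ?_⟩, ?_⟩
          · simpa [h4] using hA b h4
          · simpa [h5, h6, h7, h8, hp] using hI'
          · simp [h5, h6, h7, h8, hp]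
            split_ifs <;> omega
        · simp only [colorBody, St.run, RamState.setReg, RamState.setArr, Ex.eval, hw, hw', hi,
            if_false]
          refine ⟨⟨rfl, fun b h4 => by simpa using hA b h4, ?_⟩, ?_⟩
          · simpa using hI.next hi
          · simp [hw]
            omega
  · rintro n A s ⟨hT, hS, -⟩ ⟨rfl, hA, hI⟩ hlt
    exact ⟨rfl, hA, hI.isTriColoring hT hS (by omega)⟩

def colorMaps : List (ℕ × Ex) :=
  [(4, .ite (.rd 5 (.var 1)) (.lit 1) (.lit 2) (.ite (.rd 9 (.var 1)) (.lit 0) (.lit 3) (.lit 4)))]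

/-- Coloring the complement of a transversal by two colors. -/
def colorProg : RamProg := .seq (.maps colorMaps) (.phase colorInit colorBody)

theorem colorProg_spec :
    colorProg.Spec
      (fun n A => TriSys n (A 9) (A 6) (A 7) (A 8) ∧ IsTransversal n (A 9) (A 6) (A 7) (A 8) (A 5))
      (fun n A A' => (∀ b, b ≠ 4 → A' b = A b) ∧
        IsTriColoring n (A 9) (A 6) (A 7) (A 8) (A 5) (A' 4)) := by
  refine (((RamProg.maps_spec colorMaps (by decide)).weaken
    (P' := fun n A => TriSys n (A 9) (A 6) (A 7) (A 8) ∧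
      IsTransversal n (A 9) (A 6) (A 7) (A 8) (A 5)) (fun _ _ _ => trivial)
    (fun _ _ _ _ h => h)).seq color_loop_spec ?_).weaken (fun _ _ h => h) ?_
  · rintro n A A' ⟨hT, hS⟩ rfl
    refine ⟨by simpa [colorMaps, mapsArr, mapArr_of_ne] using hT,
      by simpa [colorMaps, mapsArr, mapArr_of_ne] using hS, fun v hv => ?_⟩
    simp [colorMaps, mapsArr, mapArr_of_ne, mapArr_self, hv, Ex.eval]
  · rintro n A A'' - ⟨A', rfl, h1, h2⟩
    refine ⟨fun b h4 => by rw [h1 b h4]; simp [colorMaps, mapsArr, mapArr_of_ne, h4], ?_⟩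
    simpa [colorMaps, mapsArr, mapArr_of_ne] using h2

/-- A halting run from suitable arrays exhibits the final arrays, so an algorithm proved correct is
an existence proof. -/
theorem RamProg.Spec.exists_post {p : RamProg} {P : ℕ → (ℕ → ℕ → ℕ) → Prop}
    {Q : ℕ → (ℕ → ℕ → ℕ) → (ℕ → ℕ → ℕ) → Prop} (h : p.Spec P Q) {n : ℕ} {A : ℕ → ℕ → ℕ}
    (hA : P n A) : ∃ A', Q n A A' := by
  obtain ⟨C, h⟩ := h
  obtain ⟨t, -, s', -, -, hQ⟩ := h ⟨fun _ => n, A⟩ hA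
  exact ⟨_, hQ⟩

theorem TriSys.exists_isTransversal {n : ℕ} {inact t1 t2 m : ℕ → ℕ}
    (h : TriSys n inact t1 t2 m) : ∃ S, IsTransversal n inact t1 t2 m S := by
  obtain ⟨A', -, h'⟩ := transversalProg_spec.exists_post (n := n)
    (A := fun a => if a = 9 then inact else if a = 6 then t1 else if a = 7 then t2 else m)
    (by simpa using h)
  exact ⟨_, by simpa using h'⟩

theorem IsTransversal.exists_isTriColoring {n : ℕ} {inact t1 t2 m S : ℕ → ℕ}
    (hS : IsTransversal n inact t1 t2 m S) (h : TriSys n inact t1 t2 m) :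
    ∃ col, IsTriColoring n inact t1 t2 m S col := by
  obtain ⟨A', -, h'⟩ := colorProg_spec.exists_post (n := n)
    (A := fun a => if a = 9 then inact else if a = 6 then t1 else if a = 7 then t2 else
      if a = 5 then S else m) (by simpa using ⟨h, hS⟩)
  exact ⟨_, by simpa using h'⟩

/-! ### Following paths of degree-2 vertices -/

/-- The cyclic successor in `{0, 1, 2}`. -/
def inc3 (a : ℕ) : ℕ := if a = 2 then 0 else a + 1

/-- The element of `{0, 1, 2}` different from two others. -/
def third (a b : ℕ) : ℕ := if b = inc3 a then inc3 b else inc3 a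

/-- Labels are images of colours under a permutation unknown to the program. Passing to the third
value commutes with every permutation, so two consecutive labels determine the next one. -/
theorem third_perm : ∀ (π : Equiv.Perm (Fin 3)) (a b d : Fin 3), a ≠ b → d ≠ a → d ≠ b →
    third (π a) (π b) = π d := by decide

theorem exists_perm_zero_one : ∀ a b : Fin 3, a ≠ b → ∃ π : Equiv.Perm (Fin 3),
    (π a : ℕ) = 0 ∧ (π b : ℕ) = 1 ∧ ∀ d, d ≠ a → d ≠ b → (π d : ℕ) = 2 := by decide

theorem exists_perm_one : ∀ a : Fin 3, ∃ π : Equiv.Perm (Fin 3), (π a : ℕ) = 1 := by decide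

/-- A disjoint union of paths and cycles on the numbers below `n`: the neighbors of `v` are `o1 v`
and `o2 v`, where `v` itself stands for a missing neighbor. Along it, `c` gives different colors to
any two adjacent elements and to the two neighbors of an element. -/
structure PathSys (n : ℕ) (o1 o2 : ℕ → ℕ) (c : ℕ → Fin 3) : Prop where
  lt1 : ∀ v < n, o1 v < n
  lt2 : ∀ v < n, o2 v < n
  symm1 : ∀ v < n, o1 (o1 v) = v ∨ o2 (o1 v) = v
  symm2 : ∀ v < n, o1 (o2 v) = v ∨ o2 (o2 v) = v
  missing : ∀ v < n, o1 v = v → o2 v = v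
  ne : ∀ v < n, o2 v ≠ v → o1 v ≠ o2 v
  c1 : ∀ v < n, o1 v ≠ v → c (o1 v) ≠ c v
  c2 : ∀ v < n, o2 v ≠ v → c (o2 v) ≠ c v
  c12 : ∀ v < n, o2 v ≠ v → c (o1 v) ≠ c (o2 v)

/-- Two elements lie in the same component. -/
def Linked (n : ℕ) (o1 o2 : ℕ → ℕ) : ℕ → ℕ → Prop :=
  Relation.EqvGen fun u v => u < n ∧ (v = o1 u ∨ v = o2 u)

/-- The neighbor of `v` other than `u`. -/
def onward (o1 o2 : ℕ → ℕ) (u v : ℕ) : ℕ := if o1 v = u then o2 v else o1 v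

/-- The invariant of the exploration of the components. Visited are the `v` with `pos v ≠ 3`; they
have labels `pos v` that arise from the colors `c v` by a permutation `π (root v)`. The component
of `cur` and `cur'` grows at its ends: next to `cur` comes `w` with label `l`, and next to `cur'`
comes `w'` with label `l'`. The other end of the component of an end `v` is `m v`, and one of the
ends is `E (root v)`. -/
structure LinkInv (n : ℕ) (o1 o2 : ℕ → ℕ) (c : ℕ → Fin 3) (π : ℕ → Equiv.Perm (Fin 3))
    (pos root m E : ℕ → ℕ) (cur w l cur' w' l' i : ℕ) : Prop where
  root_vis : ∀ v < n, pos v ≠ 3 → root v < n ∧ pos (root v) ≠ 3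
  linked : ∀ v < n, pos v ≠ 3 → Linked n o1 o2 v (root v)
  label : ∀ v < n, pos v ≠ 3 → pos v = π (root v) (c v)
  opn : ∀ v < n, pos v ≠ 3 → ∀ u, u = o1 v ∨ u = o2 v → pos u = 3 →
    (v = cur ∧ u = w) ∨ (v = cur' ∧ u = w')
  roots : ∀ v < n, pos v ≠ 3 → ∀ u, u = o1 v ∨ u = o2 v → pos u ≠ 3 → root u = root v
  ends : ∀ v < n, pos v ≠ 3 → o2 v = v → m v < n ∧ pos (m v) ≠ 3 ∧ m (m v) = v ∧
    root (m v) = root v ∧ (E (root v) = v ∨ E (root v) = m v)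
  inside : ∀ v < n, pos v ≠ 3 → E (root v) < n ∧ pos (E (root v)) ≠ 3 ∧
    root (E (root v)) = root v ∧ m (E (root v)) < n ∧ pos (m (E (root v))) ≠ 3 ∧
    root (m (E (root v))) = root v
  next : pos w = 3 → w < n ∧ (w = o1 cur ∨ w = o2 cur) ∧ o2 cur ≠ cur ∧ l = π (root cur) (c w)
  next' : pos w' = 3 → w' < n ∧ (w' = o1 cur' ∨ w' = o2 cur') ∧ o2 cur' ≠ cur' ∧
    l' = π (root cur') (c w')
  same : pos w = 3 ∨ pos w' = 3 →
    cur < n ∧ pos cur ≠ 3 ∧ cur' < n ∧ pos cur' ≠ 3 ∧ root cur = root cur'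
  only : pos w = 3 ∨ pos w' = 3 → ∀ v < n, pos v ≠ 3 → root v = root cur → o2 v = v →
    v = cur ∨ v = cur'
  done : ∀ v < i, v < n → pos v ≠ 3

namespace LinkInv

variable {n : ℕ} {o1 o2 : ℕ → ℕ} {c : ℕ → Fin 3} {π : ℕ → Equiv.Perm (Fin 3)}
  {pos root m E : ℕ → ℕ} {cur w l cur' w' l' i : ℕ}

/-- The component grows from `cur` to `w`, and `w` and `cur'` are recorded as each other's other
end. These records need to be right only for true ends, those `v` with `o2 v = v`; by `only` a
visited true end of the component must be `cur` or `cur'`. Since `cur` continues to `w`, it is not a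
true end and its old record may become stale. -/
theorem extend (h : LinkInv n o1 o2 c π pos root m E cur w l cur' w' l' i)
    (hP : PathSys n o1 o2 c) (hw : pos w = 3) :
    LinkInv n o1 o2 c π (Function.update pos w l) (Function.update root w (root cur))
      (Function.update (Function.update m w cur') cur' w) (Function.update E (root cur) w)
      w (onward o1 o2 cur w) (third (pos cur) l) cur' w' l' i := by
  obtain ⟨wn, wo, oc, hl⟩ := h.next hw
  obtain ⟨cn, cv, cn', cv', rr⟩ := h.same (.inl hw)
  have only := h.only (.inl hw)
  have hpc := h.label cur cn cv
  have rv := h.root_vis cur cn cv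
  have l3 : l ≠ 3 := by
    have := (π (root cur) (c w)).isLt
    omega
  have wc : w ≠ cur := fun e => cv (e ▸ hw)
  have wc' : w ≠ cur' := fun e => cv' (e ▸ hw)
  have cw : cur = o1 w ∨ cur = o2 w := by
    rcases wo with e | e
    · rw [e]; exact (hP.symm1 cur cn).imp Eq.symm Eq.symm
    · rw [e]; exact (hP.symm2 cur cn).imp Eq.symm Eq.symm
  have hccw : c cur ≠ c w := by
    have := hP.c1 cur cn
    have := hP.c2 cur cn
    grind
  have nbr : ∀ v < n, pos v ≠ 3 → (w = o1 v ∨ w = o2 v) → v = cur ∨ v = cur' := by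
    intro v hv hpv hvw
    rcases h.opn v hv hpv w hvw hw with h1 | h1
    exacts [.inl h1.1, .inr h1.1]
  have on_ne : onward o1 o2 cur w ≠ w → o2 w ≠ w := by
    unfold onward
    grind
  have on_or : onward o1 o2 cur w = o1 w ∨ onward o1 o2 cur w = o2 w := by
    unfold onward
    grind
  have on_only : ∀ u, (u = o1 w ∨ u = o2 w) → u ≠ cur → u = onward o1 o2 cur w := by
    unfold onward
    grind
  have on_n : onward o1 o2 cur w < n := by
    rcases on_or with e | e <;> rw [e]
    exacts [hP.lt1 w wn, hP.lt2 w wn]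
  -- `cur` and the onward element are the two neighbours of `w`, so the three have different
  -- colours.
  have on_col : onward o1 o2 cur w ≠ w → third (pos cur) l = π (root cur) (c (onward o1 o2 cur w)) := by
    intro hne
    have h2 := on_ne hne
    have := hP.c1 w wn
    have := hP.c2 w wn h2
    have := hP.c12 w wn h2
    rw [hpc, hl]
    unfold onward at hne ⊢
    refine third_perm _ _ _ _ hccw ?_ ?_ <;> grind
  generalize onward o1 o2 cur w = x at *
  generalize third (pos cur) l = l2 at *
  constructor
  · intro v hv
    have := h.root_vis v hv
    simp only [Function.update_apply]
    grind
  · intro v hv hpv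
    simp only [Function.update_apply]
    split_ifs with hvw
    · subst hvw
      exact .trans _ _ _ (.symm _ _ (.rel _ _ ⟨cn, wo⟩)) (h.linked cur cn cv)
    · exact h.linked v hv (by simpa [hvw] using hpv)
  · intro v hv
    have := h.label v hv
    simp only [Function.update_apply]
    grind
  · intro v hv hpv u huv
    have := h.opn v hv
    have := on_only u
    simp only [Function.update_apply] at hpv ⊢
    grind
  · intro v hv hpv u huv
    have h1 := h.roots v hv
    have h2 := nbr v hv
    have sym : v = o1 u ∨ v = o2 u := by
      rcases huv with e | e
      · rw [e]; exact (hP.symm1 v hv).imp Eq.symm Eq.symm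
      · rw [e]; exact (hP.symm2 v hv).imp Eq.symm Eq.symm
    have un : u < n := by
      rcases huv with e | e <;> rw [e]
      exacts [hP.lt1 v hv, hP.lt2 v hv]
    have h3 := nbr u un
    simp only [Function.update_apply] at hpv ⊢
    grind
  · intro v hv hpv ho
    have h1 := h.ends v hv
    have h2 := only v hv
    have h3 := only (m v)
    simp only [Function.update_apply] at hpv ⊢
    grind
  · intro v hv hpv
    have h1 := h.inside v hv
    simp only [Function.update_apply] at hpv ⊢
    grind
  · simp only [Function.update_apply]
    grind
  · have := h.next'
    simp only [Function.update_apply]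
    grind
  · simp only [Function.update_apply]
    grind
  · intro _ v hv
    have := only v hv
    simp only [Function.update_apply]
    grind
  · intro v hv hvn
    have := h.done v hv hvn
    simp only [Function.update_apply]
    grind

theorem switch (h : LinkInv n o1 o2 c π pos root m E cur w l cur' w' l' i)
    (hw' : pos w' = 3) : LinkInv n o1 o2 c π pos root m E cur' w' l' cur w l i := by
  obtain ⟨cn, cv, cn', cv', rr⟩ := h.same (.inr hw')
  exact { h with
    opn := fun v hv hpv u huv hu => (h.opn v hv hpv u huv hu).symm
    next := h.next'
    next' := h.next
    same := fun _ => ⟨cn', cv', cn, cv, rr.symm⟩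
    only := fun _ v hv hpv hr ho => (h.only (.inr hw') v hv hpv (hr.trans rr.symm) ho).symm }

/-- The visited set is closed under taking neighbours, so `i` and `o1 i` begin a new component. With
labels 0 and 1 for them, the elements beyond on either side must carry 2, because three consecutive
elements have three colours. -/
theorem start (h : LinkInv n o1 o2 c π pos root m E cur w l cur' w' l' i)
    (hP : PathSys n o1 o2 c) (hw : pos w ≠ 3) (hw' : pos w' ≠ 3) (hi : i < n) (hp : pos i = 3) :
    ∃ σ, LinkInv n o1 o2 c (Function.update π i σ)
      (Function.update (Function.update pos i 0) (o1 i) 1)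
      (Function.update (Function.update root i i) (o1 i) i)
      (Function.update (Function.update m i (o1 i)) (o1 i) i) (Function.update E i i)
      i (o2 i) 2 (o1 i) (onward o1 o2 i (o1 i)) 2 i := by
  have closed : ∀ v < n, pos v ≠ 3 → ∀ u, u = o1 v ∨ u = o2 v → pos u ≠ 3 := by
    intro v hv hpv u huv hu
    rcases h.opn v hv hpv u huv hu with ⟨-, rfl⟩ | ⟨-, rfl⟩
    exacts [hw hu, hw' hu]
  have yn := hP.lt1 i hi
  have ys := hP.symm1 i hi
  have yp : pos (o1 i) = 3 := by
    by_contra hy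
    exact closed _ yn hy i (ys.imp Eq.symm Eq.symm) hp
  have ymiss := hP.missing i hi
  have hne := hP.ne i hi
  have o2n := hP.lt2 i hi
  -- If `i` has no neighbour then `o1 i = i`, and the later write leaves it with label 1 instead of
  -- 0.
  have key : ∃ σ : Equiv.Perm (Fin 3), (o1 i = i → (σ (c i) : ℕ) = 1) ∧
      (o1 i ≠ i → (σ (c i) : ℕ) = 0 ∧ (σ (c (o1 i)) : ℕ) = 1 ∧
        ∀ d, d ≠ c i → d ≠ c (o1 i) → (σ d : ℕ) = 2) := by
    by_cases hy : o1 i = i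
    · obtain ⟨σ, hσ⟩ := exists_perm_one (c i)
      exact ⟨σ, fun _ => hσ, fun h => absurd hy h⟩
    · obtain ⟨σ, hσ⟩ := exists_perm_zero_one (c i) (c (o1 i)) (hP.c1 i hi hy).symm
      exact ⟨σ, fun h => absurd h hy, fun _ => hσ⟩
  obtain ⟨σ, hσ1, hσ2⟩ := key
  have ci2 : o2 i ≠ i → c (o2 i) ≠ c i ∧ c (o2 i) ≠ c (o1 i) :=
    fun ho => ⟨hP.c2 i hi ho, (hP.c12 i hi ho).symm⟩
  have on_n : onward o1 o2 i (o1 i) < n := by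
    unfold onward
    split_ifs
    exacts [hP.lt2 _ yn, hP.lt1 _ yn]
  have on_or : onward o1 o2 i (o1 i) = o1 (o1 i) ∨ onward o1 o2 i (o1 i) = o2 (o1 i) := by
    unfold onward
    grind
  have on_eq : o1 i = i → onward o1 o2 i (o1 i) = i := by
    unfold onward
    grind
  have on_only : ∀ u, (u = o1 (o1 i) ∨ u = o2 (o1 i)) → u ≠ i → u = onward o1 o2 i (o1 i) := by
    unfold onward
    grind
  have on_ne : onward o1 o2 i (o1 i) ≠ o1 i → onward o1 o2 i (o1 i) ≠ i →
      o2 (o1 i) ≠ o1 i ∧ c (onward o1 o2 i (o1 i)) ≠ c i ∧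
        c (onward o1 o2 i (o1 i)) ≠ c (o1 i) := by
    intro h1 h2
    have h3 : o2 (o1 i) ≠ o1 i := by
      unfold onward at h1 h2
      grind
    have := hP.c1 _ yn
    have := hP.c2 _ yn h3
    have := hP.c12 _ yn h3
    refine ⟨h3, ?_⟩
    unfold onward at h1 h2 ⊢
    grind
  generalize onward o1 o2 i (o1 i) = x at *
  have nbr : ∀ v < n, ∀ u, u = o1 v ∨ u = o2 v → u < n ∧ (v = o1 u ∨ v = o2 u) := by
    intro v hv u huv
    rcases huv with rfl | rfl
    · exact ⟨hP.lt1 v hv, (hP.symm1 v hv).imp Eq.symm Eq.symm⟩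
    · exact ⟨hP.lt2 v hv, (hP.symm2 v hv).imp Eq.symm Eq.symm⟩
  have hiy : Linked n o1 o2 (o1 i) i := .symm _ _ (.rel _ _ ⟨hi, .inl rfl⟩)
  generalize hy : o1 i = y at *
  refine ⟨σ, ?_⟩
  constructor
  · intro v hv
    have := h.root_vis v hv
    simp only [Function.update_apply]
    grind
  · intro v hv hpv
    simp only [Function.update_apply]
    split_ifs with h1 h2
    · rw [h1]; exact hiy
    · rw [h2]; exact .refl _
    · exact h.linked v hv (by simpa [h1, h2] using hpv)
  · intro v hv
    have := h.label v hv
    have := h.root_vis v hv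
    simp only [Function.update_apply]
    grind
  · intro v hv hpv u huv
    have := closed v hv
    have := on_only u
    simp only [Function.update_apply] at hpv ⊢
    grind
  · intro v hv hpv u huv
    have h1 := h.roots v hv
    have h2 := closed v hv
    have h4 := nbr v hv u huv
    have h3 := closed u h4.1
    simp only [Function.update_apply] at hpv ⊢
    grind
  · intro v hv hpv ho
    have h1 := h.ends v hv
    have h2 := h.root_vis v hv
    simp only [Function.update_apply] at hpv ⊢
    grind
  · intro v hv hpv
    have h1 := h.inside v hv
    have h2 := h.root_vis v hv
    simp only [Function.update_apply] at hpv ⊢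
    grind
  · simp only [Function.update_apply]
    grind
  · simp only [Function.update_apply]
    grind
  · simp only [Function.update_apply]
    grind
  · intro _ v hv
    have h2 := h.root_vis v hv
    simp only [Function.update_apply]
    grind
  · intro v hv hvn
    have := h.done v hv hvn
    simp only [Function.update_apply]
    grind

theorem skip (h : LinkInv n o1 o2 c π pos root m E cur w l cur' w' l' i) (hi : pos i ≠ 3) :
    LinkInv n o1 o2 c π pos root m E cur w l cur' w' l' (i + 1) :=
  { h with
    done := fun v hv hvn => by
      rcases Nat.lt_succ_iff_lt_or_eq.1 hv with h' | rfl
      exacts [h.done v h' hvn, hi] }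

end LinkInv

/-- The result of the exploration of the components: `root` tells them apart, the labels `pos`
arise from the colors by permutations that depend on the component only, `m v` is the other end of
the component of an end `v`, and `E (root v)` is one of its ends. -/
structure IsLinking (n : ℕ) (o1 o2 : ℕ → ℕ) (c : ℕ → Fin 3) (pos root m E : ℕ → ℕ) : Prop where
  root_lt : ∀ v < n, root v < n
  linked : ∀ v < n, Linked n o1 o2 v (root v)
  label : ∃ π : ℕ → Equiv.Perm (Fin 3), ∀ v < n, pos v = π (root v) (c v)
  root1 : ∀ v < n, root (o1 v) = root v
  root2 : ∀ v < n, root (o2 v) = root v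
  ends : ∀ v < n, o2 v = v → m v < n ∧ m (m v) = v ∧ root (m v) = root v ∧
    (E (root v) = v ∨ E (root v) = m v)
  inside : ∀ v < n, E (root v) < n ∧ root (E (root v)) = root v ∧ m (E (root v)) < n ∧
    root (m (E (root v))) = root v

theorem LinkInv.isLinking {n : ℕ} {o1 o2 : ℕ → ℕ} {c : ℕ → Fin 3} {π : ℕ → Equiv.Perm (Fin 3)}
    {pos root m E : ℕ → ℕ} {cur w l cur' w' l' i : ℕ}
    (h : LinkInv n o1 o2 c π pos root m E cur w l cur' w' l' i) (hP : PathSys n o1 o2 c)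
    (hi : n ≤ i) : IsLinking n o1 o2 c pos root m E := by
  have vis : ∀ v < n, pos v ≠ 3 := fun v hv => h.done v (by omega) hv
  refine ⟨fun v hv => (h.root_vis v hv (vis v hv)).1, fun v hv => h.linked v hv (vis v hv),
    ⟨π, fun v hv => h.label v hv (vis v hv)⟩,
    fun v hv => h.roots v hv (vis v hv) _ (.inl rfl) (vis _ (hP.lt1 v hv)),
    fun v hv => h.roots v hv (vis v hv) _ (.inr rfl) (vis _ (hP.lt2 v hv)), fun v hv ho => ?_, fun v hv => ?_⟩
  · obtain ⟨h1, -, h2⟩ := h.ends v hv (vis v hv) ho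
    exact ⟨h1, h2⟩
  · obtain ⟨h1, -, h2, h3, -, h4⟩ := h.inside v hv (vis v hv)
    exact ⟨h1, h2, h3, h4⟩

namespace Ex

def inc3 (e : Ex) : Ex := .ite e (.lit 2) (.lit 0) (.succ e)

def third (a b : Ex) : Ex := .ite b a.inc3 b.inc3 a.inc3

def onward (u v : Ex) : Ex := .ite (.rd 14 v) u (.rd 15 v) (.rd 14 v)

theorem eval_inc3 (ρ : ℕ → ℕ) (A : ℕ → ℕ → ℕ) (e : Ex) :
    e.inc3.eval ρ A = _root_.inc3 (e.eval ρ A) := rfl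

theorem eval_third (ρ : ℕ → ℕ) (A : ℕ → ℕ → ℕ) (a b : Ex) :
    (a.third b).eval ρ A = _root_.third (a.eval ρ A) (b.eval ρ A) := rfl

theorem eval_onward (ρ : ℕ → ℕ) (A : ℕ → ℕ → ℕ) (u v : Ex) :
    (u.onward v).eval ρ A = _root_.onward (A 14) (A 15) (u.eval ρ A) (v.eval ρ A) := rfl

end Ex

/-- The initialization and the loop body of the exploration. Arrays 14, 15 hold the neighbors;
arrays 16, 17, 8, 18 get the labels, the roots, the other ends and an end for every root. -/
def linkInit : St :=
  .set 1 (.lit 0) ;; .put 16 (.var 0) (.lit 0) ;; .set 3 (.var 0) ;; .set 6 (.var 0)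

def linkBody : St :=
  .ite (.rd 16 (.var 3)) (.lit 3)
    (.set 8 (.onward (.var 2) (.var 3)) ;; .set 9 (.third (.rd 16 (.var 2)) (.var 4)) ;;
      .set 10 (.rd 17 (.var 2)) ;; .put 16 (.var 3) (.var 4) ;; .put 17 (.var 3) (.var 10) ;;
      .put 8 (.var 3) (.var 5) ;; .put 8 (.var 5) (.var 3) ;; .put 18 (.var 10) (.var 3) ;;
      .set 2 (.var 3) ;; .set 3 (.var 8) ;; .set 4 (.var 9))
    (.ite (.rd 16 (.var 6)) (.lit 3)
      (.set 8 (.var 2) ;; .set 9 (.var 3) ;; .set 10 (.var 4) ;; .set 2 (.var 5) ;;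
        .set 3 (.var 6) ;; .set 4 (.var 7) ;; .set 5 (.var 8) ;; .set 6 (.var 9) ;;
        .set 7 (.var 10))
      (.ite (.rd 16 (.var 1)) (.lit 3)
        (.set 8 (.rd 14 (.var 1)) ;; .set 9 (.onward (.var 1) (.var 8)) ;;
          .put 16 (.var 1) (.lit 0) ;; .put 16 (.var 8) (.lit 1) ;;
          .put 17 (.var 1) (.var 1) ;; .put 17 (.var 8) (.var 1) ;;
          .put 8 (.var 1) (.var 8) ;; .put 8 (.var 8) (.var 1) ;; .put 18 (.var 1) (.var 1) ;;
          .set 2 (.var 1) ;; .set 3 (.rd 15 (.var 1)) ;; .set 4 (.lit 2) ;;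
          .set 5 (.var 8) ;; .set 6 (.var 9) ;; .set 7 (.lit 2))
        (.set 1 (.succ (.var 1)))))

theorem link_loop_spec :
    (RamProg.phase linkInit linkBody).Spec
      (fun n A => (∃ c, PathSys n (A 14) (A 15) c) ∧ ∀ v < n, A 16 v = 3)
      (fun n A A' => (∀ b, b ≠ 16 → b ≠ 17 → b ≠ 8 → b ≠ 18 → A' b = A b) ∧
        ∀ c, PathSys n (A 14) (A 15) c →
          IsLinking n (A 14) (A 15) c (A' 16) (A' 17) (A' 8) (A' 18)) := by
  refine RamProg.phase_spec rfl rfl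
    (fun n A s => s.reg 0 = n ∧ (∀ b, b ≠ 16 → b ≠ 17 → b ≠ 8 → b ≠ 18 → s.arr b = A b) ∧
      -- The colouring is quantified inside the invariant: one and the same run serves all
      -- admissible `c`, each with its own permutations `π`.
      ∀ c, PathSys n (A 14) (A 15) c → ∃ π,
        LinkInv n (A 14) (A 15) c π (s.arr 16) (s.arr 17) (s.arr 8) (s.arr 18)
          (s.reg 2) (s.reg 3) (s.reg 4) (s.reg 5) (s.reg 6) (s.reg 7) (s.reg 1))
    (fun s => 2 * ((Finset.range (s.reg 0)).filter fun v => s.arr 16 v = 3).card +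
      (if s.arr 16 (s.reg 3) = 3 then 0 else 1) + (s.reg 0 - s.reg 1)) 4 ?_ ?_ ?_
  · rintro n A s rfl rfl ⟨-, hA⟩
    refine ⟨⟨rfl, fun b h16 _ _ _ => ?_, fun c hP => ⟨fun _ => 1, ?_⟩⟩, ?_⟩
    · simp [linkInit, St.run, RamState.setReg, RamState.setArr, h16]
    -- Cell `n` counts as visited, so the initial `w = w' = n` means that no component is under
    -- exploration.
    · have hc : ∀ v < s.reg 0, Function.update (s.arr 16) (s.reg 0) 0 v = 3 :=
        fun v hv => by simp [hv.ne, hA v hv]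
      simp [linkInit, St.run, RamState.setReg, RamState.setArr, Ex.eval]
      constructor
      · intro v hv h; exact absurd (hc v hv) h
      · intro v hv h; exact absurd (hc v hv) h
      · intro v hv h; exact absurd (hc v hv) h
      · intro v hv h; exact absurd (hc v hv) h
      · intro v hv h; exact absurd (hc v hv) h
      · intro v hv h; exact absurd (hc v hv) h
      · intro v hv h; exact absurd (hc v hv) h
      · simp
      · simp
      · simp
      · simp
      · intro v hv; simp at hv
    · have := card_filter_range_le (n := s.reg 0)
        fun v => Function.update (s.arr 16) (s.reg 0) 0 v = 3
      simp [linkInit, St.run, RamState.setReg, RamState.setArr, Ex.eval]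
      omega
  · rintro n A s ⟨⟨c₀, hP₀⟩, -⟩ ⟨rfl, hA, hI⟩ hlt
    obtain ⟨π₀, hI₀⟩ := hI c₀ hP₀
    have h14 := hA 14 (by decide) (by decide) (by decide) (by decide)
    have h15 := hA 15 (by decide) (by decide) (by decide) (by decide)
    have count : ∀ x, x < s.reg 0 → s.arr 16 x = 3 → ∀ f : ℕ → ℕ,
        (∀ v, f v = 3 → s.arr 16 v = 3 ∧ v ≠ x) →
        ((Finset.range (s.reg 0)).filter fun v => f v = 3).card <
        ((Finset.range (s.reg 0)).filter fun v => s.arr 16 v = 3).card :=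
      fun x hx h3 f hf => card_filter_range_lt (fun v _ h => (hf v h).1) hx h3
        (fun h => (hf x h).2 rfl)
    by_cases hw : s.arr 16 (s.reg 3) = 3
    · obtain ⟨wn, -, -, hl⟩ := hI₀.next hw
      have hc := count _ wn hw (Function.update (s.arr 16) (s.reg 3) (s.reg 4)) (by
        -- The label is a value of a permutation of `Fin 3`, hence not 3, the code for unvisited
        -- elements.
        have := (π₀ (s.arr 17 (s.reg 2)) (c₀ (s.reg 3))).isLt
        intro v
        simp only [Function.update_apply]
        split_ifs <;> omega)
      simp only [linkBody, St.run, RamState.setReg, RamState.setArr, Ex.eval, Ex.eval_third,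
        Ex.eval_onward, hw, if_true]
      refine ⟨⟨rfl, fun b h1 h2 h3 h4 => ?_, fun c hP => ?_⟩, ?_⟩
      · simpa [h1, h2, h3, h4] using hA b h1 h2 h3 h4
      · obtain ⟨π, hI⟩ := hI c hP
        have hI' := hI.extend hP hw
        exact ⟨π, by simpa [h14, h15] using hI'⟩
      · simp
        split_ifs <;> omega
    · by_cases hw' : s.arr 16 (s.reg 6) = 3
      · simp only [linkBody, St.run, RamState.setReg, RamState.setArr, Ex.eval, hw, hw',
          if_true, if_false]
        refine ⟨⟨rfl, fun b h1 h2 h3 h4 => by simpa using hA b h1 h2 h3 h4, fun c hP => ?_⟩, ?_⟩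
        · obtain ⟨π, hI⟩ := hI c hP
          exact ⟨π, by simpa using hI.switch hw'⟩
        · simp [hw']
      · by_cases hi : s.arr 16 (s.reg 1) = 3
        · have hc := count _ hlt hi (Function.update (Function.update (s.arr 16) (s.reg 1) 0)
            (A 14 (s.reg 1)) 1) (by
              intro v
              simp only [Function.update_apply]
              grind)
          simp only [linkBody, St.run, RamState.setReg, RamState.setArr, Ex.eval, Ex.eval_onward,
            hw, hw', hi, if_true, if_false]
          refine ⟨⟨rfl, fun b h1 h2 h3 h4 => ?_, fun c hP => ?_⟩, ?_⟩
          · simpa [h1, h2, h3, h4] using hA b h1 h2 h3 h4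
          · obtain ⟨π, hI⟩ := hI c hP
            obtain ⟨σ, hI'⟩ := hI.start hP hw hw' hlt hi
            exact ⟨_, by simpa [h14, h15] using hI'⟩
          · simp [h14, h15]
            split_ifs <;> omega
        · simp only [linkBody, St.run, RamState.setReg, RamState.setArr, Ex.eval, hw, hw', hi,
            if_false]
          refine ⟨⟨rfl, fun b h1 h2 h3 h4 => by simpa using hA b h1 h2 h3 h4, fun c hP => ?_⟩, ?_⟩
          · obtain ⟨π, hI⟩ := hI c hP
            exact ⟨π, by simpa using hI.skip hi⟩
          · simp [hw]
            omega
  · rintro n A s - ⟨rfl, hA, hI⟩ hlt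
    refine ⟨rfl, hA, fun c hP => ?_⟩
    obtain ⟨π, hI⟩ := hI c hP
    exact hI.isLinking hP (by omega)

def linkMaps : List (ℕ × Ex) := [(16, .lit 3)]

/-- Exploring the components. -/
def linkProg : RamProg := .seq (.maps linkMaps) (.phase linkInit linkBody)

theorem linkProg_spec :
    linkProg.Spec (fun n A => ∃ c, PathSys n (A 14) (A 15) c)
      (fun n A A' => (∀ b, b ≠ 16 → b ≠ 17 → b ≠ 8 → b ≠ 18 → A' b = A b) ∧
        ∀ c, PathSys n (A 14) (A 15) c →
          IsLinking n (A 14) (A 15) c (A' 16) (A' 17) (A' 8) (A' 18)) := by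
  refine (((RamProg.maps_spec linkMaps (by decide)).weaken
    (P' := fun n A => ∃ c, PathSys n (A 14) (A 15) c) (fun _ _ _ => trivial)
    (fun _ _ _ _ h => h)).seq link_loop_spec ?_).weaken (fun _ _ h => h) ?_
  · rintro n A A' hP rfl
    refine ⟨by simpa [linkMaps, mapsArr, mapArr_of_ne] using hP, fun v hv => ?_⟩
    simp [linkMaps, mapsArr, mapArr_self, hv, Ex.eval]
  · rintro n A A'' - ⟨A', rfl, h1, h2⟩
    refine ⟨fun b h16 h17 h8 h18 => by
      rw [h1 b h16 h17 h8 h18]; simp [linkMaps, mapsArr, mapArr_of_ne, h16], ?_⟩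
    simpa [linkMaps, mapsArr, mapArr_of_ne] using h2

/-! ### Local structure of claw-free graphs of maximum degree three -/

/-- Adjacency in a graph on `0, …, n - 1`, as a relation between natural numbers. -/
def NatAdj {n : ℕ} (G : SimpleGraph (Fin n)) (u v : ℕ) : Prop :=
  ∃ (hu : u < n) (hv : v < n), G.Adj ⟨u, hu⟩ ⟨v, hv⟩

theorem natAdj_val {n : ℕ} {G : SimpleGraph (Fin n)} {u v : Fin n} :
    NatAdj G u v ↔ G.Adj u v :=
  ⟨fun ⟨_, _, h⟩ => h, fun h => ⟨u.2, v.2, h⟩⟩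

/-- Arrays 0, 1, 2, 3 hold the adjacency lists `nb`. -/
def HoldsLists {n : ℕ} (nb : Fin n → List (Fin n)) (A : ℕ → ℕ → ℕ) : Prop :=
  ∀ v : Fin n, A 0 v = (nb v).length ∧ ∀ j < 3, A (j + 1) v = (((nb v).map Fin.val)[j]?).getD 0

/-- A symmetric irreflexive relation on the numbers below `n` with at most three neighbors of each
element, which are `N1 v`, `N2 v`, `N3 v`; missing neighbors come last and are replaced by `v`. -/
structure NbrFun (n : ℕ) (adj : ℕ → ℕ → Prop) (N1 N2 N3 : ℕ → ℕ) : Prop where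
  symm : ∀ u v, adj u v → adj v u
  irrefl : ∀ u, ¬ adj u u
  lt : ∀ u v, adj u v → u < n
  mem : ∀ v < n, ∀ u, adj v u ↔ u ≠ v ∧ (u = N1 v ∨ u = N2 v ∨ u = N3 v)
  miss1 : ∀ v < n, N1 v = v → N2 v = v
  miss2 : ∀ v < n, N2 v = v → N3 v = v
  ne12 : ∀ v < n, N2 v ≠ v → N1 v ≠ N2 v
  ne13 : ∀ v < n, N3 v ≠ v → N1 v ≠ N3 v
  ne23 : ∀ v < n, N3 v ≠ v → N2 v ≠ N3 v

namespace Ex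

/-- The indicator of `y` being among the three neighbors of `x`. -/
def adj (x y : Ex) : Ex :=
  .ite (.rd 11 x) y (.lit 1) (.ite (.rd 12 x) y (.lit 1) (.ite (.rd 13 x) y (.lit 1) (.lit 0)))

/-- A choice according to the positions of the triangles at a vertex. -/
def sel (e₁₂ e₁₃ e₂₃ e₀ e : Ex) : Ex :=
  .ite (.rd 21 (.var 1)) (.lit 1)
    (.ite (.rd 22 (.var 1)) (.lit 1) e (.ite (.rd 23 (.var 1)) (.lit 1) e e₁₂))
    (.ite (.rd 22 (.var 1)) (.lit 1) (.ite (.rd 23 (.var 1)) (.lit 1) e e₁₃)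
      (.ite (.rd 23 (.var 1)) (.lit 1) e₂₃ e₀))

end Ex

/-- Computation of the neighbors (arrays 11, 12, 13), of the triangles (arrays 21, 22, 23 and 6, 7)
and of the neighbors outside triangles (arrays 14, 15). -/
def prepMaps : List (ℕ × Ex) :=
  [(11, .ite (.rd 0 (.var 1)) (.lit 0) (.var 1) (.rd 1 (.var 1))),
    (12, .ite (.rd 0 (.var 1)) (.lit 0) (.var 1)
      (.ite (.rd 0 (.var 1)) (.lit 1) (.var 1) (.rd 2 (.var 1)))),
    (13, .ite (.rd 0 (.var 1)) (.lit 3) (.rd 3 (.var 1)) (.var 1)),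
    (21, .ite (.rd 12 (.var 1)) (.var 1) (.lit 0) (.adj (.rd 11 (.var 1)) (.rd 12 (.var 1)))),
    (22, .ite (.rd 13 (.var 1)) (.var 1) (.lit 0) (.adj (.rd 11 (.var 1)) (.rd 13 (.var 1)))),
    (23, .ite (.rd 13 (.var 1)) (.var 1) (.lit 0) (.adj (.rd 12 (.var 1)) (.rd 13 (.var 1)))),
    (6, .sel (.rd 11 (.var 1)) (.rd 11 (.var 1)) (.rd 12 (.var 1)) (.var 1) (.var 1)),
    (7, .sel (.rd 12 (.var 1)) (.rd 13 (.var 1)) (.rd 13 (.var 1)) (.var 1) (.var 1)),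
    (14, .sel (.rd 13 (.var 1)) (.rd 12 (.var 1)) (.rd 11 (.var 1)) (.rd 11 (.var 1)) (.var 1)),
    (15, .sel (.var 1) (.var 1) (.var 1) (.rd 12 (.var 1)) (.var 1))]

theorem prepMaps_of_ne {n b : ℕ} (A : ℕ → ℕ → ℕ) (hb : b < 6 ∨ b = 9 ∨ b = 8) :
    mapsArr n prepMaps A b = A b := by
  have : b ≠ 11 ∧ b ≠ 12 ∧ b ≠ 13 ∧ b ≠ 21 ∧ b ≠ 22 ∧ b ≠ 23 ∧ b ≠ 6 ∧ b ≠ 7 ∧ b ≠ 14 ∧ b ≠ 15 := by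
    omega
  simp [prepMaps, mapsArr, mapArr_of_ne, this]

theorem prepMaps_nbrFun {n : ℕ} {G : SimpleGraph (Fin n)} {nb : Fin n → List (Fin n)}
    (hnb : IsAdjacencyLists G nb) (h3 : ∀ v, (nb v).length ≤ 3) {A : ℕ → ℕ → ℕ}
    (hA : HoldsLists nb A) :
    NbrFun n (NatAdj G) (mapsArr n prepMaps A 11) (mapsArr n prepMaps A 12)
      (mapsArr n prepMaps A 13) := by
  have key : ∀ v : Fin n,
      let N1 := mapsArr n prepMaps A 11 v
      let N2 := mapsArr n prepMaps A 12 v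
      let N3 := mapsArr n prepMaps A 13 v
      (∀ u, NatAdj G v u ↔ u ≠ v ∧ (u = N1 ∨ u = N2 ∨ u = N3)) ∧ (N1 = v → N2 = v) ∧
        (N2 = v → N3 = v) ∧ (N2 ≠ v → N1 ≠ N2) ∧ (N3 ≠ v → N1 ≠ N3) ∧ (N3 ≠ v → N2 ≠ N3) := by
    intro v
    obtain ⟨hlen, hget⟩ := hA v
    have g0 := hget 0 (by omega)
    have g1 := hget 1 (by omega)
    have g2 := hget 2 (by omega)
    have e1 : mapsArr n prepMaps A 11 v = if A 0 v = 0 then (v : ℕ) else A 1 v := by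
      simp [prepMaps, mapsArr, mapArr_of_ne, mapArr_self, Ex.eval]
    have e2 : mapsArr n prepMaps A 12 v =
        if A 0 v = 0 then (v : ℕ) else if A 0 v = 1 then (v : ℕ) else A 2 v := by
      simp [prepMaps, mapsArr, mapArr_of_ne, mapArr_self, Ex.eval]
    have e3 : mapsArr n prepMaps A 13 v = if A 0 v = 3 then A 3 v else (v : ℕ) := by
      simp [prepMaps, mapsArr, mapArr_of_ne, mapArr_self, Ex.eval]
    obtain ⟨nd, hmem⟩ := hnb v
    have hl3 := h3 v
    have hadj : ∀ u, NatAdj G v u ↔ ∃ x ∈ nb v, (x : ℕ) = u := by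
      intro u
      constructor
      · rintro ⟨_, hu, h⟩
        exact ⟨⟨u, hu⟩, (hmem _).2 h, rfl⟩
      · rintro ⟨x, hx, rfl⟩
        exact natAdj_val.2 ((hmem _).1 hx)
    have hirr : v ∉ nb v := fun h => G.irrefl ((hmem v).1 h)
    simp only [e1, e2, e3, hlen, hadj, g0, g1, g2]
    generalize nb v = l at *
    match l, hl3 with
    | [], _ => simp
    | [a], _ =>
      have ha : a ≠ v := by rintro rfl; simp at hirr
      have ha' : (a : ℕ) ≠ v := fun h => ha (Fin.ext h)
      simp
      grind
    | [a, b], _ =>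
      have ha' : (a : ℕ) ≠ v := fun h => hirr (by simp [Fin.ext h])
      have hb' : (b : ℕ) ≠ v := fun h => hirr (by simp [Fin.ext h])
      have hab : (a : ℕ) ≠ b := fun h => by simp [Fin.ext h] at nd
      simp
      grind
    | [a, b, d], _ =>
      have ha' : (a : ℕ) ≠ v := fun h => hirr (by simp [Fin.ext h])
      have hb' : (b : ℕ) ≠ v := fun h => hirr (by simp [Fin.ext h])
      have hd' : (d : ℕ) ≠ v := fun h => hirr (by simp [Fin.ext h])
      have hab : (a : ℕ) ≠ b := fun h => by simp [Fin.ext h] at nd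
      have had : (a : ℕ) ≠ d := fun h => by simp [Fin.ext h] at nd
      have hbd : (b : ℕ) ≠ d := fun h => by simp [Fin.ext h] at nd
      simp
      grind
    | _ :: _ :: _ :: _ :: _, h =>
      simp only [List.length_cons] at h
      omega
  exact {
    symm := fun u v ⟨hu, hv, h⟩ => ⟨hv, hu, h.symm⟩
    irrefl := fun u ⟨_, _, h⟩ => G.irrefl h
    lt := fun u v ⟨hu, _, _⟩ => hu
    mem := fun v hv => (key ⟨v, hv⟩).1
    miss1 := fun v hv => (key ⟨v, hv⟩).2.1
    miss2 := fun v hv => (key ⟨v, hv⟩).2.2.1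
    ne12 := fun v hv => (key ⟨v, hv⟩).2.2.2.1
    ne13 := fun v hv => (key ⟨v, hv⟩).2.2.2.2.1
    ne23 := fun v hv => (key ⟨v, hv⟩).2.2.2.2.2 }

/-! ### Three kinds of vertices -/

/-- `v` lies in exactly one triangle, `{v, T1 v, T2 v}`; its further neighbor is `o1 v`, or `v`
itself stands for a missing one. -/
structure SingleAt (adj : ℕ → ℕ → Prop) (T1 T2 o1 o2 : ℕ → ℕ) (v : ℕ) : Prop where
  adj1 : adj v (T1 v)
  adj2 : adj v (T2 v)
  adj12 : adj (T1 v) (T2 v)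
  nbr : ∀ u, adj v u → u = T1 v ∨ u = T2 v ∨ u = o1 v
  outer : o1 v ≠ v → adj v (o1 v) ∧ o1 v ≠ T1 v ∧ o1 v ≠ T2 v ∧ ¬ adj (o1 v) (T1 v) ∧
    ¬ adj (o1 v) (T2 v)
  o2_eq : o2 v = v

/-- `v` has three neighbors and lies in at least two triangles. -/
structure CenterAt (adj : ℕ → ℕ → Prop) (T1 T2 o1 o2 : ℕ → ℕ) (v : ℕ) : Prop where
  T1_eq : T1 v = v
  T2_eq : T2 v = v
  o1_eq : o1 v = v
  o2_eq : o2 v = v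
  nbr : ∃ x y z, adj v x ∧ adj v y ∧ adj v z ∧ x ≠ z ∧ adj y x ∧ adj y z ∧
    ∀ u, adj v u → u = x ∨ u = y ∨ u = z

/-- `v` lies in no triangle; its neighbors are `o1 v` and `o2 v`, where `v` stands for a missing
one. -/
structure PlainAt (adj : ℕ → ℕ → Prop) (T1 T2 o1 o2 : ℕ → ℕ) (v : ℕ) : Prop where
  T1_eq : T1 v = v
  T2_eq : T2 v = v
  nbr : ∀ u, adj v u ↔ u ≠ v ∧ (u = o1 v ∨ u = o2 v)
  not_adj : ∀ u w, adj v u → adj v w → ¬ adj u w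
  miss : o1 v = v → o2 v = v
  ne : o2 v ≠ v → o1 v ≠ o2 v

structure LocTri (n : ℕ) (adj : ℕ → ℕ → Prop) (T1 T2 o1 o2 : ℕ → ℕ) : Prop where
  symm : ∀ u v, adj u v → adj v u
  irrefl : ∀ u, ¬ adj u u
  lt : ∀ u v, adj u v → u < n
  cases : ∀ v < n, SingleAt adj T1 T2 o1 o2 v ∨ CenterAt adj T1 T2 o1 o2 v ∨
    PlainAt adj T1 T2 o1 o2 v

/-- Arrays 21, 22, 23 tell which pairs of neighbours are adjacent. If no pair is, claw-freeness
excludes a third neighbour and the vertex is plain; exactly one pair makes it single, and at least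
two pairs make it a center. -/
theorem prepMaps_locTri {n : ℕ} {G : SimpleGraph (Fin n)} {nb : Fin n → List (Fin n)}
    (hnb : IsAdjacencyLists G nb) (h3 : ∀ v, (nb v).length ≤ 3)
    (hclaw : ∀ v x y z, NatAdj G v x → NatAdj G v y → NatAdj G v z → x ≠ y → x ≠ z → y ≠ z →
      NatAdj G x y ∨ NatAdj G x z ∨ NatAdj G y z) {A : ℕ → ℕ → ℕ} (hA : HoldsLists nb A) :
    LocTri n (NatAdj G) (mapsArr n prepMaps A 6) (mapsArr n prepMaps A 7)
      (mapsArr n prepMaps A 14) (mapsArr n prepMaps A 15) := by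
  have hN := prepMaps_nbrFun hnb h3 hA
  refine ⟨hN.symm, hN.irrefl, hN.lt, fun v hv => ?_⟩
  have f12 : mapsArr n prepMaps A 21 v = if mapsArr n prepMaps A 12 v = v then 0 else
      if mapsArr n prepMaps A 11 (mapsArr n prepMaps A 11 v) = mapsArr n prepMaps A 12 v then 1 else
      if mapsArr n prepMaps A 12 (mapsArr n prepMaps A 11 v) = mapsArr n prepMaps A 12 v then 1 else
      if mapsArr n prepMaps A 13 (mapsArr n prepMaps A 11 v) = mapsArr n prepMaps A 12 v then 1
      else 0 := by
    simp [prepMaps, mapsArr, mapArr_of_ne, mapArr_self, Ex.eval, Ex.adj, hv]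
  have f13 : mapsArr n prepMaps A 22 v = if mapsArr n prepMaps A 13 v = v then 0 else
      if mapsArr n prepMaps A 11 (mapsArr n prepMaps A 11 v) = mapsArr n prepMaps A 13 v then 1 else
      if mapsArr n prepMaps A 12 (mapsArr n prepMaps A 11 v) = mapsArr n prepMaps A 13 v then 1 else
      if mapsArr n prepMaps A 13 (mapsArr n prepMaps A 11 v) = mapsArr n prepMaps A 13 v then 1
      else 0 := by
    simp [prepMaps, mapsArr, mapArr_of_ne, mapArr_self, Ex.eval, Ex.adj, hv]
  have f23 : mapsArr n prepMaps A 23 v = if mapsArr n prepMaps A 13 v = v then 0 else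
      if mapsArr n prepMaps A 11 (mapsArr n prepMaps A 12 v) = mapsArr n prepMaps A 13 v then 1 else
      if mapsArr n prepMaps A 12 (mapsArr n prepMaps A 12 v) = mapsArr n prepMaps A 13 v then 1 else
      if mapsArr n prepMaps A 13 (mapsArr n prepMaps A 12 v) = mapsArr n prepMaps A 13 v then 1
      else 0 := by
    simp [prepMaps, mapsArr, mapArr_of_ne, mapArr_self, Ex.eval, Ex.adj, hv]
  -- An identity, used only to fix the shape in which the next four array values are stated.
  have sel : ∀ a a₁₂ a₁₃ a₂₃ a₀ e, a = (if mapsArr n prepMaps A 21 v = 1 then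
      (if mapsArr n prepMaps A 22 v = 1 then e else
        if mapsArr n prepMaps A 23 v = 1 then e else a₁₂) else
      if mapsArr n prepMaps A 22 v = 1 then (if mapsArr n prepMaps A 23 v = 1 then e else a₁₃) else
      if mapsArr n prepMaps A 23 v = 1 then a₂₃ else a₀) → a = (if mapsArr n prepMaps A 21 v = 1 then
      (if mapsArr n prepMaps A 22 v = 1 then e else
        if mapsArr n prepMaps A 23 v = 1 then e else a₁₂) else
      if mapsArr n prepMaps A 22 v = 1 then (if mapsArr n prepMaps A 23 v = 1 then e else a₁₃) else
      if mapsArr n prepMaps A 23 v = 1 then a₂₃ else (a₀ : ℕ)) := fun _ _ _ _ _ _ h => h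
  have t1 := sel (mapsArr n prepMaps A 6 v) (mapsArr n prepMaps A 11 v) (mapsArr n prepMaps A 11 v)
    (mapsArr n prepMaps A 12 v) v v
    (by simp [prepMaps, mapsArr, mapArr_of_ne, mapArr_self, Ex.eval, Ex.sel, hv])
  have t2 := sel (mapsArr n prepMaps A 7 v) (mapsArr n prepMaps A 12 v) (mapsArr n prepMaps A 13 v)
    (mapsArr n prepMaps A 13 v) v v
    (by simp [prepMaps, mapsArr, mapArr_of_ne, mapArr_self, Ex.eval, Ex.sel, hv])
  have r1 := sel (mapsArr n prepMaps A 14 v) (mapsArr n prepMaps A 13 v) (mapsArr n prepMaps A 12 v)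
    (mapsArr n prepMaps A 11 v) (mapsArr n prepMaps A 11 v) v
    (by simp [prepMaps, mapsArr, mapArr_of_ne, mapArr_self, Ex.eval, Ex.sel, hv])
  have r2 := sel (mapsArr n prepMaps A 15 v) v v v (mapsArr n prepMaps A 12 v) v
    (by simp [prepMaps, mapsArr, mapArr_of_ne, mapArr_self, Ex.eval, Ex.sel, hv])
  clear sel
  have hlt : ∀ u w, NatAdj G u w → w < n := fun u w h => hN.lt _ _ (hN.symm _ _ h)
  have hm := hN.mem v hv
  have a1 := (hm (mapsArr n prepMaps A 11 v))
  have a2 := (hm (mapsArr n prepMaps A 12 v))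
  have a3 := (hm (mapsArr n prepMaps A 13 v))
  have miss1 := hN.miss1 v hv
  have miss2 := hN.miss2 v hv
  have ne12 := hN.ne12 v hv
  have ne13 := hN.ne13 v hv
  have ne23 := hN.ne23 v hv
  have hcl := hclaw v (mapsArr n prepMaps A 11 v) (mapsArr n prepMaps A 12 v)
    (mapsArr n prepMaps A 13 v)
  have m12 := fun h => hN.mem (mapsArr n prepMaps A 11 v) h (mapsArr n prepMaps A 12 v)
  have m13 := fun h => hN.mem (mapsArr n prepMaps A 11 v) h (mapsArr n prepMaps A 13 v)
  have m23 := fun h => hN.mem (mapsArr n prepMaps A 12 v) h (mapsArr n prepMaps A 13 v)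
  have l1 := hlt v (mapsArr n prepMaps A 11 v)
  have l2 := hlt v (mapsArr n prepMaps A 12 v)
  have symm := hN.symm
  have irrefl := hN.irrefl
  have F12 : mapsArr n prepMaps A 21 v = 1 ↔ mapsArr n prepMaps A 12 v ≠ v ∧
      NatAdj G (mapsArr n prepMaps A 11 v) (mapsArr n prepMaps A 12 v) := by
    rw [f12]
    split_ifs <;> grind
  have F13 : mapsArr n prepMaps A 22 v = 1 ↔ mapsArr n prepMaps A 13 v ≠ v ∧
      NatAdj G (mapsArr n prepMaps A 11 v) (mapsArr n prepMaps A 13 v) := by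
    rw [f13]
    split_ifs <;> grind
  have F23 : mapsArr n prepMaps A 23 v = 1 ↔ mapsArr n prepMaps A 13 v ≠ v ∧
      NatAdj G (mapsArr n prepMaps A 12 v) (mapsArr n prepMaps A 13 v) := by
    rw [f23]
    split_ifs <;> grind
  clear f12 f13 f23 m12 m13 m23
  generalize mapsArr n prepMaps A 21 v = f12 at *
  generalize mapsArr n prepMaps A 22 v = f13 at *
  generalize mapsArr n prepMaps A 23 v = f23 at *
  generalize mapsArr n prepMaps A 6 = T1 at *
  generalize mapsArr n prepMaps A 7 = T2 at *
  generalize mapsArr n prepMaps A 14 = o1 at *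
  generalize mapsArr n prepMaps A 15 = o2 at *
  generalize mapsArr n prepMaps A 11 v = x at *
  generalize mapsArr n prepMaps A 12 v = y at *
  generalize mapsArr n prepMaps A 13 v = z at *
  clear hnb h3 hA hN
  generalize NatAdj G = adj at *
  clear hclaw
  -- If exactly two pairs are adjacent, the middle witness of `CenterAt.nbr` is the neighbour common
  -- to both pairs.
  by_cases p12 : f12 = 1 <;> by_cases p13 : f13 = 1 <;> by_cases p23 : f23 = 1 <;>
    simp only [p12, p13, p23, if_true, if_false, true_iff, false_iff] at t1 t2 r1 r2 F12 F13 F23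
  · refine .inr (.inl ⟨t1, t2, r1, r2, x, y, z, ?_⟩)
    grind
  · refine .inr (.inl ⟨t1, t2, r1, r2, y, x, z, ?_⟩)
    grind
  · refine .inr (.inl ⟨t1, t2, r1, r2, x, y, z, ?_⟩)
    grind
  · refine .inl ⟨?_, ?_, ?_, ?_, ?_, ?_⟩ <;> grind
  · refine .inr (.inl ⟨t1, t2, r1, r2, x, z, y, ?_⟩)
    grind
  · refine .inl ⟨?_, ?_, ?_, ?_, ?_, ?_⟩ <;> grind
  · refine .inl ⟨?_, ?_, ?_, ?_, ?_, ?_⟩ <;> grind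
  · refine .inr (.inr ⟨t1, t2, ?_, fun u w hu hw huw => ?_, ?_, ?_⟩)
    · grind
    · have := symm u w huw
      rcases (hm u).1 hu with ⟨_, rfl | rfl | rfl⟩ <;> rcases (hm w).1 hw with ⟨_, rfl | rfl | rfl⟩ <;>
        grind
    · grind
    · grind

namespace LocTri

variable {n : ℕ} {adj : ℕ → ℕ → Prop} {T1 T2 o1 o2 : ℕ → ℕ}

theorem lt' (h : LocTri n adj T1 T2 o1 o2) {u v : ℕ} (huv : adj u v) : v < n :=
  h.lt _ _ (h.symm _ _ huv)

theorem ne (h : LocTri n adj T1 T2 o1 o2) {u v : ℕ} (huv : adj u v) : u ≠ v :=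
  fun e => h.irrefl v (e ▸ huv)

theorem single (h : LocTri n adj T1 T2 o1 o2) {v : ℕ} (hv : v < n) (hT : T1 v ≠ v) :
    SingleAt adj T1 T2 o1 o2 v := by
  rcases h.cases v hv with h1 | h1 | h1
  exacts [h1, absurd h1.T1_eq hT, absurd h1.T1_eq hT]

theorem T1_ne (h : LocTri n adj T1 T2 o1 o2) {v : ℕ} (hs : SingleAt adj T1 T2 o1 o2 v) :
    T1 v ≠ v := (h.ne hs.adj1).symm

theorem T2_ne (h : LocTri n adj T1 T2 o1 o2) {v : ℕ} (hs : SingleAt adj T1 T2 o1 o2 v) :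
    T2 v ≠ v := (h.ne hs.adj2).symm

/-- The outer neighbour of a single vertex is adjacent to neither of the other two neighbours, so
only one pair of neighbours is adjacent. -/
theorem pair_eq (h : LocTri n adj T1 T2 o1 o2) {v x y : ℕ} (hs : SingleAt adj T1 T2 o1 o2 v)
    (hx : adj v x) (hy : adj v y) (hxy : adj x y) :
    (T1 v = x ∧ T2 v = y) ∨ (T1 v = y ∧ T2 v = x) := by
  have h1 := hs.nbr x hx
  have h2 := hs.nbr y hy
  have h3 := hs.outer
  have h4 := h.ne hx
  have h5 := h.ne hy
  have h6 := h.ne hxy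
  have h7 := h.symm _ _ hxy
  grind

theorem single_or_center (h : LocTri n adj T1 T2 o1 o2) {v x y : ℕ}
    (hx : adj v x) (hy : adj v y) (hxy : adj x y) :
    SingleAt adj T1 T2 o1 o2 v ∨ CenterAt adj T1 T2 o1 o2 v := by
  rcases h.cases v (h.lt _ _ hx) with h1 | h1 | h1
  exacts [.inl h1, .inr h1, absurd hxy (h1.not_adj x y hx hy)]

/-- One of the three neighbours of a center is adjacent to both others. The neighbour besides `v`
and `x` either is that one or is joined to it, so it is adjacent to `v` or `x`. -/
theorem center_third (h : LocTri n adj T1 T2 o1 o2) {v x y : ℕ} (hc : CenterAt adj T1 T2 o1 o2 y)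
    (hv : adj y v) (hx : adj y x) (hvx : adj v x) :
    ∃ w, adj y w ∧ w ≠ v ∧ w ≠ x ∧ (adj w v ∨ adj w x) ∧
      ∀ u, adj y u → u = v ∨ u = x ∨ u = w := by
  obtain ⟨p, q, r, hp, hq, hr, hpr, hqp, hqr, hall⟩ := hc.nbr
  have h1 := hall v hv
  have h2 := hall x hx
  have h3 := h.ne hvx
  have h4 := h.ne hqp
  have h5 := h.ne hqr
  have h6 := h.symm _ _ hqp
  have h7 := h.symm _ _ hqr
  have key : (v = p ∧ x = q) ∨ (v = q ∧ x = p) ∨ (v = q ∧ x = r) ∨ (v = r ∧ x = q) ∨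
      (v = p ∧ x = r) ∨ (v = r ∧ x = p) := by grind
  rcases key with ⟨rfl, rfl⟩ | ⟨rfl, rfl⟩ | ⟨rfl, rfl⟩ | ⟨rfl, rfl⟩ | ⟨rfl, rfl⟩ | ⟨rfl, rfl⟩
  · exact ⟨r, hr, by grind, by grind, by grind, by grind⟩
  · exact ⟨r, hr, by grind, by grind, by grind, by grind⟩
  · exact ⟨p, hp, by grind, by grind, by grind, by grind⟩
  · exact ⟨p, hp, by grind, by grind, by grind, by grind⟩
  · exact ⟨q, hq, by grind, by grind, by grind, by grind⟩
  · exact ⟨q, hq, by grind, by grind, by grind, by grind⟩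

/-- A vertex whose triangle has two vertices that lie in no other triangle lies in no other
triangle. -/
theorem single_of_two (h : LocTri n adj T1 T2 o1 o2) {v x y : ℕ}
    (hv : SingleAt adj T1 T2 o1 o2 v) (hx : SingleAt adj T1 T2 o1 o2 x)
    (hvx : adj v x) (hvy : adj v y) (hxy : adj x y) : SingleAt adj T1 T2 o1 o2 y := by
  rcases h.single_or_center (h.symm _ _ hvy) (h.symm _ _ hxy) hvx with h1 | h1
  · exact h1
  · obtain ⟨w, hw, wv, wx, hor, -⟩ := h.center_third h1 (h.symm _ _ hvy) (h.symm _ _ hxy) hvx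
    exfalso
    rcases hor with h2 | h2
    · have e1 := h.pair_eq hv hvx hvy hxy
      have e2 := h.pair_eq hv (h.symm _ _ h2) hvy (h.symm _ _ hw)
      have := h.ne hw
      grind
    · have e1 := h.pair_eq hx (h.symm _ _ hvx) hxy hvy
      have e2 := h.pair_eq hx (h.symm _ _ h2) hxy (h.symm _ _ hw)
      have := h.ne hw
      grind

/-- The active vertices are those whose triangle shares no vertex with another triangle. Testing `v`
and `T1 v` is enough: by `single_of_two` the third vertex is then single as well. -/
theorem triSys (h : LocTri n adj T1 T2 o1 o2) {inact m : ℕ → ℕ}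
    (hin : ∀ v < n, inact v = 0 ↔ T1 v ≠ v ∧ T1 (T1 v) ≠ T1 v)
    (hm : ∀ v < n, o2 v = v → m v < n ∧ m (m v) = v) : TriSys n inact T1 T2 m := by
  have key : ∀ v < n, inact v = 0 → SingleAt adj T1 T2 o1 o2 v ∧ SingleAt adj T1 T2 o1 o2 (T1 v) ∧
      SingleAt adj T1 T2 o1 o2 (T2 v) := by
    intro v hv hav
    obtain ⟨h1, h2⟩ := (hin v hv).1 hav
    have hs := h.single hv h1
    have hs1 := h.single (h.lt' hs.adj1) h2
    exact ⟨hs, hs1, h.single_of_two hs hs1 hs.adj1 hs.adj2 hs.adj12⟩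
  have sw1 : ∀ v < n, inact v = 0 →
      (T1 (T1 v) = v ∧ T2 (T1 v) = T2 v) ∨ (T1 (T1 v) = T2 v ∧ T2 (T1 v) = v) := fun v hv hav =>
    have hs := key v hv hav
    h.pair_eq hs.2.1 (h.symm _ _ hs.1.adj1) hs.1.adj12 hs.1.adj2
  have sw2 : ∀ v < n, inact v = 0 →
      (T1 (T2 v) = v ∧ T2 (T2 v) = T1 v) ∨ (T1 (T2 v) = T1 v ∧ T2 (T2 v) = v) := fun v hv hav =>
    have hs := key v hv hav
    h.pair_eq hs.2.2 (h.symm _ _ hs.1.adj2) (h.symm _ _ hs.1.adj12) hs.1.adj1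
  refine ⟨fun v hv hav => h.lt' (key v hv hav).1.adj1, fun v hv hav => h.lt' (key v hv hav).1.adj2,
    fun v hv hav => ?_, fun v hv hav => ?_, fun v hv hav => h.T1_ne (key v hv hav).1,
    fun v hv hav => h.T2_ne (key v hv hav).1, fun v hv hav => h.ne (key v hv hav).1.adj12,
    sw1, sw2, fun v hv hav => (hm v hv (key v hv hav).1.o2_eq).1,
    fun v hv hav => (hm v hv (key v hv hav).1.o2_eq).2⟩
  · have hs := key v hv hav
    rw [hin _ (h.lt' hs.1.adj1)]
    refine ⟨h.T1_ne hs.2.1, ?_⟩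
    rcases sw1 v hv hav with e | e <;> rw [e.1]
    exacts [h.T1_ne hs.1, h.T1_ne hs.2.2]
  · have hs := key v hv hav
    rw [hin _ (h.lt' hs.1.adj2)]
    refine ⟨h.T1_ne hs.2.2, ?_⟩
    rcases sw2 v hv hav with e | e <;> rw [e.1]
    exacts [h.T1_ne hs.1, h.T1_ne hs.2.1]

/-- The neighbors `o1 v`, `o2 v` are those with which `v` has no common neighbor. -/
theorem outer_iff (h : LocTri n adj T1 T2 o1 o2) {v : ℕ} (hv : v < n) (u : ℕ) :
    (u ≠ v ∧ (u = o1 v ∨ u = o2 v)) ↔ adj v u ∧ ∀ w, adj v w → ¬ adj u w := by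
  rcases h.cases v hv with hs | hc | hp
  · have h1 := hs.outer
    have h2 := hs.nbr
    have h3 := hs.o2_eq
    have h4 := hs.adj1
    have h5 := hs.adj2
    have h6 := hs.adj12
    have h7 := h.symm _ _ hs.adj12
    have hirr := h.irrefl
    constructor
    · rintro ⟨h8, h9⟩
      have : u = o1 v := by grind
      subst this
      refine ⟨(h1 h8).1, fun w hw => ?_⟩
      rcases h2 w hw with rfl | rfl | rfl
      exacts [(h1 h8).2.2.2.1, (h1 h8).2.2.2.2, hirr _]
    · rintro ⟨h8, h9⟩
      refine ⟨(h.ne h8).symm, ?_⟩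
      rcases h2 u h8 with rfl | rfl | rfl
      exacts [absurd h6 (h9 _ h5), absurd h7 (h9 _ h4), .inl rfl]
  · obtain ⟨x, y, z, hx, hy, hz, hxz, hyx, hyz, hall⟩ := hc.nbr
    constructor
    · rintro ⟨h8, h9⟩
      rw [hc.o1_eq, hc.o2_eq] at h9
      exact absurd (h9.elim id id) h8
    · rintro ⟨h8, h9⟩
      rcases hall u h8 with rfl | rfl | rfl
      exacts [absurd (h.symm _ _ hyx) (h9 _ hy), absurd hyx (h9 _ hx),
        absurd (h.symm _ _ hyz) (h9 _ hy)]
  · rw [← hp.nbr u]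
    exact ⟨fun h1 => ⟨h1, fun w hw => hp.not_adj u w h1 hw⟩, fun h1 => h1.1⟩

/-- The description by common neighbours in `outer_iff` is symmetric in the two vertices. -/
theorem outer_symm (h : LocTri n adj T1 T2 o1 o2) {v u : ℕ} (hv : v < n)
    (hu : u = o1 v ∨ u = o2 v) : o1 u = v ∨ o2 u = v := by
  by_cases huv : u = v
  · subst huv
    rcases hu with e | e
    exacts [.inl e.symm, .inr e.symm]
  · have h1 := (h.outer_iff hv u).1 ⟨huv, hu⟩
    have h2 := (h.outer_iff (h.lt' h1.1) v).2 ⟨h.symm _ _ h1.1, fun w hw hvw => h1.2 w hvw hw⟩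
    exact h2.2.imp Eq.symm Eq.symm

/-- A vertex with two outer neighbours is plain and has no other neighbours, so the dynamic
condition gives these two different colours. -/
theorem pathSys (h : LocTri n adj T1 T2 o1 o2) {c : ℕ → Fin 3}
    (hprop : ∀ u v, adj u v → c u ≠ c v)
    (hdyn : ∀ v x y, adj v x → adj v y → x ≠ y → (∀ u, adj v u → u = x ∨ u = y) → c x ≠ c y) :
    PathSys n o1 o2 c := by
  have out1 : ∀ v < n, o1 v ≠ v → adj v (o1 v) := fun v hv h1 =>
    ((h.outer_iff hv _).1 ⟨h1, .inl rfl⟩).1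
  have out2 : ∀ v < n, o2 v ≠ v → adj v (o2 v) := fun v hv h1 =>
    ((h.outer_iff hv _).1 ⟨h1, .inr rfl⟩).1
  have ne12 : ∀ v < n, o2 v ≠ v → o1 v ≠ o2 v := by
    intro v hv h1
    rcases h.cases v hv with hs | hc | hp
    exacts [absurd hs.o2_eq h1, absurd hc.o2_eq h1, hp.ne h1]
  have miss : ∀ v < n, o1 v = v → o2 v = v := by
    intro v hv h1
    rcases h.cases v hv with hs | hc | hp
    exacts [hs.o2_eq, hc.o2_eq, hp.miss h1]
  refine ⟨fun v hv => ?_, fun v hv => ?_, fun v hv => h.outer_symm hv (.inl rfl),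
    fun v hv => h.outer_symm hv (.inr rfl), miss, ne12,
    fun v hv h1 => (hprop _ _ (out1 v hv h1)).symm, fun v hv h1 => (hprop _ _ (out2 v hv h1)).symm,
    fun v hv h1 => ?_⟩
  · by_cases h1 : o1 v = v
    · rwa [h1]
    · exact h.lt' (out1 v hv h1)
  · by_cases h1 : o2 v = v
    · rwa [h1]
    · exact h.lt' (out2 v hv h1)
  · refine hdyn v _ _ (out1 v hv fun e => h1 (miss v hv e)) (out2 v hv h1) (ne12 v hv h1)
      fun u hu => ?_
    rcases h.cases v hv with hs | hc | hp
    exacts [absurd hs.o2_eq h1, absurd hc.o2_eq h1, ((hp.nbr u).1 hu).2]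

/-- A vertex in two triangles is one of the two central vertices of a diamond. -/
theorem diamond (h : LocTri n adj T1 T2 o1 o2) {c : ℕ → Fin 3}
    (hprop : ∀ u v, adj u v → c u ≠ c v) {v : ℕ} (hv : CenterAt adj T1 T2 o1 o2 v) :
    ∃ x y z, adj v x ∧ adj v y ∧ adj v z ∧ x ≠ z ∧ adj y x ∧ adj y z ∧
      (∀ u, adj v u → u = x ∨ u = y ∨ u = z) ∧ (∀ u, adj y u → u = x ∨ u = v ∨ u = z) ∧
      SingleAt adj T1 T2 o1 o2 x ∧ CenterAt adj T1 T2 o1 o2 y ∧ SingleAt adj T1 T2 o1 o2 z ∧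
      c x = c z := by
  obtain ⟨x, y, z, hx, hy, hz, hxz, hyx, hyz, hall⟩ := hv.nbr
  have c1 := hprop _ _ hx
  have c2 := hprop _ _ hy
  have c3 := hprop _ _ hz
  have c4 := hprop _ _ hyx
  have c5 := hprop _ _ hyz
  -- `v` and `y` are adjacent, and each of `x` and `z` is adjacent to both, so a single colour is
  -- left for `x` and `z`. This excludes `K_4`.
  have hcxz : c x = c z := by
    generalize c x = a at *
    generalize c y = b at *
    generalize c z = d at *
    generalize c v = e at *
    omega
  have nxz : ¬ adj x z := fun e => hprop _ _ e hcxz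
  have nzx : ¬ adj z x := fun e => nxz (h.symm _ _ e)
  have yc : CenterAt adj T1 T2 o1 o2 y := by
    rcases h.single_or_center (h.symm _ _ hy) hyx hx with h1 | h1
    · have e1 := h.pair_eq h1 (h.symm _ _ hy) hyx hx
      have e2 := h.pair_eq h1 (h.symm _ _ hy) hyz hz
      have := h.ne hx
      grind
    · exact h1
  have yall : ∀ u, adj y u → u = x ∨ u = v ∨ u = z := by
    obtain ⟨w, hw, wv, wx, -, hw2⟩ := h.center_third yc (h.symm _ _ hy) hyx hx
    have := hw2 z hyz
    have := h.ne hz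
    intro u hu
    have := hw2 u hu
    grind
  -- In a second triangle at `p`, the further vertex would be adjacent to `v` or `y`, hence equal to
  -- `q`; but `p` and `q` are not adjacent.
  have side : ∀ p q, adj v p → adj y p → ¬ adj p q → ¬ adj q p → (∀ u, adj v u → u = p ∨ u = y ∨ u = q) →
      (∀ u, adj y u → u = p ∨ u = v ∨ u = q) → SingleAt adj T1 T2 o1 o2 p := by
    intro p q hp hyp npq nqp hva hya
    rcases h.single_or_center (h.symm _ _ hp) (h.symm _ _ hyp) hy with h1 | h1
    · exact h1
    · obtain ⟨w, hw, wv, wy, hor, -⟩ := h.center_third h1 (h.symm _ _ hp) (h.symm _ _ hyp) hy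
      have w1 := h.ne hw
      exfalso
      rcases hor with h2 | h2
      · have := hva w (h.symm _ _ h2)
        grind
      · have := hya w (h.symm _ _ h2)
        grind
  refine ⟨x, y, z, hx, hy, hz, hxz, hyx, hyz, hall, yall, ?_, yc, ?_, hcxz⟩
  · exact side x z hx hyx nxz nzx hall yall
  · refine side z x hz hyz nzx nxz (fun u hu => ?_) (fun u hu => ?_)
    · have := hall u hu; grind
    · have := yall u hu; grind

/-- The structure of a diamond seen from one of its ends. -/
theorem diamond_end (h : LocTri n adj T1 T2 o1 o2) {c : ℕ → Fin 3}
    (hprop : ∀ u v, adj u v → c u ≠ c v) {a : ℕ} (ha : a < n) (h1 : T1 a ≠ a)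
    (h2 : T1 (T1 a) = T1 a) :
    ∃ b, b < n ∧ b ≠ a ∧ b ≠ T1 a ∧ b ≠ T2 a ∧ adj (T1 a) b ∧ c b = c a ∧
      (∀ u, adj (T1 a) u → u = a ∨ u = T2 a ∨ u = b) ∧
      (∀ u, adj (T2 a) u → u = a ∨ u = T1 a ∨ u = b) ∧
      SingleAt adj T1 T2 o1 o2 a ∧ SingleAt adj T1 T2 o1 o2 b ∧
      CenterAt adj T1 T2 o1 o2 (T1 a) ∧ CenterAt adj T1 T2 o1 o2 (T2 a) ∧
      ((T1 b = T1 a ∧ T2 b = T2 a) ∨ (T1 b = T2 a ∧ T2 b = T1 a)) := by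
  have hs := h.single ha h1
  have hc : CenterAt adj T1 T2 o1 o2 (T1 a) := by
    rcases h.single_or_center (h.symm _ _ hs.adj1) hs.adj12 hs.adj2 with h3 | h3
    exacts [absurd h2 (h.T1_ne h3), h3]
  obtain ⟨x, y, z, hx, hy, hz, hxz, hyx, hyz, hall, yall, sx, cy, sz, hcc⟩ := h.diamond hprop hc
  have hay : a ≠ y := by
    rintro rfl
    exact h.T1_ne hs cy.T1_eq
  have px := h.pair_eq sx (h.symm _ _ hx) (h.symm _ _ hyx) hy
  have pz := h.pair_eq sz (h.symm _ _ hz) (h.symm _ _ hyz) hy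
  have n1 := h.ne hx
  have n2 := h.ne hy
  have n3 := h.ne hz
  have n4 := h.ne hyx
  have n5 := h.ne hyz
  have hT2 : T2 a = y := by
    rcases hall a (h.symm _ _ hs.adj1) with rfl | rfl | rfl
    · grind
    · exact absurd rfl hay
    · grind
  rw [hT2]
  rcases hall a (h.symm _ _ hs.adj1) with rfl | rfl | rfl
  · refine ⟨z, h.lt' hz, hxz.symm, n3.symm, n5.symm, hz, hcc.symm, hall, fun u hu => ?_, sx, sz,
      hc, cy, pz⟩
    exact yall u hu
  · exact absurd rfl hay
  · refine ⟨x, h.lt' hx, hxz, n1.symm, n4.symm, hx, hcc, fun u hu => ?_, fun u hu => ?_, sz, sx,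
      hc, cy, px⟩
    · have := hall u hu; grind
    · have := yall u hu; grind

end LocTri

/-! ### Coloring the diamonds -/

/-- A number below 3 different from two given ones. -/
def pick (p q : ℕ) : ℕ :=
  if p = 0 then if p = 1 then 2 else if q = 1 then 2 else 1
  else if q = 0 then if p = 1 then 2 else if q = 1 then 2 else 1
  else 0

theorem pick_spec (p q : ℕ) : pick p q < 3 ∧ pick p q ≠ p ∧ pick p q ≠ q := by
  unfold pick
  split_ifs <;> omega

def Ex.pick (p q : Ex) : Ex :=
  .ite p (.lit 0) (.ite p (.lit 1) (.lit 2) (.ite q (.lit 1) (.lit 2) (.lit 1)))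
    (.ite q (.lit 0) (.ite p (.lit 1) (.lit 2) (.ite q (.lit 1) (.lit 2) (.lit 1))) (.lit 0))

theorem Ex.eval_pick (ρ : ℕ → ℕ) (A : ℕ → ℕ → ℕ) (p q : Ex) :
    (p.pick q).eval ρ A = _root_.pick (p.eval ρ A) (q.eval ρ A) := rfl

/-- Disjoint diamonds with ends `a`, `op a` and centers `T1 a`, `T2 a`; `op a = a` if `a` is not
the end of a diamond. The ends are linked to other vertices by `m`. -/
structure DiaSys (n : ℕ) (T1 T2 op m : ℕ → ℕ) : Prop where
  op_lt : ∀ a < n, op a ≠ a → op a < n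
  op_op : ∀ a < n, op a ≠ a → op (op a) = a
  lt1 : ∀ a < n, op a ≠ a → T1 a < n
  lt2 : ∀ a < n, op a ≠ a → T2 a < n
  ne1 : ∀ a < n, op a ≠ a → T1 a ≠ a
  ne2 : ∀ a < n, op a ≠ a → T2 a ≠ a
  ne12 : ∀ a < n, op a ≠ a → T1 a ≠ T2 a
  op_ne1 : ∀ a < n, op a ≠ a → op a ≠ T1 a
  op_ne2 : ∀ a < n, op a ≠ a → op a ≠ T2 a
  op1 : ∀ a < n, op a ≠ a → op (T1 a) = T1 a
  op2 : ∀ a < n, op a ≠ a → op (T2 a) = T2 a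
  T1_1 : ∀ a < n, op a ≠ a → T1 (T1 a) = T1 a
  T1_2 : ∀ a < n, op a ≠ a → T1 (T2 a) = T2 a
  op_T : ∀ a < n, op a ≠ a →
    (T1 (op a) = T1 a ∧ T2 (op a) = T2 a) ∨ (T1 (op a) = T2 a ∧ T2 (op a) = T1 a)
  disj : ∀ a < n, op a ≠ a → ∀ b < n, op b ≠ b →
    T1 b = T1 a ∨ T1 b = T2 a ∨ T2 b = T1 a ∨ T2 b = T2 a → b = a ∨ b = op a
  m_ne : ∀ a < n, op a ≠ a → m a ≠ op a
  m_lt : ∀ v < n, T1 v ≠ v → m v < n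
  mm : ∀ v < n, T1 v ≠ v → m (m v) = v

/-- The coloring `col` extends `col₀` to the diamonds whose ends do not have color 4. -/
structure DiaColoring (n : ℕ) (T1 T2 op m col₀ col : ℕ → ℕ) : Prop where
  eq_off : ∀ v < n, op v = v → (∀ a < n, op a ≠ a → v ≠ T1 a ∧ v ≠ T2 a) → col v = col₀ v
  dia : ∀ a < n, op a ≠ a → (col a = 4 ∧ col (op a) = 4) ∨
    (col a < 3 ∧ col (op a) = col a ∧ col (T1 a) < 3 ∧ col (T2 a) < 3 ∧ col (T1 a) ≠ col a ∧
      col (T2 a) ≠ col a ∧ col (T1 a) ≠ col (T2 a))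
  linked : ∀ v < n, T1 v ≠ v → T1 (m v) ≠ m v → m v ≠ v → col v ≠ 4 → col (m v) ≠ 4 →
    col v ≠ col (m v)

theorem inc3_spec {a : ℕ} (h : a < 3) :
    inc3 a < 3 ∧ inc3 a ≠ a ∧ inc3 (inc3 a) < 3 ∧ inc3 (inc3 a) ≠ a ∧ inc3 (inc3 a) ≠ inc3 a := by
  unfold inc3
  interval_cases a <;> simp

/-- Three colours always leave one for the two ends that avoids the colours of both mates, and the
centers take the two other colours. By `m_ne` the ends are not linked to each other, so giving them
the same colour does no harm; by `disj` no other diamond is touched. -/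
theorem DiaColoring.step {n : ℕ} {T1 T2 op m col₀ col : ℕ → ℕ}
    (h : DiaColoring n T1 T2 op m col₀ col) (hD : DiaSys n T1 T2 op m) {i x : ℕ} (hi : i < n)
    (ho : op i ≠ i) (hc : col i = 4) (hx : x < 3) (hx1 : x ≠ col (m i)) (hx2 : x ≠ col (m (op i))) :
    DiaColoring n T1 T2 op m col₀
      (Function.update (Function.update (Function.update (Function.update col i x) (op i) x)
        (T1 i) (inc3 x)) (T2 i) (inc3 (inc3 x))) := by
  have b1 := hD.op_lt i hi ho
  have b2 := hD.op_op i hi ho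
  have ho' : op (op i) ≠ op i := by rw [b2]; exact ho.symm
  have b3 := hD.ne1 i hi ho
  have b4 := hD.ne2 i hi ho
  have b5 := hD.ne12 i hi ho
  have b6 := hD.op_ne1 i hi ho
  have b7 := hD.op_ne2 i hi ho
  have b8 := hD.op1 i hi ho
  have b9 := hD.op2 i hi ho
  have b10 := hD.T1_1 i hi ho
  have b11 := hD.T1_2 i hi ho
  have b12 := hD.op_T i hi ho
  have b13 := hD.m_ne i hi ho
  have b14 := hD.ne1 _ b1 ho'
  have c1 := hD.mm i hi b3
  have c2 := hD.mm _ b1 b14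
  have hinc := inc3_spec hx
  generalize inc3 (inc3 x) = x2 at *
  generalize inc3 x = x1 at *
  constructor
  · intro v hv hov hoff
    have := h.eq_off v hv hov hoff
    have := hoff i hi ho
    simp only [Function.update_apply]
    grind
  · intro a ha hoa
    have d0 := h.dia a ha hoa
    have d1 := hD.disj i hi ho a ha hoa
    have d2 := hD.op_op a ha hoa
    have d3 := hD.op1 a ha hoa
    have d4 := hD.op2 a ha hoa
    by_cases hai : a = i
    · subst hai
      simp only [Function.update_apply]
      grind
    · by_cases hab : a = op i
      · subst hab
        simp only [Function.update_apply]
        grind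
      · have e1 : op a ≠ i := fun e => hab (by rw [← e, d2])
        have e2 : op a ≠ op i := fun e => hai (by rw [← d2, e, b2])
        have f1 : a ≠ T1 i := fun e => hoa (by rw [e, b8])
        have f2 : a ≠ T2 i := fun e => hoa (by rw [e, b9])
        have f3 : op a ≠ T1 i := fun e => f1 (by rw [← d2, e, b8])
        have f4 : op a ≠ T2 i := fun e => f2 (by rw [← d2, e, b9])
        have f5 : T1 a ≠ i := fun e => ho (by rw [← e, d3])
        have f6 : T2 a ≠ i := fun e => ho (by rw [← e, d4])
        have f7 : T1 a ≠ op i := fun e => ho' (by rw [← e, d3])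
        have f8 : T2 a ≠ op i := fun e => ho' (by rw [← e, d4])
        have d1' : ¬ (T1 a = T1 i ∨ T1 a = T2 i ∨ T2 a = T1 i ∨ T2 a = T2 i) :=
          fun e => (d1 e).elim hai hab
        simp only [not_or] at d1'
        obtain ⟨g1, g2, g3, g4⟩ := d1'
        simpa only [Function.update_apply, hai, hab, e1, e2, f1, f2, f3, f4, f5, f6, f7, f8, g1,
          g2, g3, g4, if_false] using d0
  · intro v hv hv1 hmv1 hmv
    have d0 := h.linked v hv hv1 hmv1 hmv
    have d1 := hD.mm v hv hv1
    simp only [Function.update_apply]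
    grind

/-- The initialization and the loop body of the coloring of the diamonds in array 4. Arrays 6, 7,
8, 19 hold `T1`, `T2`, `m`, `op`. -/
def diamondInit : St := .set 1 (.lit 0)

def diamondBody : St :=
  .ite (.rd 19 (.var 1)) (.var 1) (.set 1 (.succ (.var 1)))
    (.ite (.rd 4 (.var 1)) (.lit 4)
      (.set 2 (.pick (.rd 4 (.rd 8 (.var 1))) (.rd 4 (.rd 8 (.rd 19 (.var 1))))) ;;
        .put 4 (.var 1) (.var 2) ;; .put 4 (.rd 19 (.var 1)) (.var 2) ;;
        .put 4 (.rd 6 (.var 1)) (.inc3 (.var 2)) ;;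
        .put 4 (.rd 7 (.var 1)) (.inc3 (.inc3 (.var 2))) ;; .set 1 (.succ (.var 1)))
      (.set 1 (.succ (.var 1))))

/-- Coloring the diamonds. -/
def diamondProg : RamProg := .phase diamondInit diamondBody

theorem diamondProg_spec :
    diamondProg.Spec
      (fun n A => DiaSys n (A 6) (A 7) (A 19) (A 8) ∧
        DiaColoring n (A 6) (A 7) (A 19) (A 8) (A 4) (A 4))
      (fun n A A' => (∀ b, b ≠ 4 → A' b = A b) ∧
        DiaColoring n (A 6) (A 7) (A 19) (A 8) (A 4) (A' 4) ∧
        ∀ a < n, A 19 a ≠ a → A' 4 a ≠ 4) := by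
  refine RamProg.phase_spec rfl rfl
    (fun n A s => s.reg 0 = n ∧ (∀ b, b ≠ 4 → s.arr b = A b) ∧
      DiaColoring n (A 6) (A 7) (A 19) (A 8) (A 4) (s.arr 4) ∧
        ∀ a < n, a < s.reg 1 → A 19 a ≠ a → s.arr 4 a ≠ 4)
    (fun s => s.reg 0 - s.reg 1) 1 ?_ ?_ ?_
  · rintro n A s rfl rfl ⟨-, hC⟩
    simp only [diamondInit, St.run, RamState.setReg, Ex.eval]
    exact ⟨⟨rfl, fun _ _ => trivial, hC, fun a _ h => by simp at h⟩, by simp⟩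
  · rintro n A s ⟨hD, -⟩ ⟨rfl, hA, hC, hdone⟩ hlt
    have h6 := hA 6 (by decide)
    have h7 := hA 7 (by decide)
    have h8 := hA 8 (by decide)
    have h19 := hA 19 (by decide)
    have hsplit : ∀ a, a < s.reg 1 + 1 ↔ a < s.reg 1 ∨ a = s.reg 1 := fun a => by omega
    by_cases ho : A 19 (s.reg 1) = s.reg 1
    · simp only [diamondBody, St.run, RamState.setReg, Ex.eval, h19, ho, if_true]
      refine ⟨⟨rfl, hA, hC, fun a ha h hoa => ?_⟩, by simp; omega⟩
      simp only [Function.update_self, hsplit] at h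
      rcases h with h | rfl
      exacts [hdone a ha h hoa, absurd ho hoa]
    · by_cases hc : s.arr 4 (s.reg 1) = 4
      · obtain ⟨hx, hx1, hx2⟩ :=
          pick_spec (s.arr 4 (A 8 (s.reg 1))) (s.arr 4 (A 8 (A 19 (s.reg 1))))
        have hC' := hC.step hD hlt ho hc hx hx1 hx2
        simp only [diamondBody, St.run, RamState.setReg, RamState.setArr, Ex.eval, Ex.eval_pick,
          Ex.eval_inc3, h19, ho, hc, if_true, if_false]
        refine ⟨⟨rfl, fun b h4 => ?_, ?_, fun a ha h hoa => ?_⟩, by simp; omega⟩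
        · simpa [h4] using hA b h4
        · simpa [h6, h7, h8, h19] using hC'
        · rcases (by simpa [hsplit] using h : a < s.reg 1 ∨ a = s.reg 1) with h | h
          · have h1 := hdone a ha h hoa
            have d := inc3_spec hx
            simp only [Function.update_self, Function.update_apply, h6, h7, h8, h19]
            simp
            split_ifs <;> grind
          · have d := inc3_spec hx
            simp only [Function.update_self, Function.update_apply, h6, h7, h8, h19]
            simp
            split_ifs <;> grind
      · simp only [diamondBody, St.run, RamState.setReg, Ex.eval, h19, ho, hc, if_false]
        refine ⟨⟨rfl, hA, hC, fun a ha h hoa => ?_⟩, by simp; omega⟩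
        simp only [Function.update_self, hsplit] at h
        rcases h with h | rfl
        exacts [hdone a ha h hoa, hc]
  · rintro n A s - ⟨rfl, hA, hC, hdone⟩ hlt
    exact ⟨rfl, hA, hC, fun a ha => hdone a ha (by omega)⟩

/-! ### Assembling the coloring -/

/-- `a + (p - q)` modulo 3. -/
def shift (a p q : ℕ) : ℕ := if p = q then a else if p = inc3 q then inc3 a else inc3 (inc3 a)

/-- The color of an element with label `p` in a component whose ends have labels `p1`, `p2` and
colors `a1`, `a2`, where color 4 is no restriction. -/
def fill (a1 a2 p1 p2 p : ℕ) : ℕ :=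
  if a1 = 4 then if a2 = 4 then p else shift a2 p p2
  else if a2 = 4 then shift a1 p p1
  else if p1 = p2 then shift a1 p p1
  else if p = p1 then a1 else if p = p2 then a2 else third a1 a2

theorem shift_spec {a q : ℕ} (ha : a < 3) (hq : q < 3) :
    (∀ p < 3, shift a p q < 3) ∧ (∀ p < 3, ∀ r < 3, shift a p q = shift a r q → p = r) ∧
      shift a q q = a := by
  have key : ∀ a < 3, ∀ q < 3, (∀ p < 3, shift a p q < 3) ∧
      (∀ p < 3, ∀ r < 3, shift a p q = shift a r q → p = r) ∧ shift a q q = a := by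
    unfold shift inc3
    decide
  exact key a ha q hq

/-- A permutation taking `p1` to `a1` and `p2` to `a2` exists precisely when the labels agree
exactly if the colours do. With at most one prescribed value a rotation is enough. -/
theorem fill_spec {a1 a2 p1 p2 : ℕ} (ha1 : a1 < 3 ∨ a1 = 4) (ha2 : a2 < 3 ∨ a2 = 4) (hp1 : p1 < 3)
    (hp2 : p2 < 3) (h : a1 ≠ 4 → a2 ≠ 4 → (p1 = p2 ↔ a1 = a2)) :
    (∀ p < 3, fill a1 a2 p1 p2 p < 3) ∧
      (∀ p < 3, ∀ q < 3, fill a1 a2 p1 p2 p = fill a1 a2 p1 p2 q → p = q) ∧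
      (a1 ≠ 4 → fill a1 a2 p1 p2 p1 = a1) ∧ (a2 ≠ 4 → fill a1 a2 p1 p2 p2 = a2) := by
  rcases ha1 with ha1 | rfl <;> rcases ha2 with ha2 | rfl
  · have h1 : a1 ≠ 4 := by omega
    have h2 : a2 ≠ 4 := by omega
    have h := h h1 h2
    have h3 := shift_spec ha1 hp1
    by_cases hp : p1 = p2
    · subst hp
      have h4 := h.1 rfl
      subst h4
      simpa [fill, h1] using h3
    · have h4 : a1 ≠ a2 := fun e => hp (h.2 e)
      have key : third a1 a2 < 3 ∧ third a1 a2 ≠ a1 ∧ third a1 a2 ≠ a2 := by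
        unfold third inc3
        split_ifs <;> omega
      simp only [fill, h1, h2, hp, if_false]
      generalize third a1 a2 = a3 at key
      refine ⟨fun p hp => ?_, fun p hp q hq => ?_, fun _ => by simp, fun _ => ?_⟩
      · split_ifs <;> omega
      · split_ifs <;> omega
      · simp [Ne.symm hp]
  · have h1 : a1 ≠ 4 := by omega
    simpa [fill, h1] using shift_spec ha1 hp1
  · have h1 : a2 ≠ 4 := by omega
    simpa [fill, h1] using shift_spec ha2 hp2
  · simp [fill]

namespace Ex

def shift (a p q : Ex) : Ex := .ite p q a (.ite p q.inc3 a.inc3 a.inc3.inc3)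

def fill (a1 a2 p1 p2 p : Ex) : Ex :=
  .ite a1 (.lit 4) (.ite a2 (.lit 4) p (.shift a2 p p2))
    (.ite a2 (.lit 4) (.shift a1 p p1)
      (.ite p1 p2 (.shift a1 p p1) (.ite p p1 a1 (.ite p p2 a2 (.third a1 a2)))))

theorem eval_fill (ρ : ℕ → ℕ) (A : ℕ → ℕ → ℕ) (a1 a2 p1 p2 p : Ex) :
    (fill a1 a2 p1 p2 p).eval ρ A = _root_.fill (a1.eval ρ A) (a2.eval ρ A) (p1.eval ρ A)
      (p2.eval ρ A) (p.eval ρ A) := rfl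

end Ex

/-- The other end of the diamond of `v`, if `v` is an end of a diamond, and `v` otherwise. -/
def opposite (N1 N2 N3 T1 T2 : ℕ → ℕ) (v : ℕ) : ℕ :=
  if T1 v = v then v else if T1 (T1 v) = T1 v then
    if N1 (T1 v) ≠ v ∧ N1 (T1 v) ≠ T2 v then N1 (T1 v)
    else if N2 (T1 v) ≠ v ∧ N2 (T1 v) ≠ T2 v then N2 (T1 v) else N3 (T1 v)
  else v

/-- Marking the vertices outside isolated triangles in array 9 and computing the opposite ends of
diamonds in array 19. -/
def diamondMaps : List (ℕ × Ex) :=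
  let u : Ex := .rd 6 (.var 1)
  let third : Ex := .ite (.rd 12 u) (.var 1) (.rd 13 u)
    (.ite (.rd 12 u) (.rd 7 (.var 1)) (.rd 13 u) (.rd 12 u))
  [(9, .ite u (.var 1) (.lit 1) (.ite (.rd 6 u) u (.lit 1) (.lit 0))),
    (19, .ite u (.var 1) (.var 1) (.ite (.rd 6 u) u
      (.ite (.rd 11 u) (.var 1) third (.ite (.rd 11 u) (.rd 7 (.var 1)) third (.rd 11 u)))
      (.var 1)))]

theorem diamondMaps_spec {n : ℕ} (A : ℕ → ℕ → ℕ) :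
    (∀ b, b ≠ 9 → b ≠ 19 → mapsArr n diamondMaps A b = A b) ∧
    (∀ v < n, mapsArr n diamondMaps A 9 v = 0 ↔ A 6 v ≠ v ∧ A 6 (A 6 v) ≠ A 6 v) ∧
    ∀ v < n, mapsArr n diamondMaps A 19 v = opposite (A 11) (A 12) (A 13) (A 6) (A 7) v := by
  refine ⟨fun b h9 h19 => by simp [diamondMaps, mapsArr, mapArr_of_ne, h9, h19],
    fun v hv => ?_, fun v hv => ?_⟩
  · simp only [diamondMaps, mapsArr]
    rw [mapArr_of_ne _ _ (by decide), mapArr_self _ _ hv]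
    simp only [Ex.eval, one_ne_zero, if_false]
    split_ifs <;> simp_all
  · simp only [diamondMaps, mapsArr]
    rw [mapArr_self _ _ hv]
    simp [Ex.eval, opposite, mapArr_of_ne]
    split_ifs <;> grind

/-- The final coloring in array 4. -/
def fillMaps : List (ℕ × Ex) :=
  let e1 : Ex := .rd 18 (.rd 17 (.var 1))
  let e2 : Ex := .rd 8 e1
  [(20, .rd 4 (.var 1)),
    (4, .fill (.rd 20 e1) (.rd 20 e2) (.rd 16 e1) (.rd 16 e2) (.rd 16 (.var 1)))]

/-- The color of `v` in the final coloring. -/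
def finalColor (pos root m E col : ℕ → ℕ) (v : ℕ) : ℕ :=
  fill (col (E (root v))) (col (m (E (root v)))) (pos (E (root v))) (pos (m (E (root v)))) (pos v)

theorem fillMaps_spec {n : ℕ} (A : ℕ → ℕ → ℕ) {v : ℕ} (hv : v < n) (hE : A 18 (A 17 v) < n)
    (hm : A 8 (A 18 (A 17 v)) < n) :
    mapsArr n fillMaps A 4 v = finalColor (A 16) (A 17) (A 8) (A 18) (A 4) v := by
  simp only [fillMaps, mapsArr]
  rw [mapArr_self _ _ hv]
  simp only [Ex.eval_fill, Ex.eval, finalColor]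
  simp [mapArr_of_ne, mapArr_self, hE, hm, Ex.eval]

section

variable {n : ℕ} {adj : ℕ → ℕ → Prop} {N1 N2 N3 T1 T2 o1 o2 op inact : ℕ → ℕ} {c : ℕ → Fin 3}
  {pos root m E col col₀ : ℕ → ℕ}

/-- The center `T1 a` has exactly three neighbours: `a`, the other center `T2 a`, and the opposite
end. The search through its neighbour list for one different from the first two thus finds the
opposite end. The same argument from that end leads back to `a`, even if its two centers are listed
in the other order. -/
theorem LocTri.opposite_spec (h : LocTri n adj T1 T2 o1 o2) (hN : NbrFun n adj N1 N2 N3)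
    (hprop : ∀ u v, adj u v → c u ≠ c v)
    (hop : ∀ v < n, op v = opposite N1 N2 N3 T1 T2 v) {a : ℕ} (ha : a < n) (h1 : T1 a ≠ a)
    (h2 : T1 (T1 a) = T1 a) :
    op a ≠ a ∧ op a < n ∧ op (op a) = a ∧ op a ≠ T1 a ∧ op a ≠ T2 a ∧ c (op a) = c a ∧
      SingleAt adj T1 T2 o1 o2 a ∧ CenterAt adj T1 T2 o1 o2 (T1 a) ∧
      CenterAt adj T1 T2 o1 o2 (T2 a) ∧
      ((T1 (op a) = T1 a ∧ T2 (op a) = T2 a) ∨ (T1 (op a) = T2 a ∧ T2 (op a) = T1 a)) ∧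
      (∀ u, adj (T1 a) u → u = a ∨ u = T2 a ∨ u = op a) ∧
      (∀ u, adj (T2 a) u → u = a ∨ u = T1 a ∨ u = op a) := by
  have key : ∀ a b, a < n → T1 a ≠ a → T1 (T1 a) = T1 a → b ≠ a → b ≠ T2 a → adj (T1 a) b →
      adj (T1 a) a → (∀ u, adj (T1 a) u → u = a ∨ u = T2 a ∨ u = b) → op a = b := by
    intro a b ha h1 h2 h3 h4 h5 h6 h7
    have hu := h.lt _ _ h5
    have m1 := hN.mem _ hu (N1 (T1 a))
    have m2 := hN.mem _ hu (N2 (T1 a))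
    have m3 := hN.mem _ hu (N3 (T1 a))
    have mb := (hN.mem _ hu b).1 h5
    have n1 := hN.miss1 _ hu
    have n2 := hN.miss2 _ hu
    have s1 := h7 (N1 (T1 a))
    have s2 := h7 (N2 (T1 a))
    have s3 := h7 (N3 (T1 a))
    rw [hop a ha]
    unfold opposite
    rw [if_neg h1, if_pos h2]
    split_ifs <;> grind
  obtain ⟨b, hbn, hba, hb1, hb2, hab, hcb, hall1, hall2, sa, sb, ce1, ce2, hT⟩ :=
    h.diamond_end hprop ha h1 h2
  have e1 : op a = b := key a b ha h1 h2 hba hb2 hab (h.symm _ _ sa.adj1) hall1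
  have e2 : op b = a := by
    have hb3 := h.T1_ne sb
    have adj1 := h.symm _ _ sb.adj1
    have n1 := h.ne sa.adj1
    have n2 := h.ne sa.adj2
    have a1 := h.symm _ _ sa.adj1
    have a2 := h.symm _ _ sa.adj2
    rcases hT with ⟨t1, t2⟩ | ⟨t1, t2⟩
    · refine key b a hbn hb3 ?_ hba.symm ?_ ?_ adj1 ?_
      · rw [t1, h2]
      · rw [t2]; exact n2
      · rw [t1]; exact a1
      · rw [t1, t2]
        intro u hu
        have := hall1 u hu
        grind
    · refine key b a hbn hb3 ?_ hba.symm ?_ ?_ adj1 ?_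
      · rw [t1, ce2.T1_eq]
      · rw [t2]; exact n1
      · rw [t1]; exact a2
      · rw [t1, t2]
        intro u hu
        have := hall2 u hu
        grind
  rw [e1]
  exact ⟨hba, hbn, e2, hb1, hb2, hcb, sa, ce1, ce2, hT, hall1, hall2⟩

theorem opposite_ne (hop : ∀ v < n, op v = opposite N1 N2 N3 T1 T2 v) {a : ℕ} (ha : a < n)
    (hoa : op a ≠ a) : T1 a ≠ a ∧ T1 (T1 a) = T1 a := by
  rw [hop a ha] at hoa
  unfold opposite at hoa
  split_ifs at hoa <;> grind

theorem LocTri.diaSys (h : LocTri n adj T1 T2 o1 o2) (hN : NbrFun n adj N1 N2 N3)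
    (hprop : ∀ u v, adj u v → c u ≠ c v) (hop : ∀ v < n, op v = opposite N1 N2 N3 T1 T2 v)
    (hL : IsLinking n o1 o2 c pos root m E)
    (hlink : ∀ u < n, ∀ v < n, T1 u ≠ u → T1 v ≠ v → u ≠ v → root u = root v → c u ≠ c v) :
    DiaSys n T1 T2 op m := by
  have spec := fun a (ha : a < n) (hoa : op a ≠ a) =>
    h.opposite_spec hN hprop hop ha (opposite_ne hop ha hoa).1 (opposite_ne hop ha hoa).2
  have fix : ∀ v < n, T1 v = v → op v = v := fun v hv hT => by
    by_contra h1
    exact (opposite_ne hop hv h1).1 hT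
  constructor
  · exact fun a ha hoa => (spec a ha hoa).2.1
  · exact fun a ha hoa => (spec a ha hoa).2.2.1
  · exact fun a ha hoa => h.lt' (spec a ha hoa).2.2.2.2.2.2.1.adj1
  · exact fun a ha hoa => h.lt' (spec a ha hoa).2.2.2.2.2.2.1.adj2
  · exact fun a ha hoa => h.T1_ne (spec a ha hoa).2.2.2.2.2.2.1
  · exact fun a ha hoa => h.T2_ne (spec a ha hoa).2.2.2.2.2.2.1
  · exact fun a ha hoa => h.ne (spec a ha hoa).2.2.2.2.2.2.1.adj12
  · exact fun a ha hoa => (spec a ha hoa).2.2.2.1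
  · exact fun a ha hoa => (spec a ha hoa).2.2.2.2.1
  · intro a ha hoa
    obtain ⟨-, -, -, -, -, -, s, c1, c2, -⟩ := spec a ha hoa
    exact fix _ (h.lt' s.adj1) c1.T1_eq
  · intro a ha hoa
    obtain ⟨-, -, -, -, -, -, s, c1, c2, -⟩ := spec a ha hoa
    exact fix _ (h.lt' s.adj2) c2.T1_eq
  · exact fun a ha hoa => (spec a ha hoa).2.2.2.2.2.2.2.1.T1_eq
  · exact fun a ha hoa => (spec a ha hoa).2.2.2.2.2.2.2.2.1.T1_eq
  · exact fun a ha hoa => (spec a ha hoa).2.2.2.2.2.2.2.2.2.1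
  · intro a ha hoa b hb hob hor
    obtain ⟨-, -, -, -, -, -, sa, a1, a2, -, n1, n2⟩ := spec a ha hoa
    obtain ⟨-, -, -, -, -, -, sb, b1, b2, -, -, -⟩ := spec b hb hob
    have hb1 := h.T1_ne sb
    have e1 := a1.T1_eq
    have e2 := a2.T1_eq
    -- If the diamonds share a center, then `b` is adjacent to a center of the diamond of `a`, whose
    -- only neighbours besides the other center are `a` and `op a`.
    have hadj : adj (T1 a) b ∨ adj (T2 a) b := by
      have i1 := h.symm _ _ sb.adj1
      have i2 := h.symm _ _ sb.adj2
      grind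
    rcases hadj with h3 | h3
    · have := n1 b h3; grind
    · have := n2 b h3; grind
  -- The ends of a diamond have equal colours under `c`, whereas distinct linked triangle vertices
  -- have different ones.
  · intro a ha hoa e
    obtain ⟨hne, hlt, hoo, -, -, hc, s, -⟩ := spec a ha hoa
    have hs' : T1 (op a) ≠ op a := (opposite_ne hop hlt (by rw [hoo]; exact hne.symm)).1
    have := (hL.ends a ha s.o2_eq).2.2.1
    exact hlink (op a) hlt a ha hs' (h.T1_ne s) hne (by rw [← e, this]) hc
  · exact fun v hv hT => (hL.ends v hv (h.single hv hT).o2_eq).1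
  · exact fun v hv hT => (hL.ends v hv (h.single hv hT).o2_eq).2.1

/-- All inactive vertices, including the diamonds, still have color 4, so the conditions on diamonds
hold in their uncoloured form. -/
theorem DiaSys.diaColoring {S : ℕ → ℕ}
    (hin : ∀ v < n, inact v = 0 ↔ T1 v ≠ v ∧ T1 (T1 v) ≠ T1 v)
    (hop : ∀ v < n, op v = opposite N1 N2 N3 T1 T2 v) (hD : DiaSys n T1 T2 op m)
    (hcol : IsTriColoring n inact T1 T2 m S col) : DiaColoring n T1 T2 op m col col := by
  have h4 : ∀ v < n, op v ≠ v → col v = 4 := fun v hv hov =>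
    hcol.inact_four v hv fun e => ((hin v hv).1 e).2 (opposite_ne hop hv hov).2
  refine ⟨fun _ _ _ _ => rfl, fun a ha hoa => .inl ⟨h4 a ha hoa, ?_⟩, fun v hv h1 h2 h3 h5 h6 => ?_⟩
  · refine h4 _ (hD.op_lt a ha hoa) ?_
    rw [hD.op_op a ha hoa]
    exact hoa.symm
  · refine hcol.ne_m v hv ?_ h3
    by_contra hi
    exact h5 (hcol.inact_four v hv hi)

/-- In the coloring of the triangles and diamonds, adjacent vertices with a common neighbor have
different colors, and exactly the vertices outside triangles have color 4. -/
structure TriColored (n : ℕ) (adj : ℕ → ℕ → Prop) (T1 T2 o1 o2 m col : ℕ → ℕ) : Prop where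
  single_lt : ∀ v < n, SingleAt adj T1 T2 o1 o2 v → col v < 3
  center_lt : ∀ v < n, CenterAt adj T1 T2 o1 o2 v → col v < 3
  plain : ∀ v < n, PlainAt adj T1 T2 o1 o2 v → col v = 4
  ne : ∀ u v w, adj u v → adj u w → adj v w → col u ≠ col v
  linked : ∀ v < n, T1 v ≠ v → T1 (m v) ≠ m v → m v ≠ v → col v ≠ col (m v)

/-- Isolated triangles are disjoint from the diamonds and keep their colours from `col₀`; every
other vertex that lies in a triangle belongs to a diamond, whose colours come from `dia`. -/
theorem LocTri.triColored (h : LocTri n adj T1 T2 o1 o2) (hN : NbrFun n adj N1 N2 N3)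
    (hprop : ∀ u v, adj u v → c u ≠ c v) {S : ℕ → ℕ}
    (hin : ∀ v < n, inact v = 0 ↔ T1 v ≠ v ∧ T1 (T1 v) ≠ T1 v)
    (hop : ∀ v < n, op v = opposite N1 N2 N3 T1 T2 v) (hD : DiaSys n T1 T2 op m)
    (hcol₀ : IsTriColoring n inact T1 T2 m S col₀) (hcol : DiaColoring n T1 T2 op m col₀ col)
    (hdone : ∀ a < n, op a ≠ a → col a ≠ 4) : TriColored n adj T1 T2 o1 o2 m col := by
  have dia := fun a (ha : a < n) (hoa : op a ≠ a) =>
    (hcol.dia a ha hoa).resolve_left fun e => hdone a ha hoa e.1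
  have block : ∀ v < n, inact v = 0 → col v = col₀ v := by
    intro v hv hav
    have hv' := (hin v hv).1 hav
    refine hcol.eq_off v hv ?_ fun a ha hoa => ⟨?_, ?_⟩
    · by_contra hov
      exact hv'.2 (opposite_ne hop hv hov).2
    · rintro rfl
      exact hv'.1 (hD.T1_1 a ha hoa)
    · rintro rfl
      exact hv'.1 (hD.T1_2 a ha hoa)
  have dia_of : ∀ a < n, T1 a ≠ a → inact a ≠ 0 → op a ≠ a := by
    intro a ha h1 h2
    have h3 : T1 (T1 a) = T1 a := by
      by_contra h3
      exact h2 ((hin a ha).2 ⟨h1, h3⟩)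
    exact (h.opposite_spec hN hprop hop ha h1 h3).1
  have lt_of : ∀ v < n, T1 v ≠ v → col v < 3 := by
    intro v hv h1
    by_cases h2 : inact v = 0
    · rw [block v hv h2]
      exact hcol₀.lt_three v hv h2
    · exact (dia v hv (dia_of v hv h1 h2)).1
  have ne_T : ∀ v < n, T1 v ≠ v → col v ≠ col (T1 v) ∧ col v ≠ col (T2 v) := by
    intro v hv h1
    by_cases h2 : inact v = 0
    · have hT := h.triSys hin (m := id) fun v hv _ => ⟨hv, rfl⟩
      rw [block v hv h2, block _ (hT.lt1 v hv h2) (hT.act1 v hv h2),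
        block _ (hT.lt2 v hv h2) (hT.act2 v hv h2)]
      exact ⟨hcol₀.ne1 v hv h2, hcol₀.ne2 v hv h2⟩
    · obtain ⟨-, -, -, -, d1, d2, -⟩ := dia v hv (dia_of v hv h1 h2)
      exact ⟨d1.symm, d2.symm⟩
  have sgl : ∀ u v w, SingleAt adj T1 T2 o1 o2 u → adj u v → adj u w → adj v w →
      col u ≠ col v := by
    intro u v w hs hv hw hvw
    have h1 := ne_T u (h.lt _ _ hv) (h.T1_ne hs)
    rcases h.pair_eq hs hv hw hvw with ⟨e, -⟩ | ⟨-, e⟩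
    · rw [← e]; exact h1.1
    · rw [← e]; exact h1.2
  have ctr : ∀ v, CenterAt adj T1 T2 o1 o2 v → ∃ a < n, op a ≠ a ∧
      ∃ b, (T1 a = v ∧ T2 a = b ∨ T1 a = b ∧ T2 a = v) ∧
        ∀ u, adj v u → CenterAt adj T1 T2 o1 o2 u → u = b := by
    intro v hv
    obtain ⟨x, y, z, hx, hy, hz, hxz, hyx, hyz, hall, yall, sx, cy, sz, hcc⟩ := h.diamond hprop hv
    have p := h.pair_eq sx (h.symm _ _ hx) (h.symm _ _ hyx) hy
    have hxn := h.lt' hx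
    refine ⟨x, hxn, ?_, y, p, fun u hu cu => ?_⟩
    · have h2 : T1 (T1 x) = T1 x := by
        rcases p with ⟨e, -⟩ | ⟨e, -⟩ <;> rw [e]
        exacts [hv.T1_eq, cy.T1_eq]
      exact (h.opposite_spec hN hprop hop hxn (h.T1_ne sx) h2).1
    · rcases hall u hu with rfl | rfl | rfl
      exacts [absurd cu.T1_eq (h.T1_ne sx), rfl, absurd cu.T1_eq (h.T1_ne sz)]
  constructor
  · exact fun v hv hs => lt_of v hv (h.T1_ne hs)
  · intro v hv hc
    obtain ⟨a, ha, hoa, b, hor, -⟩ := ctr v hc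
    have := dia a ha hoa
    rcases hor with ⟨e, -⟩ | ⟨-, e⟩ <;> rw [← e]
    exacts [this.2.2.1, this.2.2.2.1]
  · intro v hv hp
    have hi : inact v ≠ 0 := fun e => ((hin v hv).1 e).1 hp.T1_eq
    rw [← hcol₀.inact_four v hv hi]
    refine hcol.eq_off v hv ?_ fun a ha hoa => ?_
    · by_contra hov
      exact (opposite_ne hop hv hov).1 hp.T1_eq
    · obtain ⟨-, -, -, -, -, -, s, -⟩ := h.opposite_spec hN hprop hop ha
        (opposite_ne hop ha hoa).1 (opposite_ne hop ha hoa).2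
      refine ⟨?_, ?_⟩
      · rintro rfl
        exact hp.not_adj _ _ (h.symm _ _ s.adj1) s.adj12 s.adj2
      · rintro rfl
        exact hp.not_adj _ _ (h.symm _ _ s.adj2) (h.symm _ _ s.adj12) s.adj1
  · intro u v w huv huw hvw
    rcases h.single_or_center huv huw hvw with hu | hu
    · exact sgl u v w hu huv huw hvw
    · rcases h.single_or_center (h.symm _ _ huv) hvw huw with hv | hv
      · exact (sgl v u w hv (h.symm _ _ huv) hvw huw).symm
      · obtain ⟨a, ha, hoa, b, hor, hb⟩ := ctr u hu
        have e := hb v huv hv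
        have := dia a ha hoa
        grind
  · intro v hv h1 h2 h3
    have hm := hD.m_lt v hv h1
    have h4 := lt_of v hv h1
    have h5 := lt_of _ hm h2
    exact hcol.linked v hv h1 h2 h3 (by omega) (by omega)

/-- A center has no outer neighbours, so it is a component on its own. -/
theorem LocTri.linked_center (h : LocTri n adj T1 T2 o1 o2) {u v : ℕ} (hl : Linked n o1 o2 u v) :
    (CenterAt adj T1 T2 o1 o2 u → u = v) ∧ (CenterAt adj T1 T2 o1 o2 v → u = v) := by
  induction hl with
  | rel x y hxy =>
    obtain ⟨hx, hy⟩ := hxy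
    refine ⟨fun hc => ?_, fun hc => ?_⟩
    · rw [hc.o1_eq, hc.o2_eq] at hy
      exact (hy.elim id id).symm
    · have := h.outer_symm hx hy
      rw [hc.o1_eq, hc.o2_eq] at this
      exact (this.elim id id).symm
  | refl x => exact ⟨fun _ => rfl, fun _ => rfl⟩
  | symm x y _ ih => exact ⟨fun hc => (ih.2 hc).symm, fun hc => (ih.1 hc).symm⟩
  | trans x y z _ _ ih1 ih2 =>
    refine ⟨fun hc => ?_, fun hc => ?_⟩
    · have := ih1.1 hc
      subst this
      exact ih2.1 hc
    · have := ih2.2 hc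
      subst this
      exact ih1.2 hc

/-- Within a component the final colour is an injective function of `c`, since the labels are
permuted colours and `fill` is injective. So the conditions on outer edges and at plain vertices are
inherited from `c`. On triangle vertices, which are ends of components, `fill` returns the
prescribed `col`, which settles the edges of triangles. The dynamic condition at a triangle vertex
then holds because two of its neighbours are adjacent. -/
theorem LocTri.finalColor_spec (h : LocTri n adj T1 T2 o1 o2)
    (hprop : ∀ u v, adj u v → c u ≠ c v)
    (hdyn : ∀ v x y, adj v x → adj v y → x ≠ y → (∀ u, adj v u → u = x ∨ u = y) → c x ≠ c y)
    (hL : IsLinking n o1 o2 c pos root m E)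
    (hlink : ∀ u < n, ∀ v < n, T1 u ≠ u → T1 v ≠ v → u ≠ v → root u = root v → c u ≠ c v)
    (hcol : TriColored n adj T1 T2 o1 o2 m col) :
    (∀ v < n, finalColor pos root m E col v < 3) ∧
    (∀ u v, adj u v → finalColor pos root m E col u ≠ finalColor pos root m E col v) ∧
    ∀ v x y, adj v x → adj v y → x ≠ y → ∃ x y, adj v x ∧ adj v y ∧
      finalColor pos root m E col x ≠ finalColor pos root m E col y := by
  have hP := h.pathSys hprop hdyn
  obtain ⟨π, hπ⟩ := hL.label
  have pos_lt : ∀ v < n, pos v < 3 := fun v hv => by rw [hπ v hv]; exact (π _ _).isLt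
  have pos_iff : ∀ u < n, ∀ v < n, root u = root v → (pos u = pos v ↔ c u = c v) := by
    intro u hu v hv huv
    rw [hπ u hu, hπ v hv, huv, Fin.val_inj, (π (root v)).apply_eq_iff_eq]
  have col_or : ∀ v < n, col v < 3 ∨ col v = 4 := by
    intro v hv
    rcases h.cases v hv with h1 | h1 | h1
    exacts [.inl (hcol.single_lt v hv h1), .inl (hcol.center_lt v hv h1), .inr (hcol.plain v hv h1)]
  have linked_of : ∀ u < n, ∀ v < n, root u = root v → Linked n o1 o2 u v := by
    intro u hu v hv huv
    have h1 := hL.linked u hu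
    rw [huv] at h1
    exact .trans _ _ _ h1 (.symm _ _ (hL.linked v hv))
  have tri_of : ∀ u < n, ∀ v < n, root u = root v → u ≠ v → col u ≠ 4 → T1 u ≠ u := by
    intro u hu v hv huv hne hc
    rcases h.cases u hu with h1 | h1 | h1
    exacts [h.T1_ne h1, absurd ((h.linked_center (linked_of u hu v hv huv)).1 h1) hne,
      absurd (hcol.plain u hu h1) hc]
  -- If the two ends are distinct and both prescribed, they lie in triangles: their labels differ
  -- because `c` does, and their colours differ because `col` respects links.
  have consistent : ∀ v < n, col (E (root v)) ≠ 4 → col (m (E (root v))) ≠ 4 →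
      (pos (E (root v)) = pos (m (E (root v))) ↔ col (E (root v)) = col (m (E (root v)))) := by
    intro v hv h1 h2
    obtain ⟨i1, i2, i3, i4⟩ := hL.inside v hv
    by_cases he : m (E (root v)) = E (root v)
    · rw [he]
      simp
    · have hr := i2.trans i4.symm
      have t1 := tri_of _ i1 _ i3 hr (Ne.symm he) h1
      have t2 := tri_of _ i3 _ i1 hr.symm he h2
      have hne := hcol.linked _ i1 t1 t2 he
      rw [pos_iff _ i1 _ i3 hr]
      exact ⟨fun e => absurd e (hlink _ i1 _ i3 t1 t2 (Ne.symm he) hr), fun e => absurd e hne⟩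
  have spec := fun v (hv : v < n) =>
    have hi := hL.inside v hv
    fill_spec (col_or _ hi.1) (col_or _ hi.2.2.1) (pos_lt _ hi.1) (pos_lt _ hi.2.2.1)
      (consistent v hv)
  have out_lt : ∀ v < n, finalColor pos root m E col v < 3 := fun v hv =>
    (spec v hv).1 _ (pos_lt v hv)
  have out_ne : ∀ u < n, ∀ v < n, root u = root v → c u ≠ c v →
      finalColor pos root m E col u ≠ finalColor pos root m E col v := by
    intro u hu v hv huv hne he
    unfold finalColor at he
    rw [huv] at he
    exact hne ((pos_iff u hu v hv huv).1 ((spec v hv).2.1 _ (pos_lt u hu) _ (pos_lt v hv) he))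
  have out_tri : ∀ v < n, o2 v = v → col v ≠ 4 → finalColor pos root m E col v = col v := by
    intro v hv ho hc
    obtain ⟨-, e2, -, hor⟩ := hL.ends v hv ho
    obtain ⟨-, -, s3, s4⟩ := spec v hv
    unfold finalColor
    rcases hor with e | e
    · rw [e] at s3 ⊢
      exact s3 hc
    · rw [e, e2] at s4 ⊢
      exact s4 hc
  have out_tri' : ∀ u v w, adj u v → adj u w → adj v w →
      finalColor pos root m E col u = col u := by
    intro u v w huv huw hvw
    have hu := h.lt _ _ huv
    rcases h.single_or_center huv huw hvw with h1 | h1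
    · have := hcol.single_lt u hu h1
      exact out_tri u hu h1.o2_eq (by omega)
    · have := hcol.center_lt u hu h1
      exact out_tri u hu h1.o2_eq (by omega)
  have out_proper : ∀ u v, adj u v →
      finalColor pos root m E col u ≠ finalColor pos root m E col v := by
    intro u v huv
    have hu := h.lt _ _ huv
    by_cases hw : ∃ w, adj u w ∧ adj v w
    · obtain ⟨w, huw, hvw⟩ := hw
      rw [out_tri' u v w huv huw hvw, out_tri' v u w (h.symm _ _ huv) hvw huw]
      exact hcol.ne u v w huv huw hvw
    · have h1 := ((h.outer_iff hu v).2 ⟨huv, fun w h1 h2 => hw ⟨w, h1, h2⟩⟩).2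
      refine out_ne u hu v (h.lt' huv) ?_ (hprop u v huv)
      rcases h1 with e | e <;> rw [e]
      exacts [(hL.root1 u hu).symm, (hL.root2 u hu).symm]
  refine ⟨out_lt, out_proper, fun v x y hx hy hxy => ?_⟩
  have hv := h.lt _ _ hx
  rcases h.cases v hv with h1 | h1 | h1
  · exact ⟨_, _, h1.adj1, h1.adj2, out_proper _ _ h1.adj12⟩
  · obtain ⟨x, y, z, hx, hy, -, -, hyx, -⟩ := h1.nbr
    exact ⟨_, _, hy, hx, out_proper _ _ hyx⟩
  · have a1 := (h1.nbr x).1 hx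
    have a2 := (h1.nbr y).1 hy
    refine ⟨x, y, hx, hy, out_ne x (h.lt' hx) y (h.lt' hy) ?_ (hdyn v x y hx hy hxy fun u hu => ?_)⟩
    · have r1 := hL.root1 v hv
      have r2 := hL.root2 v hv
      have key : ∀ u, u = o1 v ∨ u = o2 v → root u = root v := by
        rintro u (rfl | rfl)
        exacts [r1, r2]
      rw [key x a1.2, key y a2.2]
    · have := (h1.nbr u).1 hu
      grind

end

/-! ### Paths between vertices of degree three -/

namespace IsDynamicColoring

variable {V : Type*} {G : SimpleGraph V} [G.LocallyFinite]

theorem ne_of_degree_le_two {k : ℕ} {c : V → Fin k} (hc : IsDynamicColoring G c) {v x y : V}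
    (hx : G.Adj v x) (hy : G.Adj v y) (hxy : x ≠ y) (h : ∀ u, G.Adj v u → u = x ∨ u = y) :
    c x ≠ c y := by
  classical
  intro e
  have h1 : G.neighborFinset v = {x, y} := by
    ext u
    simp only [SimpleGraph.mem_neighborFinset, Finset.mem_insert, Finset.mem_singleton]
    exact ⟨h u, by rintro (rfl | rfl) <;> assumption⟩
  have h2 := hc.2 v
  rw [← SimpleGraph.card_neighborFinset_eq_degree, h1, Finset.card_pair hxy] at h2
  simp [e] at h2

theorem of_two_neighbors {k : ℕ} {c : V → Fin k} (h : ∀ u v, G.Adj u v → c u ≠ c v)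
    (h2 : ∀ v x y, G.Adj v x → G.Adj v y → x ≠ y → ∃ x y, G.Adj v x ∧ G.Adj v y ∧ c x ≠ c y) :
    IsDynamicColoring G c := by
  classical
  refine ⟨h, fun v => ?_⟩
  by_cases hd : 1 < (G.neighborFinset v).card
  · obtain ⟨x, hx, y, hy, hxy⟩ := Finset.one_lt_card.1 hd
    rw [SimpleGraph.mem_neighborFinset] at hx hy
    obtain ⟨x, y, hx, hy, hxy⟩ := h2 v x y hx hy hxy
    refine (min_le_right _ _).trans (Finset.one_lt_card.2 ⟨c x, ?_, c y, ?_, hxy⟩) <;>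
      exact Finset.mem_image_of_mem _ (by simpa)
  · rw [SimpleGraph.card_neighborFinset_eq_degree] at hd
    rcases Nat.eq_zero_or_pos (G.degree v) with h0 | h0
    · simp [h0]
    · refine (min_le_left _ _).trans (le_trans (by omega : _ ≤ 1) (Finset.card_pos.2 ?_))
      refine Finset.Nonempty.image ?_ _
      rwa [← Finset.card_pos, SimpleGraph.card_neighborFinset_eq_degree]

/-- The colors along a path whose interior vertices have degree 2 form an arithmetic
progression. -/
theorem getVert_eq {c : V → Fin 3} (hc : IsDynamicColoring G c) {u v : V} {p : G.Walk u v}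
    (hp : p.IsPath) (h2 : ∀ i, 0 < i → i < p.length → G.degree (p.getVert i) = 2) :
    ∀ i, i + 1 ≤ p.length →
      c (p.getVert (i + 1)) - c (p.getVert i) = c (p.getVert 1) - c (p.getVert 0) := by
  classical
  intro i
  induction i with
  | zero => exact fun _ => rfl
  | succ i ih =>
    intro hi
    rw [← ih (by omega)]
    have a1 := (p.adj_getVert_succ (i := i) (by omega))
    have a2 := (p.adj_getVert_succ (i := i + 1) (by omega))
    have hne : p.getVert i ≠ p.getVert (i + 1 + 1) := fun e => by
      have := hp.getVert_injOn (by simp; omega) (by simp; omega) e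
      omega
    have hdeg := h2 (i + 1) (by omega) (by omega)
    have c1 := hc.1 _ _ a1
    have c2 := hc.1 _ _ a2
    have c3 : c (p.getVert i) ≠ c (p.getVert (i + 1 + 1)) := by
      refine hc.ne_of_degree_le_two a1.symm a2 hne fun w hw => ?_
      by_contra! hcon
      have : ({p.getVert i, p.getVert (i + 1 + 1), w} : Finset V) ⊆
          G.neighborFinset (p.getVert (i + 1)) := by
        intro z hz
        simp only [Finset.mem_insert, Finset.mem_singleton] at hz
        rw [SimpleGraph.mem_neighborFinset]
        rcases hz with rfl | rfl | rfl
        exacts [a1.symm, a2, hw]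
      have := Finset.card_le_card this
      rw [SimpleGraph.card_neighborFinset_eq_degree, hdeg,
        Finset.card_eq_three.2 ⟨_, _, _, hne, hcon.1.symm, hcon.2.symm, rfl⟩] at this
      omega
    generalize c (p.getVert i) = x at *
    generalize c (p.getVert (i + 1)) = y at *
    generalize c (p.getVert (i + 1 + 1)) = z at *
    clear ih
    revert x y z
    decide

/-- The colours form an arithmetic progression in `Fin 3` with nonzero difference, an element of
additive order 3. If the first and last colours agree, the length annihilates this difference. -/
theorem three_dvd_length {c : V → Fin 3} (hc : IsDynamicColoring G c) {u v : V} {p : G.Walk u v}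
    (hp : p.IsPath) (h2 : ∀ i, 0 < i → i < p.length → G.degree (p.getVert i) = 2)
    (huv : c u = c v) : 3 ∣ p.length := by
  rcases Nat.eq_zero_or_pos p.length with h0 | h0
  · simp [h0]
  have key : ∀ i ≤ p.length,
      c (p.getVert i) = i • (c (p.getVert 1) - c (p.getVert 0)) + c u := by
    intro i
    induction i with
    | zero => simp
    | succ i ih =>
      intro hi
      have := hc.getVert_eq hp h2 i hi
      rw [sub_eq_iff_eq_add, ih (by omega)] at this
      rw [this, succ_nsmul', add_assoc]
  have h1 := key _ le_rfl
  have hd : c (p.getVert 1) - c (p.getVert 0) ≠ 0 :=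
    sub_ne_zero.2 (hc.1 _ _ (p.adj_getVert_succ h0)).symm
  rw [p.getVert_length, huv, right_eq_add] at h1
  generalize c (p.getVert 1) - c (p.getVert 0) = d at h1 hd
  have h3 : addOrderOf d = 3 := addOrderOf_eq_prime (by clear h1 hd; revert d; decide) hd
  exact h3 ▸ addOrderOf_dvd_of_nsmul_eq_zero h1

end IsDynamicColoring

/-- With equal end colours the path would have `3 * j` edges, hence `3 * j + 1` vertices, where `j ≥
1` because the ends are distinct. -/
theorem InClassC.color_ne {V : Type*} {G : SimpleGraph V} [G.LocallyFinite] (hG : InClassC G)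
    {c : V → Fin 3} (hc : IsDynamicColoring G c) {u v : V} (hu : G.degree u = 3)
    (hv : G.degree v = 3) (huv : u ≠ v) {p : G.Walk u v} (hp : p.IsPath)
    (h2 : ∀ i, 0 < i → i < p.length → G.degree (p.getVert i) = 2) : c u ≠ c v := by
  intro e
  obtain ⟨j, hj⟩ := hc.three_dvd_length hp h2 e
  have hj0 : j ≠ 0 := by
    rintro rfl
    exact huv (p.eq_of_length_eq_zero hj)
  refine hG.2.2 j (by omega) ⟨u, v, p, hp, by simp [hj], hu, hv, fun w hw hwu hwv => ?_⟩
  obtain ⟨i, rfl, hi⟩ := SimpleGraph.Walk.mem_support_iff_exists_getVert.1 hw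
  refine h2 i (Nat.pos_of_ne_zero ?_) (lt_of_le_of_ne hi ?_)
  · rintro rfl
    simp at hwu
  · rintro rfl
    simp at hwv

/-- The edges whose ends have no common neighbor. -/
def outerGraph {V : Type*} (G : SimpleGraph V) : SimpleGraph V where
  Adj u v := G.Adj u v ∧ ∀ w, G.Adj u w → ¬ G.Adj v w
  symm := ⟨fun _ _ h => ⟨h.1.symm, fun w hv hu => h.2 w hu hv⟩⟩
  loopless := ⟨fun _ h => G.irrefl h.1⟩

theorem outerGraph_le {V : Type*} (G : SimpleGraph V) : outerGraph G ≤ G := fun _ _ h => h.1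

section

variable {n : ℕ} {G : SimpleGraph (Fin n)} {T1 T2 o1 o2 : ℕ → ℕ}

theorem LocTri.outerGraph_adj (h : LocTri n (NatAdj G) T1 T2 o1 o2) {u v : Fin n} :
    (outerGraph G).Adj u v ↔ (v : ℕ) ≠ u ∧ ((v : ℕ) = o1 u ∨ (v : ℕ) = o2 u) := by
  rw [h.outer_iff u.2, natAdj_val]
  refine and_congr_right fun _ => ⟨fun h1 w hu hv => ?_, fun h1 w hu hv => ?_⟩
  · exact h1 ⟨w, h.lt' hu⟩ (natAdj_val.1 hu) (natAdj_val.1 hv)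
  · exact h1 w (natAdj_val.2 hu) (natAdj_val.2 hv)

theorem LocTri.reachable (h : LocTri n (NatAdj G) T1 T2 o1 o2) {u v : ℕ}
    (hl : Linked n o1 o2 u v) :
    (u < n ↔ v < n) ∧ ∀ (hu : u < n) (hv : v < n), (outerGraph G).Reachable ⟨u, hu⟩ ⟨v, hv⟩ := by
  induction hl with
  | rel x y hxy =>
    obtain ⟨hx, hy⟩ := hxy
    by_cases hyx : y = x
    · subst hyx
      exact ⟨Iff.rfl, fun _ _ => .rfl⟩
    · have hy' := h.lt' ((h.outer_iff hx y).1 ⟨hyx, hy⟩).1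
      exact ⟨⟨fun _ => hy', fun _ => hx⟩, fun hu hv =>
        SimpleGraph.Adj.reachable (h.outerGraph_adj.2 ⟨hyx, hy⟩)⟩
  | refl x => exact ⟨Iff.rfl, fun _ _ => .rfl⟩
  | symm x y _ ih => exact ⟨ih.1.symm, fun hu hv => (ih.2 hv hu).symm⟩
  | trans x y z _ _ ih1 ih2 =>
    exact ⟨ih1.1.trans ih2.1, fun hu hv => (ih1.2 hu (ih1.1.1 hu)).trans (ih2.2 _ hv)⟩

variable [G.LocallyFinite]

theorem LocTri.degree_eq_three (h : LocTri n (NatAdj G) T1 T2 o1 o2) {u w : Fin n}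
    (hu : T1 u ≠ u) (hw : (outerGraph G).Adj u w) : G.degree u = 3 := by
  classical
  have hs := h.single u.2 hu
  obtain ⟨h1, h2⟩ := h.outerGraph_adj.1 hw
  rw [hs.o2_eq] at h2
  have h3 : (w : ℕ) = o1 u := by tauto
  obtain ⟨-, h5, h6, -⟩ := hs.outer (h3 ▸ h1)
  have t1 := h.lt' hs.adj1
  have t2 := h.lt' hs.adj2
  have h7 := h.ne hs.adj12
  rw [← SimpleGraph.card_neighborFinset_eq_degree]
  refine Finset.card_eq_three.2 ⟨⟨T1 u, t1⟩, ⟨T2 u, t2⟩, w, ?_, ?_, ?_, ?_⟩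
  · simpa using h7
  · simp only [ne_eq, Fin.ext_iff]
    omega
  · simp only [ne_eq, Fin.ext_iff]
    omega
  · ext x
    simp only [SimpleGraph.mem_neighborFinset, Finset.mem_insert, Finset.mem_singleton,
      Fin.ext_iff, h3]
    constructor
    · exact fun hx => hs.nbr x (natAdj_val.2 hx)
    · rintro (e | e | e)
      · exact natAdj_val.1 (e ▸ hs.adj1)
      · exact natAdj_val.1 (e ▸ hs.adj2)
      · have : x = w := Fin.ext (e.trans h3.symm)
        exact this ▸ hw.1

theorem LocTri.degree_eq_two (h : LocTri n (NatAdj G) T1 T2 o1 o2) {u v w : Fin n}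
    (hu : (outerGraph G).Adj v u) (hw : (outerGraph G).Adj v w) (huw : u ≠ w) :
    G.degree v = 2 := by
  classical
  have h1 := h.outerGraph_adj.1 hu
  have h2 := h.outerGraph_adj.1 hw
  have h3 : (u : ℕ) ≠ w := fun e => huw (Fin.ext e)
  have h4 : o2 v ≠ v := by
    intro e
    omega
  rcases h.cases v v.2 with hs | hs | hs
  · exact absurd hs.o2_eq h4
  · exact absurd hs.o2_eq h4
  · rw [← SimpleGraph.card_neighborFinset_eq_degree]
    refine Finset.card_eq_two.2 ⟨u, w, huw, ?_⟩
    ext x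
    simp only [SimpleGraph.mem_neighborFinset, Finset.mem_insert, Finset.mem_singleton]
    constructor
    · intro hx
      have := ((hs.nbr x).1 (natAdj_val.2 hx)).2
      simp only [Fin.ext_iff]
      omega
    · rintro (rfl | rfl)
      exacts [hu.1, hw.1]

/-- On a path in `outerGraph` an interior vertex has two outer neighbours, so it is plain of degree
2. Each end has two neighbours in its triangle and one outside, so its degree is 3. These are the
paths to which the exclusion of `A_{3j+1}` applies. -/
theorem LocTri.color_ne (h : LocTri n (NatAdj G) T1 T2 o1 o2) (hG : InClassC G)
    {c : Fin n → Fin 3} (hc : IsDynamicColoring G c) {u v : Fin n} (hu : T1 u ≠ u) (hv : T1 v ≠ v)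
    (huv : u ≠ v) (hl : Linked n o1 o2 u v) : c u ≠ c v := by
  obtain ⟨p, hp⟩ := ((h.reachable hl).2 u.2 v.2).exists_isPath
  have hpos : 0 < p.length := by
    by_contra h0
    exact huv (p.eq_of_length_eq_zero (by omega))
  have hpu := p.adj_getVert_succ hpos
  have hpv := p.adj_getVert_succ (i := p.length - 1) (by omega)
  rw [p.getVert_zero] at hpu
  rw [Nat.sub_add_cancel hpos, p.getVert_length] at hpv
  refine hG.color_ne hc (h.degree_eq_three hu hpu) (h.degree_eq_three hv hpv.symm) huv
    (hp.mapLe (outerGraph_le G)) fun i h0 hi => ?_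
  rw [SimpleGraph.Walk.length_map] at hi
  obtain ⟨i, rfl⟩ := Nat.exists_eq_succ_of_ne_zero h0.ne'
  have a1 := p.adj_getVert_succ (i := i) (by omega)
  have a2 := p.adj_getVert_succ (i := i + 1) (by omega)
  have hne : p.getVert i ≠ p.getVert (i + 1 + 1) := fun e => by
    have := hp.getVert_injOn (by simp; omega) (by simp; omega) e
    omega
  have := h.degree_eq_two a1.symm a2 hne
  rwa [SimpleGraph.Walk.getVert_map]

end

theorem IsClawFree.adj_or {V : Type*} {G : SimpleGraph V} (h : IsClawFree G) {v x y z : V}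
    (hx : G.Adj v x) (hy : G.Adj v y) (hz : G.Adj v z) (hxy : x ≠ y) (hxz : x ≠ z) (hyz : y ≠ z) :
    G.Adj x y ∨ G.Adj x z ∨ G.Adj y z := by
  by_contra! hcon
  obtain ⟨n1, n2, n3⟩ := hcon
  have n1' : ¬ G.Adj y x := fun e => n1 e.symm
  have n2' : ¬ G.Adj z x := fun e => n2 e.symm
  have n3' : ¬ G.Adj z y := fun e => n3 e.symm
  refine h ⟨⟨⟨Sum.elim (fun _ => v) ![x, y, z], ?_⟩, ?_⟩⟩
  · have := hx.ne
    have := hy.ne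
    have := hz.ne
    rintro (a | a) (b | b) e <;> fin_cases a <;> fin_cases b <;> simp_all
  · intro a b
    change G.Adj (Sum.elim (fun _ => v) ![x, y, z] a) (Sum.elim (fun _ => v) ![x, y, z] b) ↔ _
    rcases a with a | a <;> rcases b with b | b <;> fin_cases a <;> fin_cases b <;>
      simp [hx, hy, hz, hx.symm, hy.symm, hz.symm, n1, n2, n3, n1', n2', n3']

theorem IsAdjacencyLists.length_eq {n : ℕ} {G : SimpleGraph (Fin n)} [G.LocallyFinite]
    {nb : Fin n → List (Fin n)} (h : IsAdjacencyLists G nb) (v : Fin n) :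
    (nb v).length = G.degree v := by
  classical
  rw [← SimpleGraph.card_neighborFinset_eq_degree, ← List.toFinset_card_of_nodup (h v).1]
  congr 1
  ext u
  simp [(h v).2]

/-- A connected graph with at least three vertices has a vertex with two neighbors. -/
theorem SimpleGraph.Connected.exists_two_neighbors {V : Type*} [Fintype V] {G : SimpleGraph V}
    (h : G.Connected) (h3 : 3 ≤ Fintype.card V) : ∃ v x y, G.Adj v x ∧ G.Adj v y ∧ x ≠ y := by
  classical
  by_contra! hcon
  have h1 : ∀ v, G.degree v ≤ 1 := fun v => by
    rw [← SimpleGraph.card_neighborFinset_eq_degree]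
    exact Finset.card_le_one.2 fun x hx y hy => hcon v x y (by simpa using hx) (by simpa using hy)
  have h2 := G.sum_degrees_eq_twice_card_edges
  have h4 : ∑ v, G.degree v ≤ Fintype.card V := by
    simpa using Finset.sum_le_card_nsmul Finset.univ (fun v => G.degree v) 1 fun v _ => h1 v
  -- Connectedness requires at least `n - 1` edges, while degrees at most 1 allow at most `n / 2`.
  have h5 := h.card_vert_le_card_edgeSet_add_one
  rw [Nat.card_eq_fintype_card, Nat.card_eq_fintype_card, ← SimpleGraph.edgeFinset_card] at h5
  omega

/-- A vertex with two neighbours sees two different colours, both different from its own. -/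
theorem IsDynamicColoring.surjective {V : Type*} {G : SimpleGraph V} [G.LocallyFinite] [Fintype V]
    {c : V → Fin 3} (hc : IsDynamicColoring G c) (h : G.Connected) (h3 : 3 ≤ Fintype.card V) :
    Function.Surjective c := by
  classical
  obtain ⟨v, x, y, hx, hy, hxy⟩ := h.exists_two_neighbors h3
  have h2 : 2 ≤ G.degree v := by
    rw [← SimpleGraph.card_neighborFinset_eq_degree]
    exact Finset.one_lt_card.2 ⟨x, by simpa, y, by simpa, hxy⟩
  have h4 := hc.2 v
  rw [min_eq_right h2] at h4
  obtain ⟨a, ha, b, hb, hab⟩ := Finset.one_lt_card.1 h4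
  obtain ⟨x, hx, rfl⟩ := Finset.mem_image.1 ha
  obtain ⟨y, hy, rfl⟩ := Finset.mem_image.1 hb
  have h5 := hc.1 v x (by simpa using hx)
  have h6 := hc.1 v y (by simpa using hy)
  intro k
  have : k = c v ∨ k = c x ∨ k = c y := by
    generalize c v = p at *
    generalize c x = q at *
    generalize c y = r at *
    omega
  rcases this with rfl | rfl | rfl
  exacts [⟨_, rfl⟩, ⟨_, rfl⟩, ⟨_, rfl⟩]

/-! ### Cubic graphs with a partition into triangles -/

/-- Every vertex `v` lies in the triangle `{v, t1 v, t2 v}` and has one further neighbor `m v`, which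
has no common neighbor with `v`. -/
structure TriMatching {V : Type*} (G : SimpleGraph V) (t1 t2 m : V → V) : Prop where
  adj_iff : ∀ v w, G.Adj v w ↔ w = t1 v ∨ w = t2 v ∨ w = m v
  adj12 : ∀ v, G.Adj (t1 v) (t2 v)
  not_adj1 : ∀ v, ¬ G.Adj (m v) (t1 v)
  not_adj2 : ∀ v, ¬ G.Adj (m v) (t2 v)

theorem SimpleGraph.IsNClique.exists_eq_of_mem {V : Type*} {G : SimpleGraph V} {s : Finset V}
    (h : G.IsNClique 3 s) {v : V} (hv : v ∈ s) :
    ∃ x y, G.Adj v x ∧ G.Adj v y ∧ G.Adj x y ∧ ∀ w, w ∈ s ↔ w = v ∨ w = x ∨ w = y := by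
  classical
  obtain ⟨a, b, d, hab, had, hbd, rfl⟩ := SimpleGraph.is3Clique_iff.1 h
  simp only [Finset.mem_insert, Finset.mem_singleton] at hv ⊢
  rcases hv with rfl | rfl | rfl
  · exact ⟨b, d, hab, had, hbd, fun w => Iff.rfl⟩
  · exact ⟨a, d, hab.symm, hbd, had, fun w => by tauto⟩
  · exact ⟨a, b, had.symm, hbd.symm, hab, fun w => by tauto⟩

theorem InClassT.exists_triMatching {V : Type*} {G : SimpleGraph V} (h : InClassT G) :
    ∃ t1 t2 m, TriMatching G t1 t2 m := by
  obtain ⟨T, -, hcl, hpart, hout⟩ := h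
  have uniq : ∀ v, ∀ s ∈ T, ∀ t ∈ T, v ∈ s → v ∈ t → s = t := fun v s hs t ht hvs hvt =>
    (hpart v).unique ⟨hs, hvs⟩ ⟨ht, hvt⟩
  have key : ∀ v, ∃ x y z, (∀ w, G.Adj v w ↔ w = x ∨ w = y ∨ w = z) ∧ G.Adj x y ∧
      ¬ G.Adj z x ∧ ¬ G.Adj z y := by
    intro v
    obtain ⟨t, ⟨ht, hvt⟩, -⟩ := hpart v
    obtain ⟨x, y, hx, hy, hxy, hmem⟩ := (hcl t ht).exists_eq_of_mem hvt
    obtain ⟨z, ⟨hz, hvz⟩, huniq⟩ := hout v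
    -- If the mate `z` of `v` were adjacent to another vertex of the triangle of `v`, it would have
    -- two neighbours outside its own triangle.
    have hzt : ∀ u ∈ t, u ≠ v → ¬ G.Adj z u := by
      intro u hut huv hzu
      refine huv ((hout z).unique ⟨hzu, ?_⟩ ⟨hz.symm, fun ⟨s, hs, h1, h2⟩ => hvz ⟨s, hs, h2, h1⟩⟩)
      rintro ⟨s, hs, hzs, hus⟩
      have := uniq u s hs t ht hus hut
      subst this
      exact hvz ⟨s, hs, hvt, hzs⟩
    refine ⟨x, y, z, fun w => ⟨fun hw => ?_, ?_⟩, hxy,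
      hzt x ((hmem x).2 (by simp)) hx.ne.symm, hzt y ((hmem y).2 (by simp)) hy.ne.symm⟩
    · by_cases hwT : ∃ s ∈ T, v ∈ s ∧ w ∈ s
      · obtain ⟨s, hs, hvs, hws⟩ := hwT
        have := uniq v s hs t ht hvs hvt
        subst this
        have := (hmem w).1 hws
        have := hw.ne
        tauto
      · exact .inr (.inr (huniq w ⟨hw, hwT⟩))
    · rintro (rfl | rfl | rfl) <;> assumption
  choose t1 t2 m h using key
  exact ⟨t1, t2, m, fun v => (h v).1, fun v => (h v).2.1, fun v => (h v).2.2.1,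
    fun v => (h v).2.2.2⟩

namespace TriMatching

variable {V : Type*} {G : SimpleGraph V} {t1 t2 m : V → V}

theorem adj1 (h : TriMatching G t1 t2 m) (v : V) : G.Adj v (t1 v) := by simp [h.adj_iff]

theorem adj2 (h : TriMatching G t1 t2 m) (v : V) : G.Adj v (t2 v) := by simp [h.adj_iff]

theorem adj_m (h : TriMatching G t1 t2 m) (v : V) : G.Adj v (m v) := by simp [h.adj_iff]

theorem pair_eq (h : TriMatching G t1 t2 m) {v a b : V} (ha : G.Adj v a) (hb : G.Adj v b)
    (hab : G.Adj a b) : (t1 v = a ∧ t2 v = b) ∨ (t1 v = b ∧ t2 v = a) := by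
  have n1 := h.not_adj1 v
  have n2 := h.not_adj2 v
  have n3 := hab.symm
  have n4 := hab.ne
  rw [h.adj_iff] at ha hb
  rcases ha with rfl | rfl | rfl <;> rcases hb with rfl | rfl | rfl <;> simp_all

/-- Otherwise `v` would lie in the triangle of `m v`, and the third vertex of that triangle would be
a common neighbour of `v` and `m v`. -/
theorem m_m (h : TriMatching G t1 t2 m) (v : V) : m (m v) = v := by
  have n1 := h.not_adj1 v
  have n2 := h.not_adj2 v
  rcases (h.adj_iff (m v) v).1 (h.adj_m v).symm with e | e | e
  · have h1 := h.adj12 (m v)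
    rw [← e] at h1
    have h2 := h.adj2 (m v)
    rcases (h.adj_iff v _).1 h1 with e1 | e1 | e1
    · exact absurd (e1 ▸ h2) n1
    · exact absurd (e1 ▸ h2) n2
    · exact absurd e1 h2.ne.symm
  · have h1 := (h.adj12 (m v)).symm
    rw [← e] at h1
    have h2 := h.adj1 (m v)
    rcases (h.adj_iff v _).1 h1 with e1 | e1 | e1
    · exact absurd (e1 ▸ h2) n1
    · exact absurd (e1 ▸ h2) n2
    · exact absurd e1 h2.ne.symm
  · exact e.symm

/-- As `m v` has no common neighbour with `v`, the graph has no triangles besides those of the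
partition. This is why `cliqueSet 3` counts the right triangles. -/
theorem clique_eq [DecidableEq V] (h : TriMatching G t1 t2 m) {s : Finset V}
    (hs : G.IsNClique 3 s) {v : V} (hv : v ∈ s) : s = {v, t1 v, t2 v} := by
  obtain ⟨x, y, hx, hy, hxy, hmem⟩ := hs.exists_eq_of_mem hv
  ext w
  rw [hmem]
  rcases h.pair_eq hx hy hxy with ⟨e1, e2⟩ | ⟨e1, e2⟩ <;> simp [e1, e2]
  tauto

theorem isNClique [DecidableEq V] (h : TriMatching G t1 t2 m) (v : V) :
    G.IsNClique 3 {v, t1 v, t2 v} :=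
  SimpleGraph.is3Clique_triple_iff.2 ⟨h.adj1 v, h.adj2 v, h.adj12 v⟩

section

variable [DecidableEq V]

/-- Two distinct vertices with the same triangle are adjacent. -/
theorem injOn (h : TriMatching G t1 t2 m) {S : Finset V} (hS : G.IsIndepSet (S : Set V)) :
    Set.InjOn (fun v => ({v, t1 v, t2 v} : Finset V)) S := by
  intro v hv w hw e
  by_contra hvw
  have h1 : w ∈ ({v, t1 v, t2 v} : Finset V) := by
    dsimp only at e
    rw [e]
    simp
  refine hS hv hw hvw ((h.adj_iff v w).2 ?_)
  simp only [Finset.mem_insert, Finset.mem_singleton] at h1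
  tauto

variable [Fintype V]

theorem cliqueSet_eq (h : TriMatching G t1 t2 m) :
    G.cliqueSet 3 = ↑(Finset.univ.image fun v => ({v, t1 v, t2 v} : Finset V)) := by
  ext s
  simp only [SimpleGraph.mem_cliqueSet_iff, Finset.coe_image, Finset.coe_univ, Set.image_univ,
    Set.mem_range]
  constructor
  · intro hs
    obtain ⟨v, hv⟩ : s.Nonempty := Finset.card_pos.1 (by rw [hs.card_eq]; omega)
    exact ⟨v, (h.clique_eq hs hv).symm⟩
  · rintro ⟨v, rfl⟩
    exact h.isNClique v

theorem card_le (h : TriMatching G t1 t2 m) {S : Finset V} (hS : G.IsIndepSet (S : Set V)) :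
    S.card ≤ (G.cliqueSet 3).ncard := by
  rw [h.cliqueSet_eq, Set.ncard_coe_finset, ← Finset.card_image_of_injOn (h.injOn hS)]
  exact Finset.card_le_card (Finset.image_subset_image (Finset.subset_univ S))

theorem card_eq (h : TriMatching G t1 t2 m) {S : Finset V} (hS : G.IsIndepSet (S : Set V)) :
    S.card = (G.cliqueSet 3).ncard ↔ ∀ v, v ∈ S ∨ t1 v ∈ S ∨ t2 v ∈ S := by
  have hsub : S.image (fun v => ({v, t1 v, t2 v} : Finset V)) ⊆
    Finset.univ.image fun v => ({v, t1 v, t2 v} : Finset V) :=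
    Finset.image_subset_image (Finset.subset_univ S)
  rw [h.cliqueSet_eq, Set.ncard_coe_finset, ← Finset.card_image_of_injOn (h.injOn hS)]
  constructor
  · intro e v
    have h1 := Finset.eq_of_subset_of_card_le hsub e.ge
    have h2 := Finset.mem_image_of_mem (fun v => ({v, t1 v, t2 v} : Finset V)) (Finset.mem_univ v)
    rw [← h1] at h2
    obtain ⟨w, hw, e⟩ := Finset.mem_image.1 h2
    have h3 : w ∈ ({v, t1 v, t2 v} : Finset V) := by
      rw [← e]
      simp
    simp only [Finset.mem_insert, Finset.mem_singleton] at h3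
    rcases h3 with rfl | rfl | rfl <;> tauto
  · intro hv
    congr 1
    refine hsub.antisymm fun s hs => ?_
    obtain ⟨v, -, rfl⟩ := Finset.mem_image.1 hs
    have h1 := h.isNClique v
    rcases hv v with h2 | h2 | h2
    · exact Finset.mem_image_of_mem _ h2
    · exact Finset.mem_image.2 ⟨_, h2, (h.clique_eq h1 (by simp)).symm⟩
    · exact Finset.mem_image.2 ⟨_, h2, (h.clique_eq h1 (by simp)).symm⟩

end

/-! ### Passing between vertices and numbers -/

section

variable {n : ℕ} {e : V ≃ Fin n} {inact T1 T2 M S col : ℕ → ℕ}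

/-- The maps on vertices, read as maps on the numbers of the vertices. -/
structure Coded (e : V ≃ Fin n) (t1 t2 m : V → V) (inact T1 T2 M : ℕ → ℕ) : Prop where
  act : ∀ v < n, inact v = 0
  eq1 : ∀ v, T1 (e v) = e (t1 v)
  eq2 : ∀ v, T2 (e v) = e (t2 v)
  eq_m : ∀ v, M (e v) = e (m v)

theorem exists_coded (e : V ≃ Fin n) (t1 t2 m : V → V) :
    ∃ T1 T2 M, Coded e t1 t2 m (fun _ => 0) T1 T2 M := by
  have key : ∀ t : V → V, ∃ T : ℕ → ℕ, ∀ v, T (e v) = e (t v) := fun t =>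
    ⟨fun i => if hi : i < n then e (t (e.symm ⟨i, hi⟩)) else 0, fun v => by simp⟩
  obtain ⟨T1, h1⟩ := key t1
  obtain ⟨T2, h2⟩ := key t2
  obtain ⟨M, h3⟩ := key m
  exact ⟨T1, T2, M, fun _ _ => rfl, h1, h2, h3⟩

theorem forall_lt (e : V ≃ Fin n) {P : ℕ → Prop} (h : ∀ v, P (e v)) : ∀ i < n, P i := by
  intro i hi
  have := h (e.symm ⟨i, hi⟩)
  simpa using this

theorem triSys (h : TriMatching G t1 t2 m) (hC : Coded e t1 t2 m inact T1 T2 M) :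
    TriSys n inact T1 T2 M := by
  have val : ∀ u v, ((e u : Fin n) : ℕ) = e v ↔ u = v := fun u v => by
    rw [Fin.val_inj, e.apply_eq_iff_eq]
  refine ⟨?_, ?_, ?_, ?_, ?_, ?_, ?_, ?_, ?_, ?_, ?_⟩ <;> refine forall_lt e fun v _ => ?_ <;>
    simp only [hC.eq1, hC.eq2, hC.eq_m, val, ne_eq, Fin.is_lt, hC.act]
  · exact (h.adj1 v).ne.symm
  · exact (h.adj2 v).ne.symm
  · exact (h.adj12 v).ne
  · exact h.pair_eq (h.adj1 v).symm (h.adj12 v) (h.adj2 v)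
  · exact h.pair_eq (h.adj2 v).symm (h.adj12 v).symm (h.adj1 v)
  · exact h.m_m v

variable [DecidableEq V]

theorem exists_coloring (h : TriMatching G t1 t2 m) (hC : Coded e t1 t2 m inact T1 T2 M)
    {U : Finset V} (hS : ∀ v, S (e v) = if v ∈ U then 1 else 0)
    (hcol : IsTriColoring n inact T1 T2 M S col) :
    ∃ c : G.Coloring (Fin 3), (∀ v, c v = 2 ↔ v ∈ U) ∧ ∀ v, col (e v) = c v := by
  have act : ∀ v, inact (e v) = 0 := fun v => hC.act _ (e v).2
  refine ⟨SimpleGraph.Coloring.mk (fun v => ⟨col (e v), hcol.lt_three _ (e v).2 (act v)⟩) ?_,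
    fun v => ?_, fun v => rfl⟩
  · intro v w hvw hcw
    rw [Fin.mk.injEq] at hcw
    rcases (h.adj_iff v w).1 hvw with rfl | rfl | rfl
    · exact hcol.ne1 _ (e v).2 (act v) (by rwa [hC.eq1])
    · exact hcol.ne2 _ (e v).2 (act v) (by rwa [hC.eq2])
    · refine hcol.ne_m _ (e v).2 (act v) ?_ (by rwa [hC.eq_m])
      rw [hC.eq_m, ne_eq, Fin.val_inj, e.apply_eq_iff_eq]
      exact hvw.ne.symm
  · have h1 := hcol.two_iff _ (e v).2 (act v)
    rw [hS] at h1
    rw [← Fin.val_inj]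
    refine Iff.trans h1 ?_
    split_ifs <;> simp_all

variable [Fintype V]

/-- A transversal meets every triangle and so attains the upper bound `card_le`, the number of
triangles. -/
theorem isMaximumIndepSet (h : TriMatching G t1 t2 m) (hC : Coded e t1 t2 m inact T1 T2 M)
    (hS : IsTransversal n inact T1 T2 M S) {U : Finset V}
    (hU : ∀ v, S (e v) = if v ∈ U then 1 else 0) :
    G.IsMaximumIndepSet U ∧ U.card = (G.cliqueSet 3).ncard := by
  have sum_eq : ∀ v, S (e v) + S (e (t1 v)) + S (e (t2 v)) = 1 := fun v => by
    rw [← hC.eq1, ← hC.eq2]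
    exact hS.sum_eq _ (e v).2 (hC.act _ (e v).2)
  simp only [hU] at sum_eq
  have hind : G.IsIndepSet (U : Set V) := by
    intro v hv w hw _ hvw
    have h1 := sum_eq v
    rw [if_pos (by simpa using hv)] at h1
    rw [Finset.mem_coe] at hw
    rcases (h.adj_iff v w).1 hvw with rfl | rfl | rfl
    · rw [if_pos hw] at h1
      omega
    · rw [if_pos hw] at h1
      omega
    · have h2 := hS.indep _ (e v).2 (hC.act _ (e v).2)
      rw [hC.eq_m, hU, hU, if_pos (by simpa using hv), if_pos hw, Fin.val_inj,
        e.apply_eq_iff_eq] at h2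
      exact hvw.ne (h2 rfl rfl).symm
  have hcard := (h.card_eq hind).2 fun v => by
    by_contra! hcon
    simpa [hcon] using sum_eq v
  exact ⟨⟨hind, fun W hW => hcard ▸ h.card_le hW⟩, hcard⟩

theorem exists_indepSet (h : TriMatching G t1 t2 m) :
    ∃ U : Finset V, G.IsMaximumIndepSet U ∧ U.card = (G.cliqueSet 3).ncard := by
  obtain ⟨T1, T2, M, hC⟩ := exists_coded (Fintype.equivFin V) t1 t2 m
  obtain ⟨S, hS⟩ := (h.triSys hC).exists_isTransversal
  refine ⟨Finset.univ.filter fun v => S (Fintype.equivFin V v) = 1,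
    h.isMaximumIndepSet hC hS fun v => ?_⟩
  have := hS.sum_eq _ (Fintype.equivFin V v).2 rfl
  simp only [Finset.mem_filter, Finset.mem_univ, true_and]
  split_ifs <;> omega

theorem card_eq_of_maximum (h : TriMatching G t1 t2 m) {U : Finset V}
    (hU : G.IsMaximumIndepSet U) : U.card = (G.cliqueSet 3).ncard := by
  obtain ⟨W, hW, hcard⟩ := h.exists_indepSet
  exact (h.card_le hU.isIndepSet).antisymm (hcard ▸ hU.maximum W hW.isIndepSet)

/-- The maximum is the number of triangles, so a maximum set meets every triangle, and by
independence only once. -/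
theorem isTransversal (h : TriMatching G t1 t2 m) (hC : Coded e t1 t2 m inact T1 T2 M)
    {U : Finset V} (hU : G.IsMaximumIndepSet U) (hS : ∀ v, S (e v) = if v ∈ U then 1 else 0) :
    IsTransversal n inact T1 T2 M S := by
  have hmeet := (h.card_eq hU.isIndepSet).1 (h.card_eq_of_maximum hU)
  have hind : ∀ v w, G.Adj v w → ¬ (v ∈ U ∧ w ∈ U) := fun v w hvw ⟨hv, hw⟩ =>
    hU.isIndepSet hv hw hvw.ne hvw
  refine ⟨forall_lt e fun v hv => absurd (hC.act _ (e v).2) hv, forall_lt e fun v _ => ?_,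
    forall_lt e fun v _ => ?_⟩
  · rw [hC.eq1, hC.eq2, hS, hS, hS]
    have h1 := hmeet v
    have h2 := hind _ _ (h.adj1 v)
    have h3 := hind _ _ (h.adj2 v)
    have h4 := hind _ _ (h.adj12 v)
    split_ifs <;> simp_all
  · rw [hC.eq_m, hS, hS]
    intro h1 h2
    have h3 : v ∈ U := by by_contra h0; simp [h0] at h1
    have h4 : m v ∈ U := by by_contra h0; simp [h0] at h2
    exact absurd ⟨h3, h4⟩ (hind _ _ (h.adj_m v))

end

end TriMatching

theorem InClassT.indepNum_eq {V : Type*} [Fintype V] {G : SimpleGraph V} (hG : InClassT G) :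
    G.indepNum = (G.cliqueSet 3).ncard := by
  classical
  obtain ⟨t1, t2, m, h⟩ := hG.exists_triMatching
  obtain ⟨U, hU, hcard⟩ := h.exists_indepSet
  rw [← hcard, SimpleGraph.maximumIndepSet_card_eq_indepNum U hU]

theorem InClassT.meets {V : Type*} [Fintype V] {G : SimpleGraph V} (hG : InClassT G)
    {S : Finset V} (hS : G.IsMaximumIndepSet S) {t : Finset V} (ht : G.IsNClique 3 t) :
    ∃ v ∈ t, v ∈ S := by
  classical
  obtain ⟨t1, t2, m, h⟩ := hG.exists_triMatching
  obtain ⟨v, hv⟩ : t.Nonempty := Finset.card_pos.1 (by rw [ht.card_eq]; omega)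
  rw [h.clique_eq ht hv]
  rcases (h.card_eq hS.isIndepSet).1 (h.card_eq_of_maximum hS) v with h1 | h1 | h1
  exacts [⟨_, by simp, h1⟩, ⟨_, by simp, h1⟩, ⟨_, by simp, h1⟩]

theorem InClassT.isBipartite {V : Type*} [Fintype V] {G : SimpleGraph V} (hG : InClassT G)
    {S : Finset V} (hS : G.IsMaximumIndepSet S) : (G.induce {v | v ∉ S}).IsBipartite := by
  classical
  obtain ⟨t1, t2, m, h⟩ := hG.exists_triMatching
  obtain ⟨T1, T2, M, hC⟩ := TriMatching.exists_coded (Fintype.equivFin V) t1 t2 m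
  let I : ℕ → ℕ := fun i =>
    if hi : i < Fintype.card V then if (Fintype.equivFin V).symm ⟨i, hi⟩ ∈ S then 1 else 0 else 0
  have hI : ∀ v, I (Fintype.equivFin V v) = if v ∈ S then 1 else 0 := fun v => by simp [I]
  have hT := h.isTransversal hC hS hI
  obtain ⟨col, hcol⟩ := hT.exists_isTriColoring (h.triSys hC)
  obtain ⟨c, hc, -⟩ := h.exists_coloring hC hI hcol
  refine ⟨SimpleGraph.Coloring.mk (fun v => if c v = 0 then 0 else 1) fun {v w} hvw => ?_⟩
  have h1 := c.valid (SimpleGraph.induce_adj.1 hvw)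
  have h2 : c v ≠ 2 := fun e => v.2 ((hc _).1 e)
  have h3 : c w ≠ 2 := fun e => w.2 ((hc _).1 e)
  generalize c v = a at *
  generalize c w = b at *
  revert a b
  decide

/-! ### The algorithms -/

/-- `p` runs in linear time and turns arrays satisfying `P` into arrays satisfying `Q`, for all
values of a parameter that `p` does not know. -/
def RamProg.Turns {α : ℕ → Type*} (p : RamProg) (P Q : ∀ n, α n → (ℕ → ℕ → ℕ) → Prop) : Prop :=
  p.Spec (fun n A => ∃ x, P n x A) (fun n A A' => ∀ x, P n x A → Q n x A')

namespace RamProg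

variable {α : ℕ → Type*} {p q : RamProg} {P Q R : ∀ n, α n → (ℕ → ℕ → ℕ) → Prop}

theorem Turns.seq (h : p.Turns P Q) (h' : q.Turns Q R) : (RamProg.seq p q).Turns P R := by
  refine (Spec.seq h h' fun n A A' ⟨x, hx⟩ hQ => ⟨x, hQ x hx⟩).weaken (fun _ _ h => h) ?_
  rintro n A A'' - ⟨A', h1, h2⟩ x hx
  exact h2 x (h1 x hx)

theorem Spec.turns {Pre : ℕ → (ℕ → ℕ → ℕ) → Prop} {Post : ℕ → (ℕ → ℕ → ℕ) → (ℕ → ℕ → ℕ) → Prop}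
    (h : p.Spec Pre Post) (hP : ∀ n x A, P n x A → Pre n A)
    (hQ : ∀ n x A A', P n x A → Post n A A' → Q n x A') : p.Turns P Q :=
  h.weaken (fun n A ⟨x, hx⟩ => hP n x A hx) fun n A A' _ h x hx => hQ n x A A' hx h

theorem maps_turns (l : List (ℕ × Ex)) (hl : ∀ x ∈ l, x.2.varsLt 2 ∧ x.2.avoids x.1)
    (h : ∀ n x A, P n x A → Q n x (mapsArr n l A)) : (RamProg.maps l).Turns P Q :=
  (RamProg.maps_spec l hl).turns (fun _ _ _ _ => trivial) fun n x A _ hx e => e ▸ h n x A hx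

theorem Turns.computesWithin (h : p.Turns P Q) : ∃ C, ∀ n, 0 < n → ∀ (x : α n) (s : RamState),
    s.reg 0 = n → P n x s.arr →
      ∃ A, Q n x A ∧ ∀ out : Fin n → ℕ, (∀ v : Fin n, A 4 v = out v) → ComputesWithin p s (C * n) out := by
  obtain ⟨C, h⟩ := h
  -- The bound `C * (n + 1)` of the specification is at most `C * 2 * n` because `n` is positive.
  refine ⟨C * 2, fun n hn x s hs hP => ?_⟩
  subst hs
  obtain ⟨t, ht, s', hexec, -, hQ⟩ := h s ⟨x, hP⟩
  refine ⟨s'.arr, hQ x hP, fun out hout => ⟨t, ht.trans ?_, s', hexec, hout⟩⟩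
  rw [mul_assoc]
  exact Nat.mul_le_mul_left C (by omega)

end RamProg

theorem graphInput_holdsLists {n : ℕ} (nb : Fin n → List (Fin n)) :
    HoldsLists nb (graphInput nb).arr := by
  refine fun v => ⟨by simp [graphInput], fun j hj => ?_⟩
  simp only [graphInput]
  rw [dif_pos v.2, if_neg (by omega), if_pos (by omega)]
  simp

theorem graphSetInput_holdsLists {n : ℕ} (nb : Fin n → List (Fin n)) (S : Finset (Fin n)) :
    HoldsLists nb (graphSetInput nb S).arr := by
  refine fun v => ⟨(graphInput_holdsLists nb v).1, fun j hj => ?_⟩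
  rw [← (graphInput_holdsLists nb v).2 j hj]
  simp only [graphSetInput]
  rw [if_neg (by omega)]

section

variable {n : ℕ} {G : SimpleGraph (Fin n)} {nb : Fin n → List (Fin n)} {A : ℕ → ℕ → ℕ}

/-- Using the outer neighbors as mates, and no vertex is excluded. -/
def mateMaps : List (ℕ × Ex) := [(8, .rd 14 (.var 1)), (9, .lit 0)]

theorem TriMatching.not_adj_m {V : Type*} {G : SimpleGraph V} {t1 t2 m : V → V}
    (h : TriMatching G t1 t2 m) {v w : V} (hw : G.Adj v w) : ¬ G.Adj (m v) w := by
  rcases (h.adj_iff v w).1 hw with rfl | rfl | rfl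
  exacts [h.not_adj1 v, h.not_adj2 v, G.irrefl]

/-- A mate has no common neighbour with its vertex, whereas every neighbour of a center does; so no
vertex is a center. None is plain either, hence all are single, and the outer neighbour found is the
mate. The triangle maps are the computed ones, which may list the two other vertices in a different
order from `s1` and `s2`. -/
theorem InClassT.coded (hG : InClassT G) (hnb : IsAdjacencyLists G nb) (hA : HoldsLists nb A) :
    ∃ t1 t2 m, TriMatching G t1 t2 m ∧ TriMatching.Coded (Equiv.refl (Fin n)) t1 t2 m
      (mapsArr n mateMaps (mapsArr n prepMaps A) 9) (mapsArr n mateMaps (mapsArr n prepMaps A) 6)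
      (mapsArr n mateMaps (mapsArr n prepMaps A) 7)
      (mapsArr n mateMaps (mapsArr n prepMaps A) 8) := by
  obtain ⟨s1, s2, m, hs⟩ := hG.exists_triMatching
  have h3 : ∀ v, (nb v).length ≤ 3 := by
    intro v
    rw [← List.toFinset_card_of_nodup (hnb v).1]
    refine (Finset.card_le_card (t := {s1 v, s2 v, m v}) fun w hw => ?_).trans Finset.card_le_three
    rw [List.mem_toFinset, (hnb v).2, hs.adj_iff] at hw
    simpa using hw
  have hclaw : ∀ v x y z, NatAdj G v x → NatAdj G v y → NatAdj G v z → x ≠ y → x ≠ z → y ≠ z →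
      NatAdj G x y ∨ NatAdj G x z ∨ NatAdj G y z := by
    rintro v x y z ⟨hv, hx, h1⟩ ⟨_, hy, h2⟩ ⟨_, hz, h3⟩ hxy hxz hyz
    have key : ∀ a b, s1 ⟨v, hv⟩ = a → s2 ⟨v, hv⟩ = b → NatAdj G a b ∧ NatAdj G b a := by
      rintro _ _ rfl rfl
      exact ⟨natAdj_val.2 (hs.adj12 _), natAdj_val.2 (hs.adj12 _).symm⟩
    rw [hs.adj_iff] at h1 h2 h3
    rcases h1 with h1 | h1 | h1 <;> rcases h2 with h2 | h2 | h2 <;>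
      rcases h3 with h3 | h3 | h3 <;> simp only [Fin.ext_iff] at h1 h2 h3 <;> first
      | omega
      | exact .inl (key ⟨x, hx⟩ ⟨y, hy⟩ (Fin.ext h1.symm) (Fin.ext h2.symm)).1
      | exact .inl (key ⟨y, hy⟩ ⟨x, hx⟩ (Fin.ext h2.symm) (Fin.ext h1.symm)).2
      | exact .inr (.inl (key ⟨x, hx⟩ ⟨z, hz⟩ (Fin.ext h1.symm) (Fin.ext h3.symm)).1)
      | exact .inr (.inl (key ⟨z, hz⟩ ⟨x, hx⟩ (Fin.ext h3.symm) (Fin.ext h1.symm)).2)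
      | exact .inr (.inr (key ⟨y, hy⟩ ⟨z, hz⟩ (Fin.ext h2.symm) (Fin.ext h3.symm)).1)
      | exact .inr (.inr (key ⟨z, hz⟩ ⟨y, hy⟩ (Fin.ext h3.symm) (Fin.ext h2.symm)).2)
  have hL := prepMaps_locTri hnb h3 hclaw hA
  generalize mapsArr n prepMaps A = B at hL ⊢
  have common : ∀ v : Fin n, ∀ w, NatAdj G v w → NatAdj G (m v) w → False := by
    rintro v w ⟨_, hw, h1⟩ ⟨_, _, h2⟩
    exact hs.not_adj_m (v := v) (w := ⟨w, hw⟩) h1 h2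
  have hadjm : ∀ v : Fin n, NatAdj G v (m v) := fun v => natAdj_val.2 (hs.adj_m v)
  have single : ∀ v : Fin n, SingleAt (NatAdj G) (B 6) (B 7) (B 14) (B 15) v := by
    intro v
    rcases hL.cases v v.2 with h1 | h1 | h1
    · exact h1
    · obtain ⟨x, y, z, hx, hy, hz, -, hyx, hyz, hall⟩ := h1.nbr
      exfalso
      have key : ∀ a b, NatAdj G v b → NatAdj G a b → (m v : ℕ) ≠ a := by
        rintro a b h2 h3 rfl
        exact common v b h2 h3
      rcases hall _ (hadjm v) with e | e | e
      exacts [key x y hy (hL.symm _ _ hyx) e, key y x hx hyx e, key z y hy (hL.symm _ _ hyz) e]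
    · exact absurd (natAdj_val.2 (hs.adj12 v)) (h1.not_adj _ _ (natAdj_val.2 (hs.adj1 v))
        (natAdj_val.2 (hs.adj2 v)))
  have mate : ∀ v : Fin n, B 14 v = m v := by
    intro v
    have h1 := single v
    rcases h1.nbr _ (hadjm v) with e | e | e
    · exact (common v _ h1.adj2 (e ▸ h1.adj12)).elim
    · exact (common v _ h1.adj1 (e ▸ hL.symm _ _ h1.adj12)).elim
    · exact e.symm
  refine ⟨fun v => ⟨B 6 v, hL.lt' (single v).adj1⟩, fun v => ⟨B 7 v, hL.lt' (single v).adj2⟩, m,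
    ⟨fun v w => ⟨fun hw => ?_, ?_⟩, fun v => natAdj_val.1 (single v).adj12,
      fun v => hs.not_adj_m (natAdj_val.1 (single v).adj1),
      fun v => hs.not_adj_m (natAdj_val.1 (single v).adj2)⟩,
    fun v hv => ?_, fun v => ?_, fun v => ?_, fun v => ?_⟩
  · have := (single v).nbr w (natAdj_val.2 hw)
    rw [mate] at this
    simpa only [Fin.ext_iff] using this
  · rintro (rfl | rfl | rfl)
    exacts [natAdj_val.1 (single v).adj1, natAdj_val.1 (single v).adj2, hs.adj_m v]
  · simp [mateMaps, mapsArr, mapArr_self, hv, Ex.eval]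
  · simp [mateMaps, mapsArr, mapArr_of_ne]
  · simp [mateMaps, mapsArr, mapArr_of_ne]
  · simp [mateMaps, mapsArr, mapArr_of_ne, mapArr_self, Ex.eval, mate]

end

/-- The arrays hold the triangles and the mates of the vertices of `G`. -/
def HoldsTriangles (n : ℕ) (G : SimpleGraph (Fin n)) (A : ℕ → ℕ → ℕ) : Prop :=
  ∃ t1 t2 m, TriMatching G t1 t2 m ∧
    TriMatching.Coded (Equiv.refl (Fin n)) t1 t2 m (A 9) (A 6) (A 7) (A 8)

def trianglesProg : RamProg := .seq (.maps prepMaps) (.maps mateMaps)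

/-- The search for a maximum independent set. -/
def independentSetProg : RamProg :=
  .seq trianglesProg (.seq transversalProg (.maps [(4, .rd 5 (.var 1))]))

theorem independentSetProg_turns :
    independentSetProg.Turns
      (fun n (G : SimpleGraph (Fin n)) A => InClassT G ∧ ∃ nb, IsAdjacencyLists G nb ∧
        HoldsLists nb A)
      (fun n G A => ∃ S : Finset (Fin n), G.IsMaximumIndepSet S ∧
        ∀ v : Fin n, A 4 v = if v ∈ S then 1 else 0) := by
  have h1 : trianglesProg.Turns
      (fun n (G : SimpleGraph (Fin n)) A => InClassT G ∧ ∃ nb, IsAdjacencyLists G nb ∧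
        HoldsLists nb A) HoldsTriangles := by
    refine (RamProg.maps_turns (Q := fun n G A => HoldsTriangles n G (mapsArr n mateMaps A))
      prepMaps (by decide) ?_).seq (RamProg.maps_turns mateMaps (by decide) fun _ _ _ h => h)
    rintro n G A ⟨hG, nb, hnb, hA⟩
    exact hG.coded hnb hA
  have h2 : transversalProg.Turns HoldsTriangles (fun n (G : SimpleGraph (Fin n)) A =>
      ∃ S : Finset (Fin n), G.IsMaximumIndepSet S ∧
        ∀ v : Fin n, A 5 v = if v ∈ S then 1 else 0) := by
    refine transversalProg_spec.turns (fun n G A ⟨t1, t2, m, h, hC⟩ => h.triSys hC) ?_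
    rintro n G A A' ⟨t1, t2, m, h, hC⟩ ⟨-, hS⟩
    have hU : ∀ v : Fin n, A' 5 v =
        if v ∈ (Finset.univ.filter fun v : Fin n => A' 5 v = 1) then 1 else 0 := by
      intro v
      have := hS.sum_eq v v.2 (hC.act v v.2)
      simp only [Finset.mem_filter, Finset.mem_univ, true_and]
      split_ifs <;> omega
    exact ⟨_, (h.isMaximumIndepSet hC hS hU).1, hU⟩
  refine h1.seq (h2.seq (RamProg.maps_turns _ (by decide) ?_))
  rintro n G A ⟨S, hS, hA⟩
  exact ⟨S, hS, fun v => by simp [mapsArr, mapArr_self, Ex.eval, hA]⟩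

/-- The coloring of the complement of a maximum independent set by two colors. -/
def complementColoringProg : RamProg := .seq trianglesProg colorProg

theorem complementColoringProg_turns :
    complementColoringProg.Turns (α := fun n => SimpleGraph (Fin n) × Finset (Fin n))
      (fun n x A => InClassT x.1 ∧ x.1.IsMaximumIndepSet x.2 ∧
        (∀ v : Fin n, A 5 v = if v ∈ x.2 then 1 else 0) ∧ ∃ nb, IsAdjacencyLists x.1 nb ∧
        HoldsLists nb A)
      (fun n x A => ∃ c : x.1.Coloring (Fin 3), (∀ v, c v = 2 ↔ v ∈ x.2) ∧
        ∀ v : Fin n, A 4 v = c v) := by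
  have h1 : trianglesProg.Turns (α := fun n => SimpleGraph (Fin n) × Finset (Fin n))
      (fun n x A => InClassT x.1 ∧ x.1.IsMaximumIndepSet x.2 ∧
        (∀ v : Fin n, A 5 v = if v ∈ x.2 then 1 else 0) ∧ ∃ nb, IsAdjacencyLists x.1 nb ∧
        HoldsLists nb A)
      (fun n x A => x.1.IsMaximumIndepSet x.2 ∧ (∀ v : Fin n, A 5 v = if v ∈ x.2 then 1 else 0) ∧
        HoldsTriangles n x.1 A) := by
    refine (RamProg.maps_turns (Q := fun n x A => x.1.IsMaximumIndepSet x.2 ∧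
      (∀ v : Fin n, mapsArr n mateMaps A 5 v = if v ∈ x.2 then 1 else 0) ∧
        HoldsTriangles n x.1 (mapsArr n mateMaps A))
      prepMaps (by decide) ?_).seq (RamProg.maps_turns mateMaps (by decide) fun _ _ _ h => h)
    rintro n x A ⟨hG, hS, hA5, nb, hnb, hA⟩
    refine ⟨hS, fun v => ?_, hG.coded hnb hA⟩
    rw [← hA5, ← prepMaps_of_ne (n := n) A (b := 5) (by omega)]
    simp [mateMaps, mapsArr, mapArr_of_ne]
  refine h1.seq (colorProg_spec.turns ?_ ?_)
  · rintro n x A ⟨hS, hA, t1, t2, m, h, hC⟩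
    exact ⟨h.triSys hC, h.isTransversal hC hS hA⟩
  · rintro n x A A' ⟨hS, hA, t1, t2, m, h, hC⟩ ⟨-, hcol⟩
    exact h.exists_coloring hC hA hcol

/-! ### Dynamic colorings -/

/-- A coloring of `0, …, n - 1`, read as a function on the natural numbers. -/
def natColor {n : ℕ} (c : Fin n → Fin 3) (v : ℕ) : Fin 3 := if h : v < n then c ⟨v, h⟩ else 0

/-- The arrays hold the neighbors and the triangles of a graph with dynamic coloring `c`, such that
linked vertices in triangles have different colors. -/
structure DynData (n : ℕ) (adj : ℕ → ℕ → Prop) (c : ℕ → Fin 3) (A : ℕ → ℕ → ℕ) : Prop where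
  nbr : NbrFun n adj (A 11) (A 12) (A 13)
  loc : LocTri n adj (A 6) (A 7) (A 14) (A 15)
  proper : ∀ u v, adj u v → c u ≠ c v
  dyn : ∀ v x y, adj v x → adj v y → x ≠ y → (∀ u, adj v u → u = x ∨ u = y) → c x ≠ c y
  link : ∀ u < n, ∀ v < n, A 6 u ≠ u → A 6 v ≠ v → u ≠ v → Linked n (A 14) (A 15) u v → c u ≠ c v

theorem InClassC.dynData {n : ℕ} {G : SimpleGraph (Fin n)} [G.LocallyFinite] (hG : InClassC G)
    {c : Fin n → Fin 3} (hc : IsDynamicColoring G c) {nb : Fin n → List (Fin n)}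
    (hnb : IsAdjacencyLists G nb) {A : ℕ → ℕ → ℕ} (hA : HoldsLists nb A) :
    DynData n (NatAdj G) (natColor c) (mapsArr n prepMaps A) := by
  have h3 : ∀ v, (nb v).length ≤ 3 := fun v => (hnb.length_eq v).trans_le (hG.1 v)
  have hclaw : ∀ v x y z, NatAdj G v x → NatAdj G v y → NatAdj G v z → x ≠ y → x ≠ z → y ≠ z →
      NatAdj G x y ∨ NatAdj G x z ∨ NatAdj G y z := by
    rintro v x y z ⟨hv, hx, h1⟩ ⟨_, hy, h2⟩ ⟨_, hz, h3⟩ hxy hxz hyz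
    refine (hG.2.1.adj_or h1 h2 h3 ?_ ?_ ?_).imp (fun e => ⟨hx, hy, e⟩)
      (Or.imp (fun e => ⟨hx, hz, e⟩) fun e => ⟨hy, hz, e⟩) <;> simpa [Fin.ext_iff]
  have hL := prepMaps_locTri hnb h3 hclaw hA
  refine ⟨prepMaps_nbrFun hnb h3 hA, hL, ?_, ?_, ?_⟩
  · rintro u v ⟨hu, hv, h⟩
    simpa [natColor, hu, hv] using hc.1 _ _ h
  · rintro v x y ⟨hv, hx, h1⟩ ⟨_, hy, h2⟩ hxy hall
    simp only [natColor, hx, hy, dif_pos]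
    refine hc.ne_of_degree_le_two h1 h2 (by simpa [Fin.ext_iff]) fun u hu => ?_
    simpa only [Fin.ext_iff] using hall u ⟨hv, u.2, hu⟩
  · intro u hu v hv hTu hTv huv hl
    simp only [natColor, hu, hv, dif_pos]
    exact hL.color_ne hG hc (u := ⟨u, hu⟩) (v := ⟨v, hv⟩) hTu hTv (by simpa [Fin.ext_iff]) hl

/-- The arrays hold in addition the labels and ends of the components, the vertices outside
isolated triangles, and the opposite ends of diamonds. -/
structure LinkData (n : ℕ) (adj : ℕ → ℕ → Prop) (c : ℕ → Fin 3) (A : ℕ → ℕ → ℕ) : Prop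
    extends DynData n adj c A where
  linking : IsLinking n (A 14) (A 15) c (A 16) (A 17) (A 8) (A 18)
  inact : ∀ v < n, A 9 v = 0 ↔ A 6 v ≠ v ∧ A 6 (A 6 v) ≠ A 6 v
  opp : ∀ v < n, A 19 v = opposite (A 11) (A 12) (A 13) (A 6) (A 7) v

namespace LinkData

variable {n : ℕ} {adj : ℕ → ℕ → Prop} {c : ℕ → Fin 3} {A : ℕ → ℕ → ℕ}

/-- The searches and colourings that follow change only arrays 4, 5 and 10, to which no field
refers. -/
theorem congr (h : LinkData n adj c A) {A' : ℕ → ℕ → ℕ}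
    (hA : ∀ b, b ≠ 4 → b ≠ 5 → b ≠ 10 → A' b = A b) : LinkData n adj c A' := by
  have e : A' 6 = A 6 ∧ A' 7 = A 7 ∧ A' 8 = A 8 ∧ A' 9 = A 9 ∧ A' 11 = A 11 ∧ A' 12 = A 12 ∧
      A' 13 = A 13 ∧ A' 14 = A 14 ∧ A' 15 = A 15 ∧ A' 16 = A 16 ∧ A' 17 = A 17 ∧ A' 18 = A 18 ∧
      A' 19 = A 19 := by
    refine ⟨?_, ?_, ?_, ?_, ?_, ?_, ?_, ?_, ?_, ?_, ?_, ?_, ?_⟩ <;>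
      exact hA _ (by omega) (by omega) (by omega)
  obtain ⟨e6, e7, e8, e9, e11, e12, e13, e14, e15, e16, e17, e18, e19⟩ := e
  obtain ⟨⟨h1, h2, h3, h4, h5⟩, h6, h7, h8⟩ := h
  constructor
  · constructor <;> simpa only [e6, e7, e8, e9, e11, e12, e13, e14, e15, e16, e17, e18, e19]
  all_goals simpa only [e6, e7, e8, e9, e11, e12, e13, e14, e15, e16, e17, e18, e19]

theorem triSys (h : LinkData n adj c A) : TriSys n (A 9) (A 6) (A 7) (A 8) :=
  h.loc.triSys h.inact fun v hv ho => ⟨(h.linking.ends v hv ho).1, (h.linking.ends v hv ho).2.1⟩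

theorem root_ne (h : LinkData n adj c A) : ∀ u < n, ∀ v < n, A 6 u ≠ u → A 6 v ≠ v → u ≠ v →
    A 17 u = A 17 v → c u ≠ c v := by
  intro u hu v hv hTu hTv huv hr
  have h1 := h.linking.linked u hu
  rw [hr] at h1
  exact h.link u hu v hv hTu hTv huv (.trans _ _ _ h1 (.symm _ _ (h.linking.linked v hv)))

theorem diaSys (h : LinkData n adj c A) : DiaSys n (A 6) (A 7) (A 19) (A 8) :=
  h.loc.diaSys h.nbr h.proper h.opp h.linking h.root_ne

end LinkData

/-- The computation of a dynamic coloring with three colors. -/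
def dynamicColoringProg : RamProg :=
  .seq (.maps prepMaps) <| .seq linkProg <| .seq (.maps diamondMaps) <| .seq transversalProg <|
    .seq colorProg <| .seq diamondProg <| .maps fillMaps

/-- The parameter includes some dynamic colouring besides the graph. It only feeds the invariants,
so the mere existence of one suffices for the program to succeed. -/
theorem dynamicColoringProg_turns :
    dynamicColoringProg.Turns (α := fun n => SimpleGraph (Fin n) × (Fin n → Fin 3))
      (fun _ x A => ∃ _ : x.1.LocallyFinite, InClassC x.1 ∧ IsDynamicColoring x.1 x.2 ∧
        ∃ nb, IsAdjacencyLists x.1 nb ∧ HoldsLists nb A)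
      (fun n x A => (∀ v < n, A 4 v < 3) ∧
        (∀ u v : Fin n, x.1.Adj u v → A 4 u ≠ A 4 v) ∧
        ∀ v a b : Fin n, x.1.Adj v a → x.1.Adj v b → a ≠ b → ∃ a b : Fin n, x.1.Adj v a ∧
          x.1.Adj v b ∧ A 4 a ≠ A 4 b) := by
  refine RamProg.Turns.seq (Q := fun n x A => DynData n (NatAdj x.1) (natColor x.2) A)
    (RamProg.maps_turns prepMaps (by decide) ?_) <|
    RamProg.Turns.seq (Q := fun n x A => DynData n (NatAdj x.1) (natColor x.2) A ∧
      IsLinking n (A 14) (A 15) (natColor x.2) (A 16) (A 17) (A 8) (A 18))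
    (linkProg_spec.turns ?_ ?_) <|
    RamProg.Turns.seq (Q := fun n x A => LinkData n (NatAdj x.1) (natColor x.2) A)
    (RamProg.maps_turns diamondMaps (by decide) ?_) <|
    RamProg.Turns.seq (Q := fun n x A => LinkData n (NatAdj x.1) (natColor x.2) A ∧
      IsTransversal n (A 9) (A 6) (A 7) (A 8) (A 5))
    (transversalProg_spec.turns ?_ ?_) <|
    RamProg.Turns.seq (Q := fun n x A => LinkData n (NatAdj x.1) (natColor x.2) A ∧
      IsTriColoring n (A 9) (A 6) (A 7) (A 8) (A 5) (A 4))
    (colorProg_spec.turns ?_ ?_) <|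
    RamProg.Turns.seq (Q := fun n x A => LinkData n (NatAdj x.1) (natColor x.2) A ∧
      TriColored n (NatAdj x.1) (A 6) (A 7) (A 14) (A 15) (A 8) (A 4))
    (diamondProg_spec.turns ?_ ?_) <|
    RamProg.maps_turns fillMaps (by decide) ?_
  · rintro n x A ⟨_, hG, hc, nb, hnb, hA⟩
    exact hG.dynData hc hnb hA
  · intro n x A h
    exact ⟨_, h.loc.pathSys h.proper h.dyn⟩
  · rintro n x A A' h ⟨hA, hL⟩
    have e : ∀ b, b = 6 ∨ b = 7 ∨ b = 11 ∨ b = 12 ∨ b = 13 ∨ b = 14 ∨ b = 15 → A' b = A b :=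
      fun b hb => hA b (by omega) (by omega) (by omega) (by omega)
    have hl := hL _ (h.loc.pathSys h.proper h.dyn)
    obtain ⟨h1, h2, h3, h4, h5⟩ := h
    have e6 := e 6 (by omega)
    have e7 := e 7 (by omega)
    have e11 := e 11 (by omega)
    have e12 := e 12 (by omega)
    have e13 := e 13 (by omega)
    have e14 := e 14 (by omega)
    have e15 := e 15 (by omega)
    refine ⟨⟨?_, ?_, ?_, ?_, ?_⟩, ?_⟩ <;> simpa only [e6, e7, e11, e12, e13, e14, e15]
  · rintro n x A ⟨⟨h1, h2, h3, h4, h5⟩, hl⟩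
    obtain ⟨e, h9, h19⟩ := diamondMaps_spec (n := n) A
    have e6 := e 6 (by omega) (by omega)
    have e7 := e 7 (by omega) (by omega)
    have e8 := e 8 (by omega) (by omega)
    have e11 := e 11 (by omega) (by omega)
    have e12 := e 12 (by omega) (by omega)
    have e13 := e 13 (by omega) (by omega)
    have e14 := e 14 (by omega) (by omega)
    have e15 := e 15 (by omega) (by omega)
    have e16 := e 16 (by omega) (by omega)
    have e17 := e 17 (by omega) (by omega)
    have e18 := e 18 (by omega) (by omega)
    constructor
    · constructor <;> simpa only [e6, e7, e8, e11, e12, e13, e14, e15, e16, e17, e18]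
    all_goals simpa only [e6, e7, e8, e11, e12, e13, e14, e15, e16, e17, e18]
  · exact fun n x A h => h.triSys
  · rintro n x A A' h ⟨hA, hS⟩
    refine ⟨h.congr fun b _ h5 h10 => hA b h5 h10, ?_⟩
    rwa [hA 9 (by omega) (by omega), hA 6 (by omega) (by omega), hA 7 (by omega) (by omega),
      hA 8 (by omega) (by omega)]
  · exact fun n x A h => ⟨h.1.triSys, h.2⟩
  · rintro n x A A' ⟨h, -⟩ ⟨hA, hcol⟩
    refine ⟨h.congr fun b h4 _ _ => hA b h4, ?_⟩
    rwa [hA 9 (by omega), hA 6 (by omega), hA 7 (by omega), hA 8 (by omega), hA 5 (by omega)]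
  · exact fun n x A h => ⟨h.1.diaSys, h.1.diaSys.diaColoring h.1.inact h.1.opp h.2⟩
  · rintro n x A A' ⟨h, hcol⟩ ⟨hA, hD, hdone⟩
    refine ⟨h.congr fun b h4 _ _ => hA b h4, ?_⟩
    rw [hA 6 (by omega), hA 7 (by omega), hA 14 (by omega), hA 15 (by omega), hA 8 (by omega)]
    exact h.loc.triColored h.nbr h.proper h.inact h.opp h.diaSys hcol hD hdone
  · rintro n x A ⟨h, hcol⟩
    obtain ⟨h1, h2, h3⟩ := h.loc.finalColor_spec h.proper h.dyn h.linking h.root_ne hcol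
    have e : ∀ v < n, mapsArr n fillMaps A 4 v =
        finalColor (A 16) (A 17) (A 8) (A 18) (A 4) v := fun v hv =>
      fillMaps_spec A hv (h.linking.inside v hv).1 (h.linking.inside v hv).2.2.1
    refine ⟨fun v hv => (e v hv).trans_lt (h1 v hv), fun u v huv => ?_, fun v a b ha hb hab => ?_⟩
    · rw [e u u.2, e v v.2]
      exact h2 u v (natAdj_val.2 huv)
    · obtain ⟨a, b, ⟨_, ha, h4⟩, ⟨_, hb, h5⟩, h6⟩ := h3 v a b (natAdj_val.2 ha) (natAdj_val.2 hb)
        fun e => hab (Fin.ext e)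
      rw [← e a ha, ← e b hb] at h6
      exact ⟨⟨a, ha⟩, ⟨b, hb⟩, h4, h5, h6⟩

theorem mainTheorem8 :
    -- dynamic 3-coloring of the graphs in `𝒞` in linear time
    (∃ (p : RamProg) (C : ℕ), ∀ (n : ℕ) (G : SimpleGraph (Fin n)) [DecidableRel G.Adj],
      G.Connected → InClassC G → (∃ c : Fin n → Fin 3, IsDynamicColoring G c) →
      ∀ nb : Fin n → List (Fin n), IsAdjacencyLists G nb →
        ∃ c : Fin n → Fin 3, IsDynamicColoring G c ∧ (3 ≤ n → Function.Surjective c) ∧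
          ComputesWithin p (graphInput nb) (C * n) (fun v => (c v : ℕ))) ∧
    -- maximum independent sets of the graphs in `𝒯`
    (∀ (V : Type*) [Fintype V] (G : SimpleGraph V), InClassT G →
      G.indepNum = (G.cliqueSet 3).ncard ∧
      ∀ S : Finset V, G.IsMaximumIndepSet S →
        (∀ t : Finset V, G.IsNClique 3 t → ∃ v ∈ t, v ∈ S) ∧
        (G.induce {v | v ∉ S}).IsBipartite) ∧
    -- finding such a set in linear time
    (∃ (p : RamProg) (C : ℕ), ∀ (n : ℕ) (G : SimpleGraph (Fin n)),
      G.Connected → InClassT G →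
      ∀ nb : Fin n → List (Fin n), IsAdjacencyLists G nb →
        ∃ S : Finset (Fin n), G.IsMaximumIndepSet S ∧
          ComputesWithin p (graphInput nb) (C * n) (fun v => if v ∈ S then 1 else 0)) ∧
    -- coloring the remainder by two colors in linear time, with the third color on the given set
    (∃ (p : RamProg) (C : ℕ), ∀ (n : ℕ) (G : SimpleGraph (Fin n)),
      G.Connected → InClassT G →
      ∀ nb : Fin n → List (Fin n), IsAdjacencyLists G nb →
      ∀ S : Finset (Fin n), G.IsMaximumIndepSet S →
        ∃ c : G.Coloring (Fin 3), (∀ v, c v = 2 ↔ v ∈ S) ∧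
          ComputesWithin p (graphSetInput nb S) (C * n) (fun v => (c v : ℕ))) := by

  refine ⟨?_, fun V _ G hG => ⟨hG.indepNum_eq, fun S hS =>
    ⟨fun t ht => hG.meets hS ht, hG.isBipartite hS⟩⟩, ?_, ?_⟩
  · obtain ⟨C, h⟩ := dynamicColoringProg_turns.computesWithin
    refine ⟨dynamicColoringProg, C, fun n G _ hconn hG ⟨c, hc⟩ nb hnb => ?_⟩
    -- A connected graph has a vertex, which gives the positivity of `n` needed for a bound `C * n`.
    obtain ⟨v⟩ := hconn.nonempty
    obtain ⟨A, ⟨h1, h2, h3⟩, hA⟩ := h n v.pos (G, c) (graphInput nb) rfl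
      ⟨inferInstance, hG, hc, nb, hnb, graphInput_holdsLists nb⟩
    have hd : IsDynamicColoring G fun v : Fin n => (⟨A 4 v, h1 v v.2⟩ : Fin 3) :=
      IsDynamicColoring.of_two_neighbors (by simpa using h2) (by simpa using h3)
    exact ⟨_, hd, fun hn => hd.surjective hconn (by simpa using hn), hA _ fun v => rfl⟩
  · obtain ⟨C, h⟩ := independentSetProg_turns.computesWithin
    refine ⟨independentSetProg, C, fun n G hconn hG nb hnb => ?_⟩
    obtain ⟨v⟩ := hconn.nonempty
    obtain ⟨A, ⟨S, hS, h1⟩, hA⟩ := h n v.pos G (graphInput nb) rfl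
      ⟨hG, nb, hnb, graphInput_holdsLists nb⟩
    refine ⟨S, hS, hA _ fun v => ?_⟩
    rw [h1]
  · obtain ⟨C, h⟩ := complementColoringProg_turns.computesWithin
    refine ⟨complementColoringProg, C, fun n G hconn hG nb hnb S hS => ?_⟩
    obtain ⟨v⟩ := hconn.nonempty
    obtain ⟨A, ⟨c, hc, h1⟩, hA⟩ := h n v.pos (G, S) (graphSetInput nb S) rfl
      ⟨hG, hS, fun v => by simp [graphSetInput, Fin.val_inj], nb, hnb,
        graphSetInput_holdsLists nb S⟩
    exact ⟨c, hc, hA _ h1⟩
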